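/- **Conventions.** A prederivator is a strict $2$-functor $\mathscr D\colon \mathrm{Cat}^{\mathrm{op}}\to\mathrm{CAT}$; morphisms of prederivators are pseudo-natural transformations, $2$-cells are modifications, and adjunctions of morphisms are taken in the resulting $2$-category. For a small category $B$ write $\mathscr D^B(A)=\mathscr D(B\times A)$, and for a functor $u\colon B\to B'$ write $u^*\colon \mathscr D^{B'}\to\mathscr D^{B}$ for restriction, with left and right adjoints $u_!$ and $u_*$ (Kan extensions) when they exist. A stable derivator is a prederivator satisfying (Der1)–(Der4) such that $\mathscr D(\mathbb 1)$ has a zero object and the cartesian and the cocartesian squares coincide. With $\square=[1]\times[1]$ and $i_\ulcorner\colon\ulcorner\to\square$ the full subcategory without the terminal object $(1,1)$, the suspension of a pointed derivator $\mathscr E$ is the morphism $\Sigma=(1,1)^*\circ(i_\ulcorner)_!\circ(0,0)_*\colon\mathscr E\to\mathscr E$, where $(0,0)_*\colon\mathscr E\to\mathscr E^{\ulcorner}$ is right Kan extension along $(0,0)\colon\mathbb 1\to\ulcorner$; it is well defined up to isomorphism. Let $n\ge 1$ and let $A_n$ be the poset $1<\dots<n$. Let $M_n$ be the category with objects $(k,l)$,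 $k\in\mathbb Z$, $0\le l\le n+1$, generated by arrows $(k,l)\to(k,l+1)$ and $(k,l+1)\to(k+1,l)$ subject to the commutativity of all squares; it is the poset in which $(k,l)\le(k',l')$ iff $k\le k'$ and $k+l\le k'+l'$. For a stable derivator $\mathscr D$ let $\mathscr D^{M_n,\mathrm{ex}}\subseteq\mathscr D^{M_n}$ be spanned by all coherent diagrams $X\in\mathscr D(M_n\times A)$, $A\in\mathrm{Cat}$, which vanish at $(k,0)$ and $(k,n+1)$ for all $k\in\mathbb Z$ and for which all squares $(k,l),(k,l+1),(k+1,l-1),(k+1,l)$ with $1\le l\le n$ are bicartesian. Let $f\colon M_n\to M_n$, $f(k,l)=(k+l,n+1-l)$, and $j\colon A_n\to M_n$, $j(l)=(l,n+1-l)$. Finally let $$F=(i_4)_*(i_3)_!(i_2)_!(i_1)_*\colon\mathscr D^{A_n}\to\mathscr D^{M_n},$$ where $A_n\xrightarrow{i_1}K_1\xrightarrow{i_2}K_2\xrightarrow{i_3}K_3\xrightarrow{i_4}M_n$ factors $l\mapsto(0,l)$ through the following full subcategories of $M_n$: $K_1$ consists of the $(0,l)$ with $1\le l\le n$, the $(k,n+1)$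 with $k\ge0$ and the $(k,0)$ with $k>0$; $K_2$ is obtained from $K_1$ by adding all $(k,l)$ with $k>0$; $K_3$ is obtained from $K_2$ by adding the $(k,n+1)$ with $k<0$ and the $(k,0)$ with $k\le0$. **Theorem.** Let $\mathscr D$ be a stable derivator and $n\ge1$. 1. $\mathscr D^{M_n,\mathrm{ex}}$ is stable under restriction, hence a full subprederivator of $\mathscr D^{M_n}$, and it admits the suspension morphism $\Sigma$. The isomorphism $f^*\colon\mathscr D^{M_n}\to\mathscr D^{M_n}$ restricts to an isomorphism $f^*\colon\mathscr D^{M_n,\mathrm{ex}}\to\mathscr D^{M_n,\mathrm{ex}}$, and there is a natural isomorphism (an invertible modification) $\Sigma\cong f^*\colon\mathscr D^{M_n,\mathrm{ex}}\to\mathscr D^{M_n,\mathrm{ex}}$. 2. The morphisms $F\colon\mathscr D^{A_n}\to\mathscr D^{M_n}$ and $\Sigma\colon\mathscr D^{A_n}\to\mathscr D^{A_n}$ exist, and there is a natural isomorphism $\Sigma\cong j^*F\colon\mathscr D^{A_n}\to\mathscr D^{A_n}$. -/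

import Mathlib

open CategoryTheory Opposite
open scoped Bicategory Pseudofunctor.StrongTrans

universe w v u

noncomputable section

namespace DerivatorTheory

/-! ### Prederivators -/

instance strictCatOp : Bicategory.Strict (Cat.{w, w})ᵒᵖ where
  id_comp f := rfl
  comp_id f := rfl
  assoc f g h := rfl
  leftUnitor_eqToIso f := by
    ext; rfl
  rightUnitor_eqToIso f := by
    ext; rfl
  associator_eqToIso f g h := by
    ext; rfl

set_option linter.checkUnivs false in
/-- A prederivator: a strict 2-functor from small categories (with the direction of the functors
reversed and that of the natural transformations kept) to not necessarily small categories.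
Morphisms of prederivators are pseudo-natural transformations and 2-cells are modifications:
they are the 1-cells `D.toPseudofunctor ⟶ E.toPseudofunctor` and the 2-cells between these in
the bicategory of pseudofunctors. -/
abbrev Prederivator : Type _ := StrictPseudofunctor (Cat.{w, w})ᵒᵖ Cat.{v, u}

/-! ### Auxiliary facts on strict 2-functors -/

section

variable {B : Type*} [Bicategory B] [Bicategory.Strict B] {C : Type*} [Bicategory C]
  [Bicategory.Strict C]

/-- A family of 1-cells which is strictly 2-natural is a pseudo-natural transformation. -/
def strictTrans (F G : StrictPseudofunctor B C)
    (app : ∀ a, F.obj a ⟶ G.obj a)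
    (h : ∀ {a b : B} (f : a ⟶ b), F.map f ≫ app b = app a ≫ G.map f)
    (h₂ : ∀ {a b : B} {f g : a ⟶ b} (η : f ⟶ g),
      F.map₂ η ▷ app b ≫ eqToHom (h g) = eqToHom (h f) ≫ app a ◁ G.map₂ η) :
    F.toPseudofunctor ⟶ G.toPseudofunctor where
  app := app
  naturality f := eqToIso (h f)
  naturality_naturality η := h₂ η
  naturality_id a := by
    simp [StrictlyUnitaryPseudofunctor.mapId_eq_eqToIso, Bicategory.Strict.leftUnitor_eqToIso,
      Bicategory.Strict.rightUnitor_eqToIso]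
  naturality_comp f g := by
    simp [StrictPseudofunctor.mapComp_eq_eqToIso, Bicategory.Strict.associator_eqToIso]

end

lemma eq_id_comp_comp_id {C : Type*} [Category* C] {X Y : C} {f g : X ⟶ Y} (h : f = g) :
    f = 𝟙 X ≫ g ≫ 𝟙 Y := by
  simp [h]

lemma comp_id_eq_id_comp {C : Type*} [Category* C] {X Y : C} {f g : X ⟶ Y} (h : f = g) :
    f ≫ 𝟙 Y = 𝟙 X ≫ g := by
  simp [h]

lemma map₂_square {B : Type*} [Bicategory B] {C : Type*} [Bicategory C]
    (F : StrictPseudofunctor B C) {a b c d : B} {f g : a ⟶ b} {f' g' : c ⟶ d}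
    {k : a ⟶ c} {k' : b ⟶ d} (hf : f ≫ k' = k ≫ f') (hg : g ≫ k' = k ≫ g')
    (η : f ⟶ g) (η' : f' ⟶ g')
    (h : η ▷ k' ≫ eqToHom hg = eqToHom hf ≫ k ◁ η')
    (hf' : F.map f ≫ F.map k' = F.map k ≫ F.map f')
    (hg' : F.map g ≫ F.map k' = F.map k ≫ F.map g') :
    F.map₂ η ▷ F.map k' ≫ eqToHom hg' = eqToHom hf' ≫ F.map k ◁ F.map₂ η' := by
  have h' := congrArg F.map₂ h
  rw [F.map₂_comp, F.map₂_comp, PrelaxFunctor.map₂_eqToHom, PrelaxFunctor.map₂_eqToHom,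
    F.map₂_whisker_right, F.map₂_whisker_left, F.mapComp_eq_eqToIso, F.mapComp_eq_eqToIso,
    F.mapComp_eq_eqToIso, F.mapComp_eq_eqToIso] at h'
  simp only [eqToIso.hom, eqToIso.inv, Category.assoc, eqToHom_trans, eqToHom_trans_assoc] at h'
  have h'' := congrArg (fun t => eqToHom (F.map_comp f k').symm ≫ t ≫ eqToHom (F.map_comp k g')) h'
  simpa using h''

lemma sectR_square {B : Type w} [Category.{w} B] (b : B) {A A' : (Cat.{w, w})ᵒᵖ} (f : A ⟶ A') :
    ((𝟭 B).prod f.unop.toFunctor).toCatHom.op ≫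
      (CategoryTheory.Prod.sectR b A'.unop).toCatHom.op =
    (CategoryTheory.Prod.sectR b A.unop).toCatHom.op ≫ f := by
  apply Quiver.Hom.unop_inj
  apply Cat.ext
  rfl

lemma cat_eqToHom_app {C C' : Cat.{v, u}} {f g : C ⟶ C'} (h : f = g) (X : C) :
    (eqToHom h).toNatTrans.app X = eqToHom (congrArg (fun t => t.toFunctor.obj X) h) := by
  subst h; rfl

lemma fullSubcategory_eqToHom_hom {C : Type u} [Category.{v} C] {P : ObjectProperty C}
    {X Y : P.FullSubcategory} (h : X = Y) : (eqToHom h).hom = eqToHom (congrArg (·.obj) h) := by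
  subst h; rfl

lemma fullSubcategory_functor_ext {C : Type*} [Category* C] {E : Type*} [Category* E]
    {P : ObjectProperty E} {F G : C ⥤ P.FullSubcategory} (h : F ⋙ P.ι = G ⋙ P.ι) : F = G := by
  have hobj : ∀ X, F.obj X = G.obj X := fun X =>
    ObjectProperty.FullSubcategory.ext (Functor.congr_obj h X)
  refine CategoryTheory.Functor.ext hobj ?_
  intro X Y φ
  apply ObjectProperty.hom_ext
  have := Functor.congr_hom h φ
  simp only [ObjectProperty.FullSubcategory.comp_hom, fullSubcategory_eqToHom_hom]
  exact this

lemma full_conj_app {C : Cat.{v, u}} {C' : Type u} [Category.{v} C'] {P : ObjectProperty C'}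
    {f g g' f' : C ⟶ Cat.of P.FullSubcategory} (h : f = g) (β : g ⟶ g') (h' : g' = f') (X : C) :
    ((eqToHom h ≫ β ≫ eqToHom h').toNatTrans.app X).hom =
      eqToHom (congrArg (fun t => (t.toFunctor.obj X).obj) h) ≫ (β.toNatTrans.app X).hom ≫
        eqToHom (congrArg (fun t => (t.toFunctor.obj X).obj) h') := by
  subst h; subst h'; simp

/-- The strict 2-functor `A ↦ B × A`. -/
def prodOp (B : Type w) [Category.{w} B] :
    StrictPseudofunctor (Cat.{w, w})ᵒᵖ (Cat.{w, w})ᵒᵖ :=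
  StrictPseudofunctor.mk''
    { obj := fun A => op (Cat.of (B × A.unop))
      map := fun u => ((𝟭 B).prod u.unop.toFunctor).toCatHom.op
      map₂ := fun α => Bicategory.Opposite.op2
        (NatTrans.prod (𝟙 (𝟭 B)) α.unop2.toNatTrans).toCatHom₂
      map₂_id := fun u => rfl
      map₂_comp := fun α β => by
        apply congrArg Bicategory.Opposite.op2
        ext x
        exact Prod.ext (Category.comp_id _).symm rfl
      map_id := fun _ => rfl
      map_comp := fun _ _ => rfl
      map₂_whisker_left := fun u _ _ α => by
        refine eq_id_comp_comp_id ?_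
        apply congrArg Bicategory.Opposite.op2
        ext x
        exact Prod.ext rfl rfl
      map₂_whisker_right := fun α u => by
        refine eq_id_comp_comp_id ?_
        apply congrArg Bicategory.Opposite.op2
        ext x
        exact Prod.ext rfl rfl }

namespace Prederivator

variable (D : Prederivator.{w, v, u})

section

variable {A B C E : Type w} [Category.{w} A] [Category.{w} B] [Category.{w} C] [Category.{w} E]

/-- The category of coherent diagrams of shape `A`. -/
abbrev val (A : Type w) [Category.{w} A] : Cat.{v, u} := D.obj (op (Cat.of A))

/-- The restriction functor along `k`. -/
abbrev res (k : A ⥤ B) : D.val B ⥤ D.val A := (D.map k.toCatHom.op).toFunctor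

/-- The natural transformation between restriction functors induced by `α`. -/
abbrev resTrans {k k' : A ⥤ B} (α : k ⟶ k') : D.res k ⟶ D.res k' :=
  (D.map₂ (Bicategory.Opposite.op2 α.toCatHom₂)).toNatTrans

lemma res_comp (k : A ⥤ B) (k' : B ⥤ C) : D.res (k ⋙ k') = D.res k' ⋙ D.res k :=
  congrArg Cat.Hom.toFunctor (D.map_comp k'.toCatHom.op k.toCatHom.op)

/-- The transformation `p^* k^* ⟶ q^* l^*` induced by `α : k p ⟶ l q`. -/
def resSquare {p : E ⥤ A} {k : A ⥤ C} {q : E ⥤ B} {l : B ⥤ C} (α : p ⋙ k ⟶ q ⋙ l) :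
    D.res k ⋙ D.res p ⟶ D.res l ⋙ D.res q :=
  eqToHom (D.res_comp p k).symm ≫ D.resTrans α ≫ eqToHom (D.res_comp q l)

/-! ### Derivators -/

/-- The slice category `(k/b)`. -/
abbrev SliceLeft (k : A ⥤ B) (b : B) : Type w := Comma k (Functor.fromPUnit.{w} b)

/-- The slice category `(b/k)`. -/
abbrev SliceRight (b : B) (k : A ⥤ B) : Type w := Comma (Functor.fromPUnit.{w} b) k

/-- For left adjoints `k_!` of `k^*` and `colim` of restriction along `(k/b) ⥤ 1`, the canonical
mate `colim p^* ⟶ b^* k_!`. -/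
def leftMate (k : A ⥤ B) (b : B) {L : D.val A ⥤ D.val B} (adj : L ⊣ D.res k)
    {colim : D.val (SliceLeft k b) ⥤ D.val (Discrete PUnit.{w + 1})}
    (adj' : colim ⊣ D.res (Comma.snd k (Functor.fromPUnit.{w} b))) :
    D.res (Comma.fst k (Functor.fromPUnit.{w} b)) ⋙ colim ⟶
      L ⋙ D.res (Functor.fromPUnit.{w} b) :=
  (mateEquiv adj adj').symm
    (TwoSquare.mk _ _ _ _ (D.resSquare (Comma.natTrans k (Functor.fromPUnit.{w} b))))

/-- For right adjoints `k_*` of `k^*` and `lim` of restriction along `(b/k) ⥤ 1`, the canonical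
mate `b^* k_* ⟶ lim q^*`. -/
def rightMate (k : A ⥤ B) (b : B) {R : D.val A ⥤ D.val B} (adj : D.res k ⊣ R)
    {lim : D.val (SliceRight b k) ⥤ D.val (Discrete PUnit.{w + 1})}
    (adj' : D.res (Comma.fst (Functor.fromPUnit.{w} b) k) ⊣ lim) :
    R ⋙ D.res (Functor.fromPUnit.{w} b) ⟶
      D.res (Comma.snd (Functor.fromPUnit.{w} b) k) ⋙ lim :=
  mateEquiv adj adj'
    (TwoSquare.mk _ _ _ _ (D.resSquare (Comma.natTrans (Functor.fromPUnit.{w} b) k)))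

end

/-- The axioms (Der1) to (Der4) of a derivator. -/
structure IsDerivator : Prop where
  /-- Coproducts of shapes are sent to products. -/
  der1 : ∀ (I : Type w) (A : I → Type w) [∀ i, Category.{w} (A i)],
    (Functor.pi' fun i => D.res (Sigma.incl (C := A) i)).IsEquivalence
  /-- Isomorphisms are detected pointwise. -/
  der2 : ∀ (A : Type w) [Category.{w} A] (X Y : D.val A) (f : X ⟶ Y),
    IsIso f ↔ ∀ a : A, IsIso ((D.res (Functor.fromPUnit.{w} a)).map f)
  /-- Restriction functors have left adjoints. -/
  der3_left : ∀ (A B : Type w) [Category.{w} A] [Category.{w} B] (k : A ⥤ B),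
    (D.res k).IsRightAdjoint
  /-- Restriction functors have right adjoints. -/
  der3_right : ∀ (A B : Type w) [Category.{w} A] [Category.{w} B] (k : A ⥤ B),
    (D.res k).IsLeftAdjoint
  /-- Left Kan extensions are computed pointwise. -/
  der4_left : ∀ (A B : Type w) [Category.{w} A] [Category.{w} B] (k : A ⥤ B) (b : B)
    (L : D.val A ⥤ D.val B) (adj : L ⊣ D.res k)
    (colim : D.val (SliceLeft k b) ⥤ D.val (Discrete PUnit.{w + 1}))
    (adj' : colim ⊣ D.res (Comma.snd k (Functor.fromPUnit.{w} b))),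
    IsIso (D.leftMate k b adj adj')
  /-- Right Kan extensions are computed pointwise. -/
  der4_right : ∀ (A B : Type w) [Category.{w} A] [Category.{w} B] (k : A ⥤ B) (b : B)
    (R : D.val A ⥤ D.val B) (adj : D.res k ⊣ R)
    (lim : D.val (SliceRight b k) ⥤ D.val (Discrete PUnit.{w + 1}))
    (adj' : D.res (Comma.fst (Functor.fromPUnit.{w} b) k) ⊣ lim),
    IsIso (D.rightMate k b adj adj')

end Prederivator

/-! ### The square and its two corners -/

/-- The poset `[1] × [1]`. -/
@[ext]
structure Square : Type w where
  /-- The horizontal coordinate. -/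
  x : Fin 2
  /-- The vertical coordinate. -/
  y : Fin 2

instance : PartialOrder Square.{w} :=
  PartialOrder.lift (fun p => (p.x, p.y)) (by
    rintro ⟨x, y⟩ ⟨x', y'⟩ h
    simpa using h)

/-- The square without its terminal object. -/
abbrev SpanShape : Type w := {p : Square.{w} // p ≠ ⟨1, 1⟩}

/-- The square without its initial object. -/
abbrev CospanShape : Type w := {p : Square.{w} // p ≠ ⟨0, 0⟩}

/-- The inclusion of the span shape into the square. -/
def spanIncl : SpanShape.{w} ⥤ Square.{w} := (Subtype.mono_coe _).functor

/-- The inclusion of the cospan shape into the square. -/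
def cospanIncl : CospanShape.{w} ⥤ Square.{w} := (Subtype.mono_coe _).functor

namespace Prederivator

variable (D : Prederivator.{w, v, u})

/-- A square in `D(□ × A)` is cocartesian if it lies in the essential image of left Kan extension
along the inclusion of the span shape. -/
def IsCocartesian {A : Type w} [Category.{w} A] (X : D.val (Square.{w} × A)) : Prop :=
  ∃ L : D.val (SpanShape.{w} × A) ⥤ D.val (Square.{w} × A),
    Nonempty (L ⊣ D.res (spanIncl.{w}.prod (𝟭 A))) ∧ L.essImage X

/-- A square in `D(□ × A)` is cartesian if it lies in the essential image of right Kan extension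
along the inclusion of the cospan shape. -/
def IsCartesian {A : Type w} [Category.{w} A] (X : D.val (Square.{w} × A)) : Prop :=
  ∃ R : D.val (CospanShape.{w} × A) ⥤ D.val (Square.{w} × A),
    Nonempty (D.res (cospanIncl.{w}.prod (𝟭 A)) ⊣ R) ∧ R.essImage X

/-- Stable derivators: pointed derivators in which cartesian and cocartesian squares coincide. -/
structure IsStableDerivator : Prop extends D.IsDerivator where
  /-- The underlying category has a zero object. -/
  pointed : Limits.HasZeroObject (D.val (Discrete PUnit.{w + 1}))
  /-- A square is cocartesian if and only if it is cartesian. -/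
  cocartesian_iff_cartesian : ∀ (A : Type w) [Category.{w} A] (X : D.val (Square.{w} × A)),
    D.IsCocartesian X ↔ D.IsCartesian X

/-! ### Shifted prederivators, restriction morphisms and full subprederivators -/

/-- The shifted prederivator `D^B`, with `D^B(A) = D(B × A)`. -/
def shift (B : Type w) [Category.{w} B] : Prederivator.{w, v, u} :=
  StrictPseudofunctor.comp (prodOp B) D

/-- The restriction morphism `k^* : D^B' ⟶ D^B` along `k : B ⥤ B'`. -/
def resMor {B B' : Type w} [Category.{w} B] [Category.{w} B'] (k : B ⥤ B') :
    (D.shift B').toPseudofunctor ⟶ (D.shift B).toPseudofunctor :=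
  strictTrans (D.shift B') (D.shift B)
    (fun A => D.map (k.prod (𝟭 A.unop)).toCatHom.op)
    (fun {A A'} f => (D.map_comp _ _).symm.trans
      (D.map_comp (k.prod (𝟭 A.unop)).toCatHom.op ((𝟭 B).prod f.unop.toFunctor).toCatHom.op))
    (fun {A A' f g} η => map₂_square D (f := ((𝟭 B').prod f.unop.toFunctor).toCatHom.op)
      (f' := ((𝟭 B).prod f.unop.toFunctor).toCatHom.op) rfl rfl _ _ (by
        refine comp_id_eq_id_comp ?_
        apply congrArg Bicategory.Opposite.op2
        ext x
        refine Prod.ext ?_ ?_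
        · exact (k.map_id x.1).symm
        · rfl) _ _)

/-- The evaluation morphism `b^* : D^B ⟶ D` at an object `b` of `B`. -/
def evalMor {B : Type w} [Category.{w} B] (b : B) :
    (D.shift B).toPseudofunctor ⟶ D.toPseudofunctor :=
  strictTrans (D.shift B) D
    (fun A => D.map (CategoryTheory.Prod.sectR b A.unop).toCatHom.op)
    (fun {A A'} f =>
      (D.map_comp _ _).symm.trans ((congrArg D.map (sectR_square b f)).trans (D.map_comp _ _)))
    (fun η => map₂_square D (sectR_square b _) (sectR_square b _) _ _ (by
        refine comp_id_eq_id_comp ?_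
        apply congrArg Bicategory.Opposite.op2
        ext x
        rfl) _ _)

/-- A family of properties of coherent diagrams which is stable under restriction. -/
structure RestrictionStable (P : ∀ A : (Cat.{w, w})ᵒᵖ, ObjectProperty (D.obj A)) : Prop where
  res_mem : ∀ {A A' : (Cat.{w, w})ᵒᵖ} (f : A ⟶ A') (X : D.obj A),
    P A X → P A' ((D.map f).toFunctor.obj X)

variable {D} in
/-- The full subprederivator of `D` spanned by the coherent diagrams with property `P`. -/
def full {P : ∀ A : (Cat.{w, w})ᵒᵖ, ObjectProperty (D.obj A)}
    (hP : D.RestrictionStable P) : Prederivator.{w, v, u} :=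
  StrictPseudofunctor.mk''
    { obj := fun A => Cat.of (P A).FullSubcategory
      map := fun {A A'} f => ((P A').lift ((P A).ι ⋙ (D.map f).toFunctor)
        (fun X => hP.res_mem f X.obj X.property)).toCatHom
      map₂ := fun {A A'} f g η => NatTrans.toCatHom₂
        { app := fun X => ObjectProperty.homMk ((D.map₂ η).toNatTrans.app X.obj)
          naturality := fun X Y φ => by
            ext
            exact (D.map₂ η).toNatTrans.naturality φ.hom }
      map₂_id := fun u => by
        ext X
        simp
        rfl
      map₂_comp := fun α β => by
        ext X
        simp
        rfl
      map_id := fun A => by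
        apply Cat.ext
        apply fullSubcategory_functor_ext
        exact congrArg (fun t => (P A).ι ⋙ t.toFunctor) (D.map_id A)
      map_comp := fun {A B C} f g => by
        apply Cat.ext
        apply fullSubcategory_functor_ext
        exact congrArg (fun t => (P A).ι ⋙ t.toFunctor) (D.map_comp f g)
      map₂_whisker_left := fun u _ _ α => by
        ext X
        apply ObjectProperty.hom_ext
        have h := congrArg (fun t => t.toNatTrans.app X.obj) (D.map₂_whisker_left u α)
        simp only [D.mapComp_eq_eqToIso, eqToIso.hom, eqToIso.inv, Cat.Hom.toNatTrans_comp,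
          NatTrans.comp_app, cat_eqToHom_app] at h
        refine Eq.trans ?_ (full_conj_app _ _ _ X).symm
        exact h
      map₂_whisker_right := fun α u => by
        ext X
        apply ObjectProperty.hom_ext
        have h := congrArg (fun t => t.toNatTrans.app X.obj) (D.map₂_whisker_right α u)
        simp only [D.mapComp_eq_eqToIso, eqToIso.hom, eqToIso.inv, Cat.Hom.toNatTrans_comp,
          NatTrans.comp_app, cat_eqToHom_app] at h
        refine Eq.trans ?_ (full_conj_app _ _ _ X).symm
        exact h }

/-- The inclusion of a full subprederivator. -/
def fullIncl {P : ∀ A : (Cat.{w, w})ᵒᵖ, ObjectProperty (D.obj A)}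
    (hP : D.RestrictionStable P) : (full hP).toPseudofunctor ⟶ D.toPseudofunctor :=
  strictTrans (full hP) D
    (fun A => (P A).ι.toCatHom)
    (fun {A A'} f => by
      rfl)
    (fun η => by
      refine comp_id_eq_id_comp ?_
      rfl)
/-- A morphism of prederivators is an isomorphism if it has a strict two-sided inverse. -/
def IsStrictIso {D E : Prederivator.{w, v, u}} (φ : D.toPseudofunctor ⟶ E.toPseudofunctor) :
    Prop :=
  ∃ ψ : E.toPseudofunctor ⟶ D.toPseudofunctor, φ ≫ ψ = 𝟙 _ ∧ ψ ≫ φ = 𝟙 _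

/-! ### Suspension -/

/-- `S : D ⟶ D` is a suspension morphism, i.e. isomorphic to `(1,1)^* ∘ (i_⌜)_! ∘ (0,0)_*`, where
`(0,0)_* : D ⟶ D^⌜` is right extension by zero (a right adjoint morphism of the evaluation
`(0,0)^*`) and `(i_⌜)_! : D^⌜ ⟶ D^□` is a left adjoint morphism of `(i_⌜)^*`. The adjunctions are
those of the 2-category of prederivators, and such an `S` is unique up to isomorphism. -/
def IsSuspension (S : D.toPseudofunctor ⟶ D.toPseudofunctor) : Prop :=
  ∃ (G : D.toPseudofunctor ⟶ (D.shift SpanShape.{w}).toPseudofunctor)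
    (H : (D.shift SpanShape.{w}).toPseudofunctor ⟶ (D.shift Square.{w}).toPseudofunctor),
    Nonempty (Bicategory.Adjunction (D.evalMor (B := SpanShape.{w}) ⟨⟨0, 0⟩, by simp⟩) G) ∧
    Nonempty (Bicategory.Adjunction H (D.resMor spanIncl.{w})) ∧
    Nonempty (S ≅ G ≫ H ≫ D.evalMor (B := Square.{w}) ⟨1, 1⟩)

end Prederivator

/-! ### The quivers `A_n` and the mesh categories `M_n` -/

/-- The linearly oriented quiver `A_n = (1 < ... < n)`. -/
@[ext]
structure LinQuiver (n : ℕ) : Type w where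
  /-- The vertex. -/
  l : ℤ
  one_le : 1 ≤ l
  le_n : l ≤ n

instance (n : ℕ) : PartialOrder (LinQuiver.{w} n) :=
  PartialOrder.lift LinQuiver.l (fun _ _ h => LinQuiver.ext h)

/-- The mesh category `M_n`: its objects are the pairs `(k, l)` with `0 ≤ l ≤ n + 1`, and it is
generated by arrows `(k, l) ⟶ (k, l + 1)` and `(k, l + 1) ⟶ (k + 1, l)` subject to the relation
that all squares commute. It is the poset in which `(k, l) ≤ (k', l')` if and only if `k ≤ k'` and
`k + l ≤ k' + l'`; that this poset has the presentation just described is shown below. -/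
@[ext]
structure Mesh (n : ℕ) : Type w where
  /-- The first coordinate. -/
  k : ℤ
  /-- The second coordinate. -/
  l : ℤ
  nonneg : 0 ≤ l
  le_succ : l ≤ n + 1

instance (n : ℕ) : PartialOrder (Mesh.{w} n) :=
  PartialOrder.lift (fun p => (p.k, p.k + p.l)) (by
    rintro ⟨k, l, _, _⟩ ⟨k', l', _, _⟩ h
    simp only [Prod.mk.injEq] at h
    ext <;> simp <;> omega)

namespace Mesh

variable {n : ℕ}

lemma le_def (p q : Mesh.{w} n) : p ≤ q ↔ p.k ≤ q.k ∧ p.k + p.l ≤ q.k + q.l := Iff.rfl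

/-- The repetitive quiver of `(0 < ... < n + 1)`. -/
structure Rep (n : ℕ) : Type w where
  /-- The vertex. -/
  pt : Mesh.{w} n

/-- There is exactly one arrow `(k, l) ⟶ (k, l + 1)` and one arrow `(k, l + 1) ⟶ (k + 1, l)`. -/
instance : Quiver (Rep.{w} n) where
  Hom p q := PLift ((q.pt.k = p.pt.k ∧ q.pt.l = p.pt.l + 1) ∨
    (q.pt.k = p.pt.k + 1 ∧ q.pt.l + 1 = p.pt.l))

lemma le_of_hom {p q : Rep.{w} n} (e : p ⟶ q) : p.pt ≤ q.pt := by
  have := e.down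
  rw [le_def]
  omega

lemma height_of_hom {p q : Rep.{w} n} (e : p ⟶ q) :
    2 * q.pt.k + q.pt.l = 2 * p.pt.k + p.pt.l + 1 := by
  have := e.down
  omega

lemma height_of_path {p q : Rep.{w} n} (s : Quiver.Path p q) :
    2 * q.pt.k + q.pt.l = 2 * p.pt.k + p.pt.l + s.length := by
  induction s with
  | nil => simp
  | cons s e ih =>
    have := height_of_hom e
    simp only [Quiver.Path.length_cons]
    push_cast
    omega

/-- The order of the mesh category is reachability in the repetitive quiver. -/
theorem le_iff_nonempty_path (p q : Rep.{w} n) :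
    p.pt ≤ q.pt ↔ Nonempty (Quiver.Path p q) := by
  constructor
  · intro h
    obtain ⟨N, hN⟩ : ∃ N : ℕ, 2 * q.pt.k + q.pt.l = 2 * p.pt.k + p.pt.l + N := by
      rw [le_def] at h
      exact ⟨(2 * q.pt.k + q.pt.l - (2 * p.pt.k + p.pt.l)).toNat, by omega⟩
    induction N generalizing p with
    | zero =>
      rw [le_def] at h
      have : p = q := by
        obtain ⟨⟨pk, pl, _, _⟩⟩ := p
        obtain ⟨⟨qk, ql, _, _⟩⟩ := q
        simp only [Rep.mk.injEq, Mesh.mk.injEq] at *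
        push_cast at hN
        omega
      subst this
      exact ⟨Quiver.Path.nil⟩
    | succ N ih =>
      rw [le_def] at h
      push_cast at hN
      have hp1 := p.pt.nonneg
      have hp2 := p.pt.le_succ
      have hq1 := q.pt.nonneg
      have hq2 := q.pt.le_succ
      by_cases hc : p.pt.k + p.pt.l < q.pt.k + q.pt.l ∧ p.pt.l ≤ n
      · let r : Rep.{w} n := ⟨⟨p.pt.k, p.pt.l + 1, by omega, by omega⟩⟩
        obtain ⟨s⟩ := ih r (by rw [le_def]; simp only [r]; omega) (by simp only [r]; omega)
        exact ⟨(Quiver.Hom.toPath (show p ⟶ r from ⟨Or.inl ⟨rfl, rfl⟩⟩)).comp s⟩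
      · let r : Rep.{w} n := ⟨⟨p.pt.k + 1, p.pt.l - 1, by omega, by omega⟩⟩
        obtain ⟨s⟩ := ih r (by rw [le_def]; simp only [r]; omega) (by simp only [r]; omega)
        exact ⟨(Quiver.Hom.toPath (show p ⟶ r from ⟨Or.inr ⟨rfl, by simp [r]⟩⟩)).comp s⟩
  · rintro ⟨s⟩
    induction s with
    | nil => exact le_refl _
    | cons s e ih => exact ih.trans (le_of_hom e)

/-- Any two parallel paths in the repetitive quiver are identified as soon as all squares
commute. -/
theorem path_eq_of_squares_commute {C : Type*} [Category* C] (F : Rep.{w} n ⥤q C)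
    (hF : ∀ {p q q' r : Rep.{w} n} (a : p ⟶ q) (b : q ⟶ r) (a' : p ⟶ q') (b' : q' ⟶ r),
      F.map a ≫ F.map b = F.map a' ≫ F.map b')
    {p q : Rep.{w} n} (s t : Quiver.Path p q) :
    composePath (F.mapPath s) = composePath (F.mapPath t) := by
  obtain ⟨N, hN⟩ : ∃ N : ℕ, s.length = N := ⟨_, rfl⟩
  induction N generalizing q with
  | zero =>
    have hs := height_of_path s
    have ht := height_of_path t
    obtain rfl := Quiver.Path.eq_of_length_zero s hN
    rw [Quiver.Path.eq_nil_of_length_zero s hN,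
      Quiver.Path.eq_nil_of_length_zero t (by omega)]
  | succ N ih =>
    have hs := height_of_path s
    have ht := height_of_path t
    cases s with
    | nil => simp at hN
    | @cons q₁ _ s e =>
      cases t with
      | nil =>
        simp only [Quiver.Path.length_nil] at ht
        omega
      | @cons q₂ _ t e' =>
        simp only [Quiver.Path.length_cons] at hN ht hs
        have hsN : s.length = N := by omega
        have htN : t.length = N := by
          push_cast at hs ht
          omega
        have hq₁ := (le_iff_nonempty_path p q₁).2 ⟨s⟩
        have hq₂ := (le_iff_nonempty_path p q₂).2 ⟨t⟩
        by_cases hq : q₁ = q₂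
        · subst hq
          obtain rfl : e = e' := Subsingleton.elim (α := PLift _) e e'
          simp only [Prefunctor.mapPath_cons, composePath_cons]
          rw [ih s t hsN]
        · rw [le_def] at hq₁ hq₂
          have he := e.down
          have he' := e'.down
          have h1 := q.pt.nonneg
          have h2 := q.pt.le_succ
          have hne : ¬ (q₁.pt.k = q₂.pt.k ∧ q₁.pt.l = q₂.pt.l) := by
            rintro ⟨h1, h2⟩
            apply hq
            cases q₁
            cases q₂
            exact congrArg Rep.mk (Mesh.ext h1 h2)
          let z : Rep.{w} n := ⟨⟨q.pt.k - 1, q.pt.l, h1, h2⟩⟩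
          obtain ⟨r⟩ := (le_iff_nonempty_path p z).1 (by rw [le_def]; simp only [z]; omega)
          let a₁ : z ⟶ q₁ := ⟨by simp only [z]; omega⟩
          let a₂ : z ⟶ q₂ := ⟨by simp only [z]; omega⟩
          have e₁ := ih s (r.cons a₁) hsN
          have e₂ := ih t (r.cons a₂) htN
          simp only [Prefunctor.mapPath_cons, composePath_cons] at e₁ e₂ ⊢
          rw [e₁, e₂, Category.assoc, Category.assoc, hF a₁ e a₂ e']

/-- The square `(k, l), (k, l + 1), (k + 1, l - 1), (k + 1, l)` of the mesh category. -/
def square (n : ℕ) (k l : ℤ) (h₁ : 1 ≤ l) (h₂ : l ≤ n) : Square.{w} ⥤ Mesh.{w} n :=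
  Monotone.functor (f := fun p =>
    { k := k + (p.y : ℕ)
      l := l + (p.x : ℕ) - (p.y : ℕ)
      nonneg := by have := p.y.isLt; omega
      le_succ := by have := p.x.isLt; omega }) (by
    rintro p q ⟨hx, hy⟩
    have hx' : (p.x : ℕ) ≤ (q.x : ℕ) := hx
    have hy' : (p.y : ℕ) ≤ (q.y : ℕ) := hy
    rw [le_def]
    dsimp only
    omega)

/-- The flip symmetry `(k, l) ↦ (k + l, n + 1 - l)`. -/
def flip (n : ℕ) : Mesh.{w} n ⥤ Mesh.{w} n :=
  Monotone.functor (f := fun p =>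
    { k := p.k + p.l
      l := n + 1 - p.l
      nonneg := by have := p.le_succ; omega
      le_succ := by have := p.nonneg; omega }) (by
    intro p q h
    rw [le_def] at h ⊢
    dsimp only
    omega)

/-- The embedding `j : A_n ⥤ M_n`, `l ↦ (l, n + 1 - l)`. -/
def j (n : ℕ) : LinQuiver.{w} n ⥤ Mesh.{w} n :=
  Monotone.functor (f := fun p =>
    { k := p.l
      l := n + 1 - p.l
      nonneg := by have := p.le_n; omega
      le_succ := by have := p.one_le; omega }) (by
    intro p q h
    have h' : p.l ≤ q.l := h
    rw [le_def]
    dsimp only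
    omega)

/-- The objects of `K_1`: those of the image of `i : A_n ⥤ M_n`, `l ↦ (0, l)`, the `(k, n + 1)`
with `k ≥ 0` and the `(k, 0)` with `k > 0`. -/
def InK₁ (p : Mesh.{w} n) : Prop :=
  (p.k = 0 ∧ 1 ≤ p.l ∧ p.l ≤ n) ∨ (0 ≤ p.k ∧ p.l = n + 1) ∨ (0 < p.k ∧ p.l = 0)

/-- The objects of `K_2`: those of `K_1` and the `(k, l)` with `k > 0`. -/
def InK₂ (p : Mesh.{w} n) : Prop := InK₁ p ∨ 0 < p.k

/-- The objects of `K_3`: those of `K_2`, the `(k, n + 1)` with `k < 0` and the `(k, 0)` with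
`k ≤ 0`. -/
def InK₃ (p : Mesh.{w} n) : Prop :=
  InK₂ p ∨ (p.k < 0 ∧ p.l = n + 1) ∨ (p.k ≤ 0 ∧ p.l = 0)

/-- The inclusion `i_1 : A_n ⥤ K_1`, `l ↦ (0, l)`. -/
def i₁ (n : ℕ) : LinQuiver.{w} n ⥤ {p : Mesh.{w} n // InK₁ p} :=
  Monotone.functor (f := fun p =>
    ⟨{ k := 0
       l := p.l
       nonneg := by have := p.one_le; omega
       le_succ := by have := p.le_n; omega }, Or.inl ⟨rfl, p.one_le, p.le_n⟩⟩) (by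
    intro p q h
    have h' : p.l ≤ q.l := h
    rw [← Subtype.coe_le_coe, le_def]
    dsimp only
    omega)

/-- The inclusion `i_2 : K_1 ⥤ K_2`. -/
def i₂ (n : ℕ) : {p : Mesh.{w} n // InK₁ p} ⥤ {p : Mesh.{w} n // InK₂ p} :=
  Monotone.functor (f := fun p => ⟨p.1, Or.inl p.2⟩) (fun _ _ h => h)

/-- The inclusion `i_3 : K_2 ⥤ K_3`. -/
def i₃ (n : ℕ) : {p : Mesh.{w} n // InK₂ p} ⥤ {p : Mesh.{w} n // InK₃ p} :=
  Monotone.functor (f := fun p => ⟨p.1, Or.inl p.2⟩) (fun _ _ h => h)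

/-- The inclusion `i_4 : K_3 ⥤ M_n`. -/
def i₄ (n : ℕ) : {p : Mesh.{w} n // InK₃ p} ⥤ Mesh.{w} n :=
  (Subtype.mono_coe _).functor

end Mesh

namespace Prederivator

variable (D : Prederivator.{w, v, u})

/-- The coherent diagrams `X` in `D^{M_n}(A) = D(M_n × A)` which vanish at all `(k, 0)` and all
`(k, n + 1)` and which make all squares of `M_n` bicartesian. -/
def MeshExact (n : ℕ) (A : (Cat.{w, w})ᵒᵖ) : ObjectProperty ((D.shift (Mesh.{w} n)).obj A) :=
  fun X : D.val (Mesh.{w} n × A.unop) =>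
    (∀ m : Mesh.{w} n, m.l = 0 ∨ m.l = n + 1 →
      Limits.IsZero ((D.res (CategoryTheory.Prod.sectR m A.unop)).obj X)) ∧
    ∀ (k l : ℤ) (h₁ : 1 ≤ l) (h₂ : l ≤ n),
      D.IsCocartesian ((D.res ((Mesh.square n k l h₁ h₂).prod (𝟭 A.unop))).obj X) ∧
      D.IsCartesian ((D.res ((Mesh.square n k l h₁ h₂).prod (𝟭 A.unop))).obj X)

/-- `F : D^{A_n} ⟶ D^{M_n}` is the composite of the Kan extension morphisms
`(i_1)_*`, `(i_2)_!`, `(i_3)_!` and `(i_4)_*`. -/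
def IsMeshExtension (n : ℕ)
    (F : (D.shift (LinQuiver.{w} n)).toPseudofunctor ⟶
      (D.shift (Mesh.{w} n)).toPseudofunctor) : Prop :=
  ∃ (E₁ : (D.shift (LinQuiver.{w} n)).toPseudofunctor ⟶
        (D.shift {p : Mesh.{w} n // Mesh.InK₁ p}).toPseudofunctor)
    (E₂ : (D.shift {p : Mesh.{w} n // Mesh.InK₁ p}).toPseudofunctor ⟶
        (D.shift {p : Mesh.{w} n // Mesh.InK₂ p}).toPseudofunctor)
    (E₃ : (D.shift {p : Mesh.{w} n // Mesh.InK₂ p}).toPseudofunctor ⟶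
        (D.shift {p : Mesh.{w} n // Mesh.InK₃ p}).toPseudofunctor)
    (E₄ : (D.shift {p : Mesh.{w} n // Mesh.InK₃ p}).toPseudofunctor ⟶
        (D.shift (Mesh.{w} n)).toPseudofunctor),
    Nonempty (Bicategory.Adjunction (D.resMor (Mesh.i₁ n)) E₁) ∧
    Nonempty (Bicategory.Adjunction E₂ (D.resMor (Mesh.i₂ n))) ∧
    Nonempty (Bicategory.Adjunction E₃ (D.resMor (Mesh.i₃ n))) ∧
    Nonempty (Bicategory.Adjunction (D.resMor (Mesh.i₄ n)) E₄) ∧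
    Nonempty (F ≅ E₁ ≫ E₂ ≫ E₃ ≫ E₄)

end Prederivator

end DerivatorTheory

end

open DerivatorTheory

/-! In the coordinates `p = k` and `q = k + l` the mesh category is the strip `p ≤ q ≤ p + n + 1` in
`ℤ × ℤ` with the product order, and the mesh squares are the unit squares. An exact diagram makes
unit squares pushouts, so by pasting it makes every nondegenerate rectangle inside the strip a
pushout (`MeshExactAt.cocartAt_rect`). For `1 ≤ l ≤ n` the rectangle from `(k, l)` to `(k + l, n + 1
- l)` has its two other corners `(k, n + 1)` and `(k + l, 0)` on the boundary of the strip, where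
exact diagrams vanish. Hence the value at the flip of `(k, l)` is the suspension of the value at
`(k, l)`. These rectangles are functorial in `(k, l)` (`Mesh.susp`); on the boundary they degenerate
to squares of zero objects. The flip is `(p, q) ↦ (q, p + n + 1)`: it transposes rectangles and
therefore preserves exactness.

To obtain an isomorphism of morphisms of prederivators, `nonempty_iso_of_isSuspension` recognises
the suspension: if `T : E ⟶ E^□` takes cocartesian values, is zero at `(1,0)` and `(0,1)`, and is
the identity at `(0,0)`, then uniqueness of adjoints gives `Σ ≅ (1,1)^* T`. For exact diagrams `T`
is restriction along `Mesh.susp`. For `D^{A_n}` it is the restriction of `(i_2)_! (i_1)_*` along the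
squares `(0, l), (0, n + 1), (l, 0), (l, n + 1 - l)`: by the pointwise formula, left extension along
`i_2` is at `(l, n + 1 - l)` the pushout of the other three values, two of which are zero. The
extensions along `i_3` and `i_4` do not change values on `K_2`, which contains the image of `j`; so
the second part needs no exactness of the values of `F`.

Kan extensions are handled through their universal property. An object is `LeftInduced` or
`RightInduced` along a functor if the functor is bijective on maps out of it or into it; these
notions compose and cancel. (Der4) makes them pointwise (`leftInduced_iff_isColim`), and over posets
the colimits reduce to reflective subposets (`isColim_slice_iff`), hence to pushouts.
`exists_leftAdjoint` and `exists_rightAdjoint` turn a restriction-stable supply of (co)induced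
objects into adjunctions of pseudo-natural transformations. That the suspension exists on exact
diagrams requires the constructed spans and squares to be exact again: extension by zero is harmless
(`meshExact_of_isZero`), and left Kan extensions in different variables commute
(`meshExact_of_leftInduced`). The coincidence of cartesian and cocartesian squares enters only in
`meshExact_iff`, which reduces exactness to a pointwise statement about pushouts. -/

namespace DerivatorTheory

/-! ### Objects induced along a functor -/

section Induced

universe v₁ v₂ v₃ u₁ u₂ u₃

variable {C : Type u₁} [Category.{v₁} C] {E : Type u₂} [Category.{v₂} E]
  {E' : Type u₃} [Category.{v₃} E']

/-- Morphisms out of `Y` are the same as morphisms out of `Φ Y`. -/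
def LeftInduced (Φ : C ⥤ E) (Y : C) : Prop :=
  ∀ Z, Function.Bijective (fun g : Y ⟶ Z => Φ.map g)

/-- Morphisms into `Y` are the same as morphisms into `Φ Y`. -/
def RightInduced (Φ : C ⥤ E) (Y : C) : Prop :=
  ∀ Z, Function.Bijective (fun g : Z ⟶ Y => Φ.map g)

lemma bijective_comp_iff_right {α β γ : Sort*} {f : α → β} (hf : Function.Bijective f)
    (g : β → γ) : Function.Bijective (g ∘ f) ↔ Function.Bijective g :=
  Function.Bijective.of_comp_iff g hf

lemma bijective_comp_iff_left {α β γ : Sort*} {g : β → γ} (hg : Function.Bijective g)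
    (f : α → β) : Function.Bijective (g ∘ f) ↔ Function.Bijective f :=
  Function.Bijective.of_comp_iff' hg f

lemma Bijective.congr_fun {α β : Sort*} {f g : α → β} (hf : Function.Bijective f)
    (h : ∀ x, f x = g x) : Function.Bijective g := by
  obtain rfl : f = g := funext h
  exact hf

lemma bijective_precomp {X Y : C} (f : X ⟶ Y) [IsIso f] (Z : C) :
    Function.Bijective (fun g : Y ⟶ Z => f ≫ g) :=
  ⟨fun _ _ h => (cancel_epi f).1 h, fun g => ⟨inv f ≫ g, by simp⟩⟩

lemma bijective_postcomp {X Y : C} (f : X ⟶ Y) [IsIso f] (Z : C) :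
    Function.Bijective (fun g : Z ⟶ X => g ≫ f) :=
  ⟨fun _ _ h => (cancel_mono f).1 h, fun g => ⟨g ≫ inv f, by simp⟩⟩

/-- Yoneda: the preimage of the identity is the inverse. -/
lemma isIso_of_bijective_precomp {X Y : C} (f : X ⟶ Y)
    (h : ∀ Z, Function.Bijective (fun g : Y ⟶ Z => f ≫ g)) : IsIso f := by
  obtain ⟨g, hg⟩ := (h X).2 (𝟙 X)
  exact ⟨g, hg, (h Y).1 (by simp [reassoc_of% hg])⟩

lemma isIso_of_bijective_postcomp {X Y : C} (f : X ⟶ Y)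
    (h : ∀ Z, Function.Bijective (fun g : Z ⟶ X => g ≫ f)) : IsIso f := by
  obtain ⟨g, hg⟩ := (h Y).2 (𝟙 Y)
  exact ⟨g, (h X).1 (by simp [hg]), hg⟩

lemma bijective_map_of_eq_id {H : C ⥤ C} (h : H = 𝟭 C) (X Y : C) :
    Function.Bijective (fun g : X ⟶ Y => H.map g) := by
  subst h
  exact Function.bijective_id

namespace LeftInduced

variable {Φ : C ⥤ E} {Y Y' : C}

lemma of_iso (e : Y ≅ Y') (h : LeftInduced Φ Y) : LeftInduced Φ Y' := fun Z => by
  refine Bijective.congr_fun ((bijective_precomp (Φ.map e.inv) (Φ.obj Z)).comp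
    ((h Z).comp (bijective_precomp e.hom Z))) fun g => ?_
  simp

lemma comp {Ψ : E ⥤ E'} (h : LeftInduced Φ Y) (h' : LeftInduced Ψ (Φ.obj Y)) :
    LeftInduced (Φ ⋙ Ψ) Y := fun Z => (h' (Φ.obj Z)).comp (h Z)

/-- Two of the three bijections force the third. Together with `comp` this makes pasting of pushouts
and interchange of Kan extensions formal. -/
lemma of_comp {Ψ : E ⥤ E'} (h : LeftInduced (Φ ⋙ Ψ) Y) (h' : LeftInduced Ψ (Φ.obj Y)) :
    LeftInduced Φ Y := fun Z =>
  (bijective_comp_iff_left (h' (Φ.obj Z)) _).1 (h Z)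

lemma isIso_counit {L : E ⥤ C} (adj : L ⊣ Φ) (h : LeftInduced Φ Y) :
    IsIso (adj.counit.app Y) := by
  apply isIso_of_bijective_precomp
  intro Z
  refine Bijective.congr_fun ((adj.homEquiv (Φ.obj Y) Z).symm.bijective.comp (h Z)) fun g => ?_
  simp [Adjunction.homEquiv_counit]

lemma of_isIso_counit {L : E ⥤ C} (adj : L ⊣ Φ) [IsIso (adj.counit.app Y)] :
    LeftInduced Φ Y := fun Z => by
  refine Bijective.congr_fun ((adj.homEquiv (Φ.obj Y) Z).bijective.comp
    (bijective_precomp (adj.counit.app Y) Z)) fun g => ?_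
  simp [Adjunction.homEquiv_unit]

/-- The adjunction bijection is `Φ` on morphisms followed by precomposition with the unit, so an
invertible unit makes `Φ` itself bijective. -/
lemma of_isIso_unit {L : E ⥤ C} (adj : L ⊣ Φ) (X : E) [IsIso (adj.unit.app X)] :
    LeftInduced Φ (L.obj X) := fun Z => by
  refine (bijective_comp_iff_left (bijective_precomp (adj.unit.app X) (Φ.obj Z)) _).1 ?_
  refine Bijective.congr_fun ((adj.homEquiv X Z).bijective) fun g => ?_
  simp [Adjunction.homEquiv_unit]

end LeftInduced

namespace RightInduced

variable {Φ : C ⥤ E} {Y Y' : C}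

lemma of_iso (e : Y ≅ Y') (h : RightInduced Φ Y) : RightInduced Φ Y' := fun Z => by
  refine Bijective.congr_fun ((bijective_postcomp (Φ.map e.hom) (Φ.obj Z)).comp
    ((h Z).comp (bijective_postcomp e.inv Z))) fun g => ?_
  simp

lemma isIso_unit {R : E ⥤ C} (adj : Φ ⊣ R) (h : RightInduced Φ Y) :
    IsIso (adj.unit.app Y) := by
  apply isIso_of_bijective_postcomp
  intro Z
  refine Bijective.congr_fun ((adj.homEquiv Z (Φ.obj Y)).bijective.comp (h Z)) fun g => ?_
  simp [Adjunction.homEquiv_unit]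

lemma of_isIso_unit {R : E ⥤ C} (adj : Φ ⊣ R) [IsIso (adj.unit.app Y)] :
    RightInduced Φ Y := fun Z => by
  refine Bijective.congr_fun ((adj.homEquiv Z (Φ.obj Y)).symm.bijective.comp
    (bijective_postcomp (adj.unit.app Y) Z)) fun g => ?_
  simp [Adjunction.homEquiv_counit]

lemma of_isIso_counit {R : E ⥤ C} (adj : Φ ⊣ R) (X : E) [IsIso (adj.counit.app X)] :
    RightInduced Φ (R.obj X) := fun Z => by
  refine (bijective_comp_iff_left (bijective_postcomp (adj.counit.app X) (Φ.obj Z)) _).1 ?_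
  refine Bijective.congr_fun ((adj.homEquiv Z X).symm.bijective) fun g => ?_
  simp [Adjunction.homEquiv_counit]

end RightInduced

end Induced

/-! ### Sections and adjoints of strong transformations with values in categories -/

noncomputable section Transformations

universe w₀ v₀ u₀

variable {B : Type u₀} [Bicategory.{w₀, v₀} B] {P Q : Pseudofunctor B Cat.{v, u}}

/-- The component at `X` of the naturality constraint of a strong transformation. -/
def natApp (φ : P ⟶ Q) {a b : B} (f : a ⟶ b) (X : P.obj a) :
    (φ.app b).toFunctor.obj ((P.map f).toFunctor.obj X) ≅
      (Q.map f).toFunctor.obj ((φ.app a).toFunctor.obj X) :=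
  (Cat.Hom.toNatIso (φ.naturality f)).app X

section

variable (φ : P ⟶ Q)

/-- The axioms of a strong transformation are evaluated at single objects, since sections are
constructed object by object. -/
lemma natApp_naturality {a b : B} (f : a ⟶ b) {X X' : P.obj a} (g : X ⟶ X') :
    (φ.app b).toFunctor.map ((P.map f).toFunctor.map g) ≫ (natApp φ f X').hom =
      (natApp φ f X).hom ≫ (Q.map f).toFunctor.map ((φ.app a).toFunctor.map g) :=
  (φ.naturality f).hom.toNatTrans.naturality g

lemma natApp_map₂ {a b : B} {f g : a ⟶ b} (η : f ⟶ g) (X : P.obj a) :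
    (φ.app b).toFunctor.map ((P.map₂ η).toNatTrans.app X) ≫ (natApp φ g X).hom =
      (natApp φ f X).hom ≫ (Q.map₂ η).toNatTrans.app ((φ.app a).toFunctor.obj X) :=
  congrArg (fun t => t.toNatTrans.app X) (φ.naturality_naturality η)

lemma natApp_id (a : B) (X : P.obj a) :
    (natApp φ (𝟙 a) X).hom ≫ (Q.mapId a).hom.toNatTrans.app ((φ.app a).toFunctor.obj X) =
      (φ.app a).toFunctor.map ((P.mapId a).hom.toNatTrans.app X) := by
  have := congrArg (fun t => t.toNatTrans.app X) (φ.naturality_id a)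
  refine this.trans ?_
  simp

lemma natApp_comp {a b c : B} (f : a ⟶ b) (g : b ⟶ c) (X : P.obj a) :
    (natApp φ (f ≫ g) X).hom ≫
        (Q.mapComp f g).hom.toNatTrans.app ((φ.app a).toFunctor.obj X) =
      (φ.app c).toFunctor.map ((P.mapComp f g).hom.toNatTrans.app X) ≫
        (natApp φ g ((P.map f).toFunctor.obj X)).hom ≫
          (Q.map g).toFunctor.map (natApp φ f X).hom := by
  have := congrArg (fun t => t.toNatTrans.app X) (φ.naturality_comp f g)
  refine this.trans ?_
  simp
  rfl

end

section

variable (φ : P ⟶ Q)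

lemma natApp_inv_naturality {a b : B} (f : a ⟶ b) {X X' : P.obj a} (g : X ⟶ X') :
    (natApp φ f X).inv ≫ (φ.app b).toFunctor.map ((P.map f).toFunctor.map g) =
      (Q.map f).toFunctor.map ((φ.app a).toFunctor.map g) ≫ (natApp φ f X').inv := by
  rw [Iso.inv_comp_eq, ← Category.assoc, Iso.eq_comp_inv, natApp_naturality]

lemma natApp_inv_map₂ {a b : B} {f g : a ⟶ b} (η : f ⟶ g) (X : P.obj a) :
    (natApp φ f X).inv ≫ (φ.app b).toFunctor.map ((P.map₂ η).toNatTrans.app X) =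
      (Q.map₂ η).toNatTrans.app ((φ.app a).toFunctor.obj X) ≫ (natApp φ g X).inv := by
  rw [Iso.inv_comp_eq, ← Category.assoc, Iso.eq_comp_inv, natApp_map₂]

end

lemma natApp_id_trans {a b : B} (f : a ⟶ b) (X : Q.obj a) : (natApp (𝟙 Q) f X).hom = 𝟙 _ := by
  change 𝟙 _ ≫ 𝟙 _ = 𝟙 _
  simp

lemma natApp_comp_trans {R : Pseudofunctor B Cat.{v, u}} (ψ : R ⟶ P) (φ : P ⟶ Q) {a b : B}
    (f : a ⟶ b) (X : R.obj a) : (natApp (ψ ≫ φ) f X).hom =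
      (φ.app b).toFunctor.map (natApp ψ f X).hom ≫
        (natApp φ f ((ψ.app a).toFunctor.obj X)).hom := by
  change 𝟙 _ ≫ (φ.app b).toFunctor.map (natApp ψ f X).hom ≫ 𝟙 _ ≫ 
     (natApp φ f ((ψ.app a).toFunctor.obj X)).hom ≫ 𝟙 _ = _
  simp

/-- Objects, stable under restriction, on which the strong transformation `φ` is fully faithful,
together with a choice of preimages among them. -/
structure LiftingData (φ : P ⟶ Q) where
  /-- The objects in question. -/
  prop : ∀ a : B, ObjectProperty (P.obj a)
  bij : ∀ {a : B} {X X' : P.obj a}, prop a X → prop a X' →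
    Function.Bijective (fun g : X ⟶ X' => (φ.app a).toFunctor.map g)
  stable : ∀ {a b : B} (f : a ⟶ b) {X : P.obj a}, prop a X → prop b ((P.map f).toFunctor.obj X)
  /-- The chosen preimage. -/
  obj : ∀ {a : B}, Q.obj a → P.obj a
  mem : ∀ {a : B} (Y : Q.obj a), prop a (obj Y)
  /-- The image of the chosen preimage. -/
  iso : ∀ {a : B} (Y : Q.obj a), (φ.app a).toFunctor.obj (obj Y) ≅ Y

namespace LiftingData

variable {φ : P ⟶ Q} (𝓛 : LiftingData φ)

section

variable {a : B} {X X' X'' : P.obj a}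

/-- The unique lift of a morphism. -/
def lift (h : 𝓛.prop a X) (h' : 𝓛.prop a X')
    (g : (φ.app a).toFunctor.obj X ⟶ (φ.app a).toFunctor.obj X') : X ⟶ X' :=
  Classical.choose ((𝓛.bij h h').2 g)

@[simp]
lemma map_lift (h : 𝓛.prop a X) (h' : 𝓛.prop a X')
    (g : (φ.app a).toFunctor.obj X ⟶ (φ.app a).toFunctor.obj X') :
    (φ.app a).toFunctor.map (𝓛.lift h h' g) = g :=
  Classical.choose_spec ((𝓛.bij h h').2 g)

lemma hom_ext (h : 𝓛.prop a X) (h' : 𝓛.prop a X') {g g' : X ⟶ X'}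
    (e : (φ.app a).toFunctor.map g = (φ.app a).toFunctor.map g') : g = g' :=
  (𝓛.bij h h').1 e

/-- The unique lift of an isomorphism. -/
@[simps]
def liftIso (h : 𝓛.prop a X) (h' : 𝓛.prop a X')
    (g : (φ.app a).toFunctor.obj X ≅ (φ.app a).toFunctor.obj X') : X ≅ X' where
  hom := 𝓛.lift h h' g.hom
  inv := 𝓛.lift h' h g.inv
  hom_inv_id := 𝓛.hom_ext h h (by simp)
  inv_hom_id := 𝓛.hom_ext h' h' (by simp)

end

/-- The action of the section on morphisms. -/
def hmap {a : B} {Y Y' : Q.obj a} (g : Y ⟶ Y') : 𝓛.obj Y ⟶ 𝓛.obj Y' :=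
  𝓛.lift (𝓛.mem Y) (𝓛.mem Y') ((𝓛.iso Y).hom ≫ g ≫ (𝓛.iso Y').inv)

lemma map_hmap {a : B} {Y Y' : Q.obj a} (g : Y ⟶ Y') :
    (φ.app a).toFunctor.map (𝓛.hmap g) = (𝓛.iso Y).hom ≫ g ≫ (𝓛.iso Y').inv :=
  𝓛.map_lift _ _ _

/-- The functor given by the chosen preimages. -/
def functor (a : B) : Q.obj a ⥤ P.obj a where
  obj Y := 𝓛.obj Y
  map g := 𝓛.hmap g
  map_id Y := 𝓛.hom_ext (𝓛.mem _) (𝓛.mem _) (by simp [map_hmap])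
  map_comp f g := 𝓛.hom_ext (𝓛.mem _) (𝓛.mem _) (by simp [map_hmap])

/-- The components of the naturality constraint of the section. -/
def natIso {a b : B} (f : a ⟶ b) (Y : Q.obj a) :
    𝓛.obj ((Q.map f).toFunctor.obj Y) ≅ (P.map f).toFunctor.obj (𝓛.obj Y) :=
  𝓛.liftIso (𝓛.mem _) (𝓛.stable f (𝓛.mem Y))
    (𝓛.iso _ ≪≫ ((Q.map f).toFunctor.mapIso (𝓛.iso Y)).symm ≪≫ (natApp φ f _).symm)

lemma map_natIso_hom {a b : B} (f : a ⟶ b) (Y : Q.obj a) :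
    (φ.app b).toFunctor.map (𝓛.natIso f Y).hom =
      (𝓛.iso _).hom ≫ (Q.map f).toFunctor.map (𝓛.iso Y).inv ≫ (natApp φ f (𝓛.obj Y)).inv := by
  simp [natIso]

/-- Both sides are morphisms between objects on which `φ` is faithful, so it suffices to compare
images under `φ`, where `natIso` is made of the constraint of `φ`. The remaining coherence laws of
the section follow in the same way. -/
lemma natIso_naturality {a b : B} (f : a ⟶ b) {Y Y' : Q.obj a} (g : Y ⟶ Y') :
    𝓛.hmap ((Q.map f).toFunctor.map g) ≫ (𝓛.natIso f Y').hom =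
      (𝓛.natIso f Y).hom ≫ (P.map f).toFunctor.map (𝓛.hmap g) := by
  apply 𝓛.hom_ext (𝓛.mem _) (𝓛.stable f (𝓛.mem _))
  have h2 := natApp_inv_naturality φ f (𝓛.hmap g)
  simp only [Functor.map_comp, map_hmap, map_natIso_hom, Category.assoc, h2]
  simp only [← Functor.map_comp_assoc, Iso.inv_hom_id_assoc]

lemma natIso_map₂ {a b : B} {f g : a ⟶ b} (η : f ⟶ g) (Y : Q.obj a) :
    𝓛.hmap ((Q.map₂ η).toNatTrans.app Y) ≫ (𝓛.natIso g Y).hom =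
      (𝓛.natIso f Y).hom ≫ (P.map₂ η).toNatTrans.app (𝓛.obj Y) := by
  apply 𝓛.hom_ext (𝓛.mem _) (𝓛.stable _ (𝓛.mem Y))
  have h2 := natApp_inv_map₂ φ η (𝓛.obj Y)
  have h3 := (Q.map₂ η).toNatTrans.naturality (𝓛.iso Y).inv
  simp only [Functor.map_comp, map_hmap, map_natIso_hom, Category.assoc, h2, Iso.inv_hom_id_assoc]
  rw [reassoc_of% h3]

lemma natIso_id (a : B) (Y : Q.obj a) :
    (𝓛.natIso (𝟙 a) Y).hom ≫ (P.mapId a).hom.toNatTrans.app (𝓛.obj Y) =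
      𝓛.hmap ((Q.mapId a).hom.toNatTrans.app Y) := by
  apply 𝓛.hom_ext (𝓛.mem _) (𝓛.mem Y)
  have h1 := natApp_id φ a (𝓛.obj Y)
  have h3 : (Q.map (𝟙 a)).toFunctor.map (𝓛.iso Y).inv ≫
    (Q.mapId a).hom.toNatTrans.app ((φ.app a).toFunctor.obj (𝓛.obj Y)) =
    (Q.mapId a).hom.toNatTrans.app Y ≫ (𝓛.iso Y).inv :=
      (Q.mapId a).hom.toNatTrans.naturality (𝓛.iso Y).inv
  simp only [Functor.map_comp, map_hmap, map_natIso_hom, Category.assoc]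
  erw [← h1]
  rw [Iso.inv_hom_id_assoc]
  erw [h3]
  rfl

lemma natIso_comp {a b c : B} (f : a ⟶ b) (g : b ⟶ c) (Y : Q.obj a) :
    (𝓛.natIso (f ≫ g) Y).hom ≫ (P.mapComp f g).hom.toNatTrans.app (𝓛.obj Y) =
      𝓛.hmap ((Q.mapComp f g).hom.toNatTrans.app Y) ≫
        (𝓛.natIso g ((Q.map f).toFunctor.obj Y)).hom ≫
          (P.map g).toFunctor.map (𝓛.natIso f Y).hom := by
  apply 𝓛.hom_ext (𝓛.mem _) (𝓛.stable _ (𝓛.stable _ (𝓛.mem Y)))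
  have h1 := natApp_comp φ f g (𝓛.obj Y)
  have h3 : (Q.map (f ≫ g)).toFunctor.map (𝓛.iso Y).inv ≫ (Q.mapComp f g).hom.toNatTrans.app _ =
    (Q.mapComp f g).hom.toNatTrans.app Y ≫ (Q.map g).toFunctor.map ((Q.map f).toFunctor.map _) :=
    (Q.mapComp f g).hom.toNatTrans.naturality (𝓛.iso Y).inv
  have h4 := natApp_inv_naturality φ g (𝓛.natIso f Y).hom
  have h5 : (natApp φ (f ≫ g) (𝓛.obj Y)).inv ≫
      (φ.app c).toFunctor.map ((P.mapComp f g).hom.toNatTrans.app (𝓛.obj Y)) =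
      (Q.mapComp f g).hom.toNatTrans.app ((φ.app a).toFunctor.obj (𝓛.obj Y)) ≫
        (Q.map g).toFunctor.map (natApp φ f (𝓛.obj Y)).inv ≫
        (natApp φ g ((P.map f).toFunctor.obj (𝓛.obj Y))).inv := by
    rw [Iso.inv_comp_eq]
    rw [reassoc_of% h1, ← Functor.map_comp_assoc]
    simp
  simp only [Functor.map_comp, map_hmap, map_natIso_hom, Category.assoc, h4, h5]
  rw [reassoc_of% h3]
  simp only [← Functor.map_comp_assoc, Iso.inv_hom_id_assoc]
  erw [Iso.inv_hom_id_assoc]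

/-- The section of `φ` given by the chosen preimages. -/
def sec : Q ⟶ P where
  app a := (𝓛.functor a).toCatHom
  naturality f := Cat.Hom.isoMk (NatIso.ofComponents (𝓛.natIso f)
    (fun g => 𝓛.natIso_naturality f g))
  naturality_naturality {a b f g} η := by
    ext Y
    exact 𝓛.natIso_map₂ η Y
  naturality_id a := by
    ext Y
    refine (𝓛.natIso_id a Y).trans ?_
    -- Unitors of `Cat` have identity components, so only the law for components remains.
    change _ = 𝓛.hmap _ ≫ 𝟙 (𝓛.obj Y) ≫ 𝟙 (𝓛.obj Y)
    rw [Category.comp_id]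
    exact (Category.comp_id _).symm
  naturality_comp {a b c} f g := by
    ext Y
    refine (𝓛.natIso_comp f g Y).trans ?_
    change _ = 𝓛.hmap ((Q.mapComp f g).hom.toNatTrans.app Y) ≫
      𝟙 (𝓛.obj ((Q.map g).toFunctor.obj ((Q.map f).toFunctor.obj Y))) ≫
      (𝓛.natIso g ((Q.map f).toFunctor.obj Y)).hom ≫
      𝟙 ((P.map g).toFunctor.obj (𝓛.obj ((Q.map f).toFunctor.obj Y))) ≫
      (P.map g).toFunctor.map (𝓛.natIso f Y).hom ≫
      𝟙 ((P.map g).toFunctor.obj ((P.map f).toFunctor.obj (𝓛.obj Y)))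
    erw [Category.id_comp, Category.id_comp, Category.comp_id]

lemma sec_natApp {a b : B} (f : a ⟶ b) (Y : Q.obj a) :
    (natApp 𝓛.sec f Y).hom = (𝓛.natIso f Y).hom := rfl

lemma iso_hom_aux {a : B} {Y Y' : Q.obj a} (g : Y ⟶ Y') :
    ((𝓛.iso Y).hom ≫ g ≫ (𝓛.iso Y').inv) ≫ (𝓛.iso Y').hom = (𝓛.iso Y).hom ≫ g := by
  simp

/-- The section is a section up to isomorphism. -/
def secIso : 𝓛.sec ≫ φ ≅ 𝟙 Q :=
  Pseudofunctor.StrongTrans.isoMk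
    (fun a => Cat.Hom.isoMk (NatIso.ofComponents (fun Y => 𝓛.iso Y) (fun {Y Y'} g => by
      refine (congrArg (· ≫ (𝓛.iso Y').hom) (𝓛.map_hmap g)).trans ?_
      exact 𝓛.iso_hom_aux g)))
    (fun {a b} f => by
      ext Y
      have h2 : ((φ.app b).toFunctor.map (𝓛.natIso f Y).hom ≫ (natApp φ f (𝓛.obj Y)).hom) ≫
          (Q.map f).toFunctor.map (𝓛.iso Y).hom = (𝓛.iso ((Q.map f).toFunctor.obj Y)).hom := by
        rw [map_natIso_hom]
        simp [← Functor.map_comp]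
      rw [← sec_natApp] at h2
      erw [← natApp_comp_trans 𝓛.sec φ f Y] at h2
      refine Eq.trans ?_ h2.symm
      refine Eq.trans (congrArg ((𝓛.iso _).hom ≫ ·) (natApp_id_trans f Y)) ?_
      exact Category.comp_id _)

end LiftingData

/-! ### Lifting modifications along a strong transformation -/

section Lift

variable {R : Pseudofunctor B Cat.{v, u}} {g h : R ⟶ P} (φ : P ⟶ Q)
  (H : ∀ (a : B) (X X' : R.obj a), Function.Bijective
    (fun t : (g.app a).toFunctor.obj X ⟶ (h.app a).toFunctor.obj X' => (φ.app a).toFunctor.map t))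

include H in
lemma modification_ext_of_whiskerRight {μ μ' : g ⟶ h} (e : μ ▷ φ = μ' ▷ φ) : μ = μ' := by
  ext a X
  exact (H a X X).1 (congrArg (fun t => (t.as.app a).toNatTrans.app X) e)

-- Components are lifted one at a time. Bijectivity is needed between `g X` and `h X'` for different
-- `X` and `X'`, because naturality of the lifted components is itself checked after applying `φ`.
include H in
lemma exists_modification_lift (Γ : g ≫ φ ⟶ h ≫ φ) : ∃ μ : g ⟶ h, μ ▷ φ = Γ := by
  choose t ht using fun (a : B) (X : R.obj a) => (H a X X).2 ((Γ.as.app a).toNatTrans.app X)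
  have hnat : ∀ (a : B) {X X' : R.obj a} (s : X ⟶ X'),
      (g.app a).toFunctor.map s ≫ t a X' = t a X ≫ (h.app a).toFunctor.map s := by
    intro a X X' s
    apply (H a X X').1
    have := (Γ.as.app a).toNatTrans.naturality s
    simp only [Functor.map_comp] at ht ⊢
    erw [ht, ht]
    exact this
  refine ⟨⟨{ app := fun a => NatTrans.toCatHom₂ { app := t a, naturality := fun _ _ s => hnat a s }
             naturality := ?_ }⟩, ?_⟩
  · intro a b f
    ext X
    change t b ((R.map f).toFunctor.obj X) ≫ (natApp h f X).hom =
      (natApp g f X).hom ≫ (P.map f).toFunctor.map (t a X)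
    -- Moving the constraint of `h` to the other side makes both sides morphisms from a value of `g`
    -- to a value of `h`, where `H` gives injectivity.
    rw [← cancel_mono (natApp h f X).inv]
    apply (H b _ _).1
    have h1 : (Γ.as.app b).toNatTrans.app ((R.map f).toFunctor.obj X) ≫ (natApp (h ≫ φ) f X).hom =
      (natApp (g ≫ φ) f X).hom ≫ (Q.map f).toFunctor.map ((Γ.as.app a).toNatTrans.app X) :=
      congrArg (fun s => s.toNatTrans.app X) (Γ.as.naturality f)
    rw [natApp_comp_trans, natApp_comp_trans] at h1
    have h2 := natApp_naturality φ f (t a X)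
    have ht' : ∀ (a : B) (X : R.obj a),
        (φ.app a).toFunctor.map (t a X) = (Γ.as.app a).toNatTrans.app X := ht
    rw [ht'] at h2
    have h3 : (φ.app b).toFunctor.map (t b ((R.map f).toFunctor.obj X)) ≫
        (φ.app b).toFunctor.map (natApp h f X).hom =
        (φ.app b).toFunctor.map (natApp g f X).hom ≫
          (φ.app b).toFunctor.map ((P.map f).toFunctor.map (t a X)) := by
      rw [← cancel_mono (natApp φ f ((h.app a).toFunctor.obj X)).hom, Category.assoc,
        Category.assoc, h2, ht']
      exact h1.trans (Category.assoc _ _ _)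
    rw [← Functor.map_comp, ← Functor.map_comp] at h3
    change (φ.app b).toFunctor.map _ = (φ.app b).toFunctor.map _
    rw [Functor.map_comp, Functor.map_comp, Functor.map_comp, ← Functor.map_comp, h3,
      Functor.map_comp]
  · ext a X
    exact ht a X

end Lift

/-! ### Adjoints of strong transformations from induced objects -/

section Adjunctions

section

open Bicategory

variable {𝔅 : Type*} [Bicategory 𝔅] {a b : 𝔅} {ψ : a ⟶ b} {φ : b ⟶ a} (θ : ψ ≫ φ ≅ 𝟙 a)

/-- The counit is only known after whiskering with `φ`, so this triangle is verified after
whiskering. There the interchange law brings `θ.inv` next to `θ.hom`, and they cancel. -/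
lemma leftZigzag_whiskerRight_of_counit {κ : φ ≫ ψ ⟶ 𝟙 b}
    (h : κ ▷ φ = (α_ φ ψ φ).hom ≫ φ ◁ θ.hom ≫ (ρ_ φ).hom ≫ (λ_ φ).inv) :
    leftZigzag θ.inv κ ▷ φ = ((λ_ ψ).hom ≫ (ρ_ ψ).inv) ▷ φ := by
  have h1 : leftZigzag θ.inv κ ▷ φ = 𝟙 _ ⊗≫ θ.inv ▷ (ψ ≫ φ) ⊗≫ ψ ◁ (κ ▷ φ) ⊗≫ 𝟙 _ := by
    dsimp only [leftZigzag]; bicategory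
  have h2 : 𝟙 _ ⊗≫ θ.inv ▷ (ψ ≫ φ) ⊗≫ ψ ◁ ((α_ φ ψ φ).hom ≫ φ ◁ θ.hom ≫
      (ρ_ φ).hom ≫ (λ_ φ).inv) ⊗≫ 𝟙 _ =
      𝟙 ((𝟙 a ≫ ψ) ≫ φ) ⊗≫ (θ.inv ▷ (ψ ≫ φ) ≫ (ψ ≫ φ) ◁ θ.hom) ⊗≫ 𝟙 ((ψ ≫ 𝟙 b) ≫ φ) := by
    bicategory
  have h3 : 𝟙 ((𝟙 a ≫ ψ) ≫ φ) ⊗≫ (𝟙 a ◁ θ.hom ≫ θ.inv ▷ 𝟙 a) ⊗≫ 𝟙 ((ψ ≫ 𝟙 b) ≫ φ) =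
      𝟙 _ ⊗≫ (θ.hom ≫ θ.inv) ⊗≫ 𝟙 _ := by
    bicategory
  rw [h1, h, h2, ← whisker_exchange, h3, Iso.hom_inv_id]
  bicategory

/-- This triangle contains `κ ▷ φ` itself, so no further whiskering is needed. -/
lemma rightZigzag_of_counit {κ : φ ≫ ψ ⟶ 𝟙 b}
    (h : κ ▷ φ = (α_ φ ψ φ).hom ≫ φ ◁ θ.hom ≫ (ρ_ φ).hom ≫ (λ_ φ).inv) :
    rightZigzag θ.inv κ = (ρ_ φ).hom ≫ (λ_ φ).inv := by
  have h2 : φ ◁ θ.inv ⊗≫ ((α_ φ ψ φ).hom ≫ φ ◁ θ.hom ≫ (ρ_ φ).hom ≫ (λ_ φ).inv) =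
      φ ◁ (θ.inv ≫ θ.hom) ≫ (ρ_ φ).hom ≫ (λ_ φ).inv := by
    bicategory
  rw [rightZigzag, h, h2, Iso.inv_hom_id]
  bicategory

lemma leftZigzag_of_unit {κ : 𝟙 b ⟶ φ ≫ ψ}
    (h : κ ▷ φ = (λ_ φ).hom ≫ (ρ_ φ).inv ≫ φ ◁ θ.inv ≫ (α_ φ ψ φ).inv) :
    leftZigzag κ θ.hom = (λ_ φ).hom ≫ (ρ_ φ).inv := by
  have h2 : ((λ_ φ).hom ≫ (ρ_ φ).inv ≫ φ ◁ θ.inv ≫ (α_ φ ψ φ).inv) ⊗≫ φ ◁ θ.hom =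
      (λ_ φ).hom ≫ (ρ_ φ).inv ≫ φ ◁ (θ.inv ≫ θ.hom) := by
    bicategory
  rw [leftZigzag, h, h2, Iso.inv_hom_id]
  bicategory

lemma rightZigzag_whiskerRight_of_unit {κ : 𝟙 b ⟶ φ ≫ ψ}
    (h : κ ▷ φ = (λ_ φ).hom ≫ (ρ_ φ).inv ≫ φ ◁ θ.inv ≫ (α_ φ ψ φ).inv) :
    rightZigzag κ θ.hom ▷ φ = ((ρ_ ψ).hom ≫ (λ_ ψ).inv) ▷ φ := by
  have h1 : rightZigzag κ θ.hom ▷ φ = 𝟙 _ ⊗≫ ψ ◁ (κ ▷ φ) ⊗≫ θ.hom ▷ (ψ ≫ φ) ⊗≫ 𝟙 _ := by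
    dsimp only [rightZigzag]; bicategory
  have h2 : 𝟙 _ ⊗≫ ψ ◁ ((λ_ φ).hom ≫ (ρ_ φ).inv ≫ φ ◁ θ.inv ≫ (α_ φ ψ φ).inv) ⊗≫
        θ.hom ▷ (ψ ≫ φ) ⊗≫ 𝟙 _ =
      𝟙 ((ψ ≫ 𝟙 b) ≫ φ) ⊗≫ ((ψ ≫ φ) ◁ θ.inv ≫ θ.hom ▷ (ψ ≫ φ)) ⊗≫ 𝟙 ((𝟙 a ≫ ψ) ≫ φ) := by
    bicategory
  have h3 : 𝟙 ((ψ ≫ 𝟙 b) ≫ φ) ⊗≫ (θ.hom ▷ 𝟙 a ≫ 𝟙 a ◁ θ.inv) ⊗≫ 𝟙 ((𝟙 a ≫ ψ) ≫ φ) =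
      𝟙 _ ⊗≫ (θ.hom ≫ θ.inv) ⊗≫ 𝟙 _ := by
    bicategory
  rw [h1, h, h2, whisker_exchange, h3, Iso.hom_inv_id]
  bicategory

end

variable {φ : P ⟶ Q} {ψ : Q ⟶ P}

/-- A section with induced values is a left adjoint. -/
theorem adjunction_of_leftInduced (θ : ψ ≫ φ ≅ 𝟙 Q)
    (H : ∀ (a : B) (Y : Q.obj a), LeftInduced (φ.app a).toFunctor ((ψ.app a).toFunctor.obj Y)) :
    Nonempty (Bicategory.Adjunction ψ φ) := by
  -- The counit is the lift of the isomorphism `(φ ≫ ψ) ≫ φ ≅ 𝟙 P ≫ φ` given by `θ`; it exists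
  -- because the values of `ψ` are induced.
  obtain ⟨κ, hκ⟩ := exists_modification_lift (g := φ ≫ ψ) (h := 𝟙 P) φ (fun a X X' => H a _ _)
    ((Bicategory.associator φ ψ φ).hom ≫ φ ◁ θ.hom ≫ (Bicategory.rightUnitor φ).hom ≫
      (Bicategory.leftUnitor φ).inv)
  exact ⟨{
    unit := θ.inv
    counit := κ
    left_triangle := modification_ext_of_whiskerRight (g := 𝟙 Q ≫ ψ) (h := ψ ≫ 𝟙 P) φ
      (fun a X X' => H a X _) (leftZigzag_whiskerRight_of_counit θ hκ)
    right_triangle := rightZigzag_of_counit θ hκ }⟩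

/-- A section with coinduced values is a right adjoint. -/
theorem adjunction_of_rightInduced (θ : ψ ≫ φ ≅ 𝟙 Q)
    (H : ∀ (a : B) (Y : Q.obj a), RightInduced (φ.app a).toFunctor ((ψ.app a).toFunctor.obj Y)) :
    Nonempty (Bicategory.Adjunction φ ψ) := by
  obtain ⟨κ, hκ⟩ := exists_modification_lift (g := 𝟙 P) (h := φ ≫ ψ) φ (fun a X X' => H a _ _)
    ((Bicategory.leftUnitor φ).hom ≫ (Bicategory.rightUnitor φ).inv ≫ φ ◁ θ.inv ≫
      (Bicategory.associator φ ψ φ).inv)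
  exact ⟨{
    unit := κ
    counit := θ.hom
    left_triangle := leftZigzag_of_unit θ hκ
    right_triangle := modification_ext_of_whiskerRight (g := ψ ≫ 𝟙 P) (h := 𝟙 Q ≫ ψ) φ
      (fun a X X' => H a X' _) (rightZigzag_whiskerRight_of_unit θ hκ) }⟩

variable (φ) in
/-- Existence of a left adjoint of a strong transformation. -/
theorem exists_leftAdjoint (prop : ∀ a : B, ObjectProperty (P.obj a))
    (ind : ∀ {a : B} {X : P.obj a}, prop a X → LeftInduced (φ.app a).toFunctor X)
    (stable : ∀ {a b : B} (f : a ⟶ b) {X : P.obj a}, prop a X →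
      prop b ((P.map f).toFunctor.obj X))
    (surj : ∀ {a : B} (Y : Q.obj a), ∃ X, prop a X ∧
      Nonempty ((φ.app a).toFunctor.obj X ≅ Y)) :
    ∃ ψ : Q ⟶ P, Nonempty (Bicategory.Adjunction ψ φ) := by
  choose obj mem iso using @surj
  let 𝓛 : LiftingData φ :=
    { prop := prop, bij := fun h _ => ind h _, stable := stable, obj := obj, mem := mem
      iso := fun Y => (iso Y).some }
  exact ⟨𝓛.sec, adjunction_of_leftInduced 𝓛.secIso (fun a Y => ind (mem Y))⟩

variable (φ) in
/-- Existence of a right adjoint of a strong transformation. -/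
theorem exists_rightAdjoint (prop : ∀ a : B, ObjectProperty (P.obj a))
    (ind : ∀ {a : B} {X : P.obj a}, prop a X → RightInduced (φ.app a).toFunctor X)
    (stable : ∀ {a b : B} (f : a ⟶ b) {X : P.obj a}, prop a X →
      prop b ((P.map f).toFunctor.obj X))
    (surj : ∀ {a : B} (Y : Q.obj a), ∃ X, prop a X ∧
      Nonempty ((φ.app a).toFunctor.obj X ≅ Y)) :
    ∃ ψ : Q ⟶ P, Nonempty (Bicategory.Adjunction φ ψ) := by
  choose obj mem iso using @surj
  let 𝓛 : LiftingData φ :=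
    { prop := prop, bij := fun _ h => ind h _, stable := stable, obj := obj, mem := mem
      iso := fun Y => (iso Y).some }
  exact ⟨𝓛.sec, adjunction_of_rightInduced 𝓛.secIso (fun a Y => ind (mem Y))⟩

end Adjunctions

end Transformations

namespace Prederivator

variable (D : Prederivator.{w, v, u})

/-! ### Functoriality of restriction -/

section Functoriality

variable {S T A B C : Type w} [Category.{w} S] [Category.{w} T] [Category.{w} A] [Category.{w} B]
  [Category.{w} C]

lemma res_id (A : Type w) [Category.{w} A] : D.res (𝟭 A) = 𝟭 _ :=
  congrArg Cat.Hom.toFunctor (D.map_id (op (Cat.of A)))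

lemma resTrans_id (k : A ⥤ B) : D.resTrans (𝟙 k) = 𝟙 (D.res k) :=
  congrArg Cat.Hom₂.toNatTrans (D.map₂_id k.toCatHom.op)

lemma resTrans_comp {k k' k'' : A ⥤ B} (α : k ⟶ k') (β : k' ⟶ k'') :
    D.resTrans (α ≫ β) = D.resTrans α ≫ D.resTrans β :=
  congrArg Cat.Hom₂.toNatTrans (D.map₂_comp (Bicategory.Opposite.op2 α.toCatHom₂)
    (Bicategory.Opposite.op2 β.toCatHom₂))

/-- Restriction reverses functors and keeps transformations, so it exchanges left and right
whiskering. -/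
lemma resTrans_whiskerLeft (s : S ⥤ A) {k k' : A ⥤ B} (α : k ⟶ k') :
    D.resTrans (Functor.whiskerLeft s α) = eqToHom (D.res_comp s k) ≫
      Functor.whiskerRight (D.resTrans α) (D.res s) ≫ eqToHom (D.res_comp s k').symm := by
  have h := congrArg Cat.Hom₂.toNatTrans
    (D.map₂_whisker_right (Bicategory.Opposite.op2 α.toCatHom₂) s.toCatHom.op)
  rw [D.mapComp_eq_eqToIso, D.mapComp_eq_eqToIso] at h
  refine Eq.trans h ?_
  simp
  rfl

lemma resTrans_whiskerRight {k k' : A ⥤ B} (α : k ⟶ k') (l : B ⥤ C) :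
    D.resTrans (Functor.whiskerRight α l) = eqToHom (D.res_comp k l) ≫
      Functor.whiskerLeft (D.res l) (D.resTrans α) ≫ eqToHom (D.res_comp k' l).symm := by
  have h := congrArg Cat.Hom₂.toNatTrans
    (D.map₂_whisker_left l.toCatHom.op (Bicategory.Opposite.op2 α.toCatHom₂))
  rw [D.mapComp_eq_eqToIso, D.mapComp_eq_eqToIso] at h
  refine Eq.trans h ?_
  simp
  rfl

/-- Restriction along a composite, as an isomorphism. -/
def resComp (k : A ⥤ B) (k' : B ⥤ C) (X : D.val C) :
    (D.res (k ⋙ k')).obj X ≅ (D.res k).obj ((D.res k').obj X) :=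
  eqToIso (congrArg (fun t : D.val C ⥤ D.val A => t.obj X) (D.res_comp k k'))

lemma resComp_naturality (k : A ⥤ B) (k' : B ⥤ C) {X X' : D.val C} (f : X ⟶ X') :
    (D.res (k ⋙ k')).map f ≫ (D.resComp k k' X').hom =
      (D.resComp k k' X).hom ≫ (D.res k).map ((D.res k').map f) := by
  have := (eqToHom (D.res_comp k k')).naturality f
  simpa [resComp, eqToHom_app] using this

lemma resTrans_whiskerLeft_app (s : S ⥤ A) {k k' : A ⥤ B} (α : k ⟶ k') (X : D.val B) :
    (D.resTrans (Functor.whiskerLeft s α)).app X = (D.resComp s k X).hom ≫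
      (D.res s).map ((D.resTrans α).app X) ≫ (D.resComp s k' X).inv := by
  rw [resTrans_whiskerLeft]
  simp [resComp, eqToHom_app]

lemma resTrans_whiskerRight_app {k k' : A ⥤ B} (α : k ⟶ k') (l : B ⥤ C) (X : D.val C) :
    (D.resTrans (Functor.whiskerRight α l)).app X = (D.resComp k l X).hom ≫
      (D.resTrans α).app ((D.res l).obj X) ≫ (D.resComp k' l X).inv := by
  rw [resTrans_whiskerRight]
  simp [resComp, eqToHom_app]

/-- An isomorphism of functors induces an isomorphism of restriction functors. -/
def resIso {k k' : A ⥤ B} (e : k ≅ k') : D.res k ≅ D.res k' where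
  hom := D.resTrans e.hom
  inv := D.resTrans e.inv
  hom_inv_id := by rw [← resTrans_comp, e.hom_inv_id, resTrans_id]
  inv_hom_id := by rw [← resTrans_comp, e.inv_hom_id, resTrans_id]

/-- Restriction along `k` then `k'` only depends on the composite. -/
def resComp₂ {A' : Type w} [Category.{w} A'] {k : A ⥤ B} {k' : B ⥤ C} {l : A ⥤ A'} {l' : A' ⥤ C}
    (h : k ⋙ k' = l ⋙ l') (X : D.val C) :
    (D.res k).obj ((D.res k').obj X) ≅ (D.res l).obj ((D.res l').obj X) :=
  (D.resComp k k' X).symm ≪≫ eqToIso (by rw [h]) ≪≫ D.resComp l l' X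

lemma resSquare_app {E : Type w} [Category.{w} E] {p : E ⥤ A} {k : A ⥤ C} {q : E ⥤ B}
    {l : B ⥤ C} (α : p ⋙ k ⟶ q ⋙ l) (X : D.val C) :
    (D.resSquare α).app X =
      (D.resComp p k X).inv ≫ (D.resTrans α).app X ≫ (D.resComp q l X).hom := by
  simp [resSquare, resComp, eqToHom_app]

/-- The adjunction in the opposite bicategory of `Cat`. -/
def opAdj {r : A ⥤ B} {s : B ⥤ A} (adj : r ⊣ s) :
    Bicategory.Adjunction s.toCatHom.op r.toCatHom.op where
  unit := Bicategory.Opposite.op2 adj.toCat.unit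
  counit := Bicategory.Opposite.op2 adj.toCat.counit
  left_triangle := by
    refine congrArg Bicategory.Opposite.op2 (a₁ := Bicategory.Opposite.Hom2.unop2 _)
      (a₂ := Bicategory.Opposite.Hom2.unop2 _) ?_
    ext X
    have h : adj.unit.app (s.obj X) ≫ 𝟙 _ ≫ s.map (adj.counit.app X) = 𝟙 _ ≫ 𝟙 _ := by simp
    simp
    exact h
  right_triangle := by
    refine congrArg Bicategory.Opposite.op2 (a₁ := Bicategory.Opposite.Hom2.unop2 _)
      (a₂ := Bicategory.Opposite.Hom2.unop2 _) ?_
    ext X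
    have h : r.map (adj.unit.app X) ≫ 𝟙 _ ≫ adj.counit.app (r.obj X) = 𝟙 _ ≫ 𝟙 _ := by simp
    simp
    exact h

/-- Restriction turns the adjunction `r ⊣ s` into `s^* ⊣ r^*`. -/
def resAdj {r : A ⥤ B} {s : B ⥤ A} (adj : r ⊣ s) : D.res s ⊣ D.res r :=
  Adjunction.ofCat (D.toPseudofunctor.mapAdjunction (opAdj adj))

/-- The unit of the restricted adjunction is restriction along the original unit, up to the
invertible comparison cells of the 2-functor. -/
lemma isIso_resAdj_unit_app {r : A ⥤ B} {s : B ⥤ A} (adj : r ⊣ s) (X : D.val A)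
    (h : IsIso ((D.resTrans adj.unit).app X)) : IsIso ((D.resAdj adj).unit.app X) := by
  have : (D.resAdj adj).unit.app X = (D.mapId _).inv.toNatTrans.app X ≫
    (D.resTrans adj.unit).app X ≫ (D.mapComp s.toCatHom.op r.toCatHom.op).hom.toNatTrans.app X := by
    simp [resAdj]
    rfl
  rw [this]
  exact IsIso.comp_isIso' (NatIso.isIso_app_of_isIso _ _)
    (IsIso.comp_isIso' h (NatIso.isIso_app_of_isIso _ _))

lemma isIso_resAdj_counit_app {r : A ⥤ B} {s : B ⥤ A} (adj : r ⊣ s) (X : D.val B)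
    (h : IsIso ((D.resTrans adj.counit).app X)) : IsIso ((D.resAdj adj).counit.app X) := by
  have : (D.resAdj adj).counit.app X =
    (D.mapComp r.toCatHom.op s.toCatHom.op).inv.toNatTrans.app X ≫ (D.resTrans adj.counit).app X ≫ (D.mapId _).hom.toNatTrans.app X := by
    simp [resAdj]
    rfl
  rw [this]
  exact IsIso.comp_isIso' (NatIso.isIso_app_of_isIso _ _)
    (IsIso.comp_isIso' h (NatIso.isIso_app_of_isIso _ _))

end Functoriality

/-! ### Kan extensions of coherent diagrams -/

section Kan

variable {S T A B C : Type w} [Category.{w} S] [Category.{w} T] [Category.{w} A] [Category.{w} B]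
  [Category.{w} C]

/-- The morphism `f : X ⟶ k^* Y` exhibits `Y` as the left Kan extension of `X` along `k`. -/
def IsLan (k : A ⥤ B) {X : D.val A} {Y : D.val B} (f : X ⟶ (D.res k).obj Y) : Prop :=
  ∀ Z, Function.Bijective (fun g : Y ⟶ Z => f ≫ (D.res k).map g)

/-- The morphism `f : k^* Y ⟶ X` exhibits `Y` as the right Kan extension of `X` along `k`. -/
def IsRan (k : A ⥤ B) {X : D.val A} {Y : D.val B} (f : (D.res k).obj Y ⟶ X) : Prop :=
  ∀ Z, Function.Bijective (fun g : Z ⟶ Y => (D.res k).map g ≫ f)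

variable {D}

lemma leftInduced_iff_isLan (k : A ⥤ B) (Y : D.val B) :
    LeftInduced (D.res k) Y ↔ D.IsLan k (𝟙 ((D.res k).obj Y)) := by
  simp [LeftInduced, IsLan]

lemma rightInduced_iff_isRan (k : A ⥤ B) (Y : D.val B) :
    RightInduced (D.res k) Y ↔ D.IsRan k (𝟙 ((D.res k).obj Y)) := by
  simp [RightInduced, IsRan]

/-- Under the adjunction the map in `IsLan` becomes precomposition with the adjunct of `f`; then
Yoneda applies. -/
lemma isLan_iff_isIso (k : A ⥤ B) {X : D.val A} {Y : D.val B} (f : X ⟶ (D.res k).obj Y)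
    {L : D.val A ⥤ D.val B} (adj : L ⊣ D.res k) :
    D.IsLan k f ↔ IsIso ((adj.homEquiv X Y).symm f) := by
  have key : ∀ Z, Function.Bijective (fun g : Y ⟶ Z => f ≫ (D.res k).map g) ↔
      Function.Bijective (fun g : Y ⟶ Z => (adj.homEquiv X Y).symm f ≫ g) := fun Z => by
    rw [← bijective_comp_iff_left (adj.homEquiv X Z).symm.bijective]
    apply iff_of_eq
    congr 1
    ext g
    simp [Adjunction.homEquiv_counit]
  constructor
  · intro h
    exact isIso_of_bijective_precomp _ fun Z => (key Z).1 (h Z)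
  · intro h Z
    exact (key Z).2 (bijective_precomp _ Z)

lemma isRan_iff_isIso (k : A ⥤ B) {X : D.val A} {Y : D.val B} (f : (D.res k).obj Y ⟶ X)
    {R : D.val A ⥤ D.val B} (adj : D.res k ⊣ R) :
    D.IsRan k f ↔ IsIso (adj.homEquiv Y X f) := by
  have key : ∀ Z, Function.Bijective (fun g : Z ⟶ Y => (D.res k).map g ≫ f) ↔
      Function.Bijective (fun g : Z ⟶ Y => g ≫ adj.homEquiv Y X f) := fun Z => by
    rw [← bijective_comp_iff_left (adj.homEquiv Z X).bijective]
    apply iff_of_eq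
    congr 1
    ext g
    simp [Adjunction.homEquiv_unit]
  constructor
  · intro h
    exact isIso_of_bijective_postcomp _ fun Z => (key Z).1 (h Z)
  · intro h Z
    exact (key Z).2 (bijective_postcomp _ Z)

lemma isLan_congr {k : A ⥤ B} {X X' : D.val A} {Y Y' : D.val B} {f : X ⟶ (D.res k).obj Y}
    {f' : X' ⟶ (D.res k).obj Y'} (e : X' ≅ X) (e' : Y ≅ Y')
    (h : f' = e.hom ≫ f ≫ (D.res k).map e'.hom) : D.IsLan k f ↔ D.IsLan k f' := by
  refine forall_congr' fun Z => ?_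
  rw [← bijective_comp_iff_left (bijective_precomp e.hom _) (fun g : Y ⟶ Z => _),
    ← bijective_comp_iff_right (bijective_precomp e'.hom Z)]
  apply iff_of_eq
  congr 1
  ext g
  simp [h]

lemma isRan_congr {k : A ⥤ B} {X X' : D.val A} {Y Y' : D.val B} {f : (D.res k).obj Y ⟶ X}
    {f' : (D.res k).obj Y' ⟶ X'} (e : X ≅ X') (e' : Y' ≅ Y)
    (h : f' = (D.res k).map e'.hom ≫ f ≫ e.hom) : D.IsRan k f ↔ D.IsRan k f' := by
  refine forall_congr' fun Z => ?_
  rw [← bijective_comp_iff_left (bijective_postcomp e.hom _) (fun g : Z ⟶ Y => _),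
    ← bijective_comp_iff_right (bijective_postcomp e'.hom Z)]
  apply iff_of_eq
  congr 1
  ext g
  simp [h]

/-- The canonical morphism of diagrams on the slice category `(k/b)`. -/
def sliceLeftMap (k : A ⥤ B) (b : B) {X : D.val A} {Y : D.val B} (f : X ⟶ (D.res k).obj Y) :
    (D.res (Comma.fst k (Functor.fromPUnit.{w} b))).obj X ⟶
      (D.res (Comma.snd k (Functor.fromPUnit.{w} b))).obj
        ((D.res (Functor.fromPUnit.{w} b)).obj Y) :=
  (D.res (Comma.fst k (Functor.fromPUnit.{w} b))).map f ≫
    (D.resSquare (Comma.natTrans k (Functor.fromPUnit.{w} b))).app Y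

/-- The canonical morphism of diagrams on the slice category `(b/k)`. -/
def sliceRightMap (k : A ⥤ B) (b : B) {X : D.val A} {Y : D.val B} (f : (D.res k).obj Y ⟶ X) :
    (D.res (Comma.fst (Functor.fromPUnit.{w} b) k)).obj
        ((D.res (Functor.fromPUnit.{w} b)).obj Y) ⟶
      (D.res (Comma.snd (Functor.fromPUnit.{w} b) k)).obj X :=
  (D.resSquare (Comma.natTrans (Functor.fromPUnit.{w} b) k)).app Y ≫
    (D.res (Comma.snd (Functor.fromPUnit.{w} b) k)).map f

/-- Left Kan extensions are detected pointwise. -/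
theorem isLan_iff_slices (hD : D.IsDerivator) (k : A ⥤ B) {X : D.val A} {Y : D.val B}
    (f : X ⟶ (D.res k).obj Y) : D.IsLan k f ↔
      ∀ b, D.IsLan (Comma.snd k (Functor.fromPUnit.{w} b)) (sliceLeftMap k b f) := by
  have := hD.der3_left A B k
  let L := (D.res k).leftAdjoint
  let adj : L ⊣ D.res k := Adjunction.ofIsRightAdjoint (D.res k)
  rw [isLan_iff_isIso k f adj, hD.der2]
  refine forall_congr' fun b => ?_
  have := hD.der3_left _ _ (Comma.snd k (Functor.fromPUnit.{w} b))
  let adj' := Adjunction.ofIsRightAdjoint (D.res (Comma.snd k (Functor.fromPUnit.{w} b)))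
  rw [isLan_iff_isIso _ _ adj']
  have hm : IsIso ((D.leftMate k b adj adj').app X) := by
    have := hD.der4_left A B k b _ adj _ adj'
    infer_instance
  -- The adjunct of the slice map is the mate, invertible by (Der4), followed by the value at `b` of
  -- the adjunct of `f`. So the two adjuncts are invertible together.
  have key : (adj'.homEquiv _ _).symm (sliceLeftMap k b f) =
      (D.leftMate k b adj adj').app X ≫
        (D.res (Functor.fromPUnit.{w} b)).map ((adj.homEquiv X Y).symm f) := by
    rw [Equiv.symm_apply_eq, Adjunction.homEquiv_unit]
    have h1 := unit_mateEquiv_symm adj adj' (TwoSquare.mk _ _ _ _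
      (D.resSquare (Comma.natTrans k (Functor.fromPUnit.{w} b)))) X
    have h2 := (D.resSquare (Comma.natTrans k (Functor.fromPUnit.{w} b))).naturality
      ((adj.homEquiv X Y).symm f)
    have h3 : adj.unit.app X ≫ (D.res k).map ((adj.homEquiv X Y).symm f) = f := by
      simp [Adjunction.homEquiv_counit]
    have h4 : (D.res (Comma.fst k (Functor.fromPUnit.{w} b))).map (adj.unit.app X) ≫
        (D.resSquare (Comma.natTrans k (Functor.fromPUnit.{w} b))).app (L.obj X) =
        adj'.unit.app _ ≫ (D.res (Comma.snd k (Functor.fromPUnit.{w} b))).map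
          ((D.leftMate k b adj adj').app X) := h1
    rw [Functor.map_comp, ← reassoc_of% h4]
    refine Eq.trans ?_ (congrArg
      ((D.res (Comma.fst k (Functor.fromPUnit.{w} b))).map (adj.unit.app X) ≫ ·) h2)
    rw [sliceLeftMap, Functor.comp_map, ← Functor.map_comp_assoc, h3]
  rw [key]
  constructor
  · intro h; infer_instance
  · intro h
    exact IsIso.of_isIso_comp_left ((D.leftMate k b adj adj').app X) _

/-- Right Kan extensions are detected pointwise. -/
theorem isRan_iff_slices (hD : D.IsDerivator) (k : A ⥤ B) {X : D.val A} {Y : D.val B}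
    (f : (D.res k).obj Y ⟶ X) : D.IsRan k f ↔
      ∀ b, D.IsRan (Comma.fst (Functor.fromPUnit.{w} b) k) (sliceRightMap k b f) := by
  have := hD.der3_right A B k
  let R := (D.res k).rightAdjoint
  let adj : D.res k ⊣ R := Adjunction.ofIsLeftAdjoint (D.res k)
  rw [isRan_iff_isIso k f adj, hD.der2]
  refine forall_congr' fun b => ?_
  have := hD.der3_right _ _ (Comma.fst (Functor.fromPUnit.{w} b) k)
  let adj' := Adjunction.ofIsLeftAdjoint (D.res (Comma.fst (Functor.fromPUnit.{w} b) k))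
  rw [isRan_iff_isIso _ _ adj']
  have hm : IsIso ((D.rightMate k b adj adj').app X) := by
    have := hD.der4_right A B k b _ adj _ adj'
    infer_instance
  have key : adj'.homEquiv _ _ (sliceRightMap k b f) =
      (D.res (Functor.fromPUnit.{w} b)).map (adj.homEquiv Y X f) ≫
        (D.rightMate k b adj adj').app X := by
    rw [← Equiv.eq_symm_apply, Adjunction.homEquiv_counit]
    have h1 := mateEquiv_counit adj adj' (TwoSquare.mk _ _ _ _
      (D.resSquare (Comma.natTrans (Functor.fromPUnit.{w} b) k))) X
    have h2 := (D.resSquare (Comma.natTrans (Functor.fromPUnit.{w} b) k)).naturality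
      (adj.homEquiv Y X f)
    have h3 : (D.res k).map (adj.homEquiv Y X f) ≫ adj.counit.app X = f := by
      simp [Adjunction.homEquiv_unit]
    have h4 : (D.res (Comma.fst (Functor.fromPUnit.{w} b) k)).map
          ((D.rightMate k b adj adj').app X) ≫ adj'.counit.app _ =
        (D.resSquare (Comma.natTrans (Functor.fromPUnit.{w} b) k)).app (R.obj X) ≫
          (D.res (Comma.snd (Functor.fromPUnit.{w} b) k)).map (adj.counit.app X) := h1
    rw [Functor.map_comp, Category.assoc, h4]
    refine Eq.trans ?_ ((congrArg (· ≫ (D.res (Comma.snd (Functor.fromPUnit.{w} b) k)).map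
      (adj.counit.app X)) h2).symm.trans (Category.assoc _ _ _))
    rw [sliceRightMap, Functor.comp_map, Category.assoc, ← Functor.map_comp, h3]
  rw [key]
  constructor
  · intro h; infer_instance
  · intro h
    exact IsIso.of_isIso_comp_right _ ((D.rightMate k b adj adj').app X)

/-! ### Colimits and limits along cocones and cones -/

/-- The morphism of diagrams on `S` given by a cocone `γ` in `B` and a diagram on `B`. -/
def coconeMap {h : S ⥤ B} {b : B} (γ : h ⟶ (Functor.const S).obj b) (Y : D.val B) :
    (D.res h).obj Y ⟶
      (D.res (Functor.star.{w} S)).obj ((D.res (Functor.fromPUnit.{w} b)).obj Y) :=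
  (D.resTrans γ).app Y ≫ (D.resComp (Functor.star.{w} S) (Functor.fromPUnit.{w} b) Y).hom

/-- The morphism of diagrams on `S` given by a cone `γ` in `B` and a diagram on `B`. -/
def coneMap {h : S ⥤ B} {b : B} (γ : (Functor.const S).obj b ⟶ h) (Y : D.val B) :
    (D.res (Functor.star.{w} S)).obj ((D.res (Functor.fromPUnit.{w} b)).obj Y) ⟶
      (D.res h).obj Y :=
  (D.resComp (Functor.star.{w} S) (Functor.fromPUnit.{w} b) Y).inv ≫ (D.resTrans γ).app Y

/-- The diagram `Y` has a colimiting value at `b`. -/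
def IsColim {h : S ⥤ B} {b : B} (γ : h ⟶ (Functor.const S).obj b) (Y : D.val B) : Prop :=
  D.IsLan (Functor.star.{w} S) (coconeMap γ Y)

/-- The diagram `Y` has a limiting value at `b`. -/
def IsLim {h : S ⥤ B} {b : B} (γ : (Functor.const S).obj b ⟶ h) (Y : D.val B) : Prop :=
  D.IsRan (Functor.star.{w} S) (coneMap γ Y)

/-- Induced diagrams are those whose values are colimits over slices. -/
theorem leftInduced_iff_isColim (hD : D.IsDerivator) (k : A ⥤ B) (Y : D.val B) :
    LeftInduced (D.res k) Y ↔
      ∀ b, IsColim (h := Comma.fst k (Functor.fromPUnit.{w} b) ⋙ k) (b := b)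
        (Comma.natTrans k (Functor.fromPUnit.{w} b)) Y := by
  rw [leftInduced_iff_isLan, isLan_iff_slices hD]
  refine forall_congr' fun b => ?_
  refine isLan_congr (D.resComp _ _ Y) (Iso.refl _) ?_
  simp [coconeMap, sliceLeftMap, resSquare_app]
  rfl

/-- Coinduced diagrams are those whose values are limits over slices. -/
theorem rightInduced_iff_isLim (hD : D.IsDerivator) (k : A ⥤ B) (Y : D.val B) :
    RightInduced (D.res k) Y ↔
      ∀ b, IsLim (h := Comma.snd (Functor.fromPUnit.{w} b) k ⋙ k) (b := b)
        (Comma.natTrans (Functor.fromPUnit.{w} b) k) Y := by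
  rw [rightInduced_iff_isRan, isRan_iff_slices hD]
  refine forall_congr' fun b => ?_
  refine isRan_congr (D.resComp _ _ Y).symm (Iso.refl _) ?_
  simp [coneMap, sliceRightMap, resSquare_app]
  rfl

/-! ### Colimits and limits under restriction, and cofinality -/

section Restriction

variable {h : S ⥤ B} {b : B} {l : B ⥤ C}

lemma resTrans_eqToHom {k k' : A ⥤ B} (e : k = k') :
    D.resTrans (eqToHom e) = eqToHom (by rw [e]) := by
  subst e
  simp [resTrans_id]

lemma fromPUnit_comp (b : B) (l : B ⥤ C) :
    Functor.fromPUnit.{w} b ⋙ l = Functor.fromPUnit.{w} (l.obj b) :=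
  Functor.hext (fun _ => rfl) (fun _ _ _ => heq_of_eq (l.map_id b))

lemma const_obj_comp (b : B) (l : B ⥤ C) :
    (Functor.const S).obj b ⋙ l = (Functor.const S).obj (l.obj b) :=
  Functor.hext (fun _ => rfl) (fun _ _ _ => heq_of_eq (l.map_id b))

/-- The value at `b` of a restriction along `l`. -/
def resPt (l : B ⥤ C) (b : B) (Y : D.val C) :
    (D.res (Functor.fromPUnit.{w} b)).obj ((D.res l).obj Y) ≅
      (D.res (Functor.fromPUnit.{w} (l.obj b))).obj Y :=
  (D.resComp _ l Y).symm ≪≫ eqToIso (by rw [fromPUnit_comp])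

/-- The two universal properties concern the same morphism up to canonical isomorphism. The cocone
`γ'` is pinned down by its components only, since the constant functors in question agree through
`l.map_id`, not by definition. -/
lemma isColim_res_iff (γ : h ⟶ (Functor.const S).obj b)
    (γ' : h ⋙ l ⟶ (Functor.const S).obj (l.obj b)) (hγ : ∀ s, γ'.app s = l.map (γ.app s))
    (Y : D.val C) : IsColim γ ((D.res l).obj Y) ↔ IsColim γ' Y := by
  refine isLan_congr (D.resComp h l Y) (resPt l b Y) ?_
  have : γ' = Functor.whiskerRight γ l ≫ eqToHom (const_obj_comp b l) := by
    ext s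
    simp [hγ, eqToHom_app]
  subst this
  simp only [coconeMap, resTrans_comp, resTrans_eqToHom, NatTrans.comp_app,
    resTrans_whiskerRight_app, Category.assoc]
  simp [resComp, resPt, eqToHom_app, eqToHom_map]

lemma isLim_res_iff (γ : (Functor.const S).obj b ⟶ h)
    (γ' : (Functor.const S).obj (l.obj b) ⟶ h ⋙ l) (hγ : ∀ s, γ'.app s = l.map (γ.app s))
    (Y : D.val C) : IsLim γ ((D.res l).obj Y) ↔ IsLim γ' Y := by
  refine isRan_congr (D.resComp h l Y).symm (resPt l b Y).symm ?_
  have : γ' = eqToHom (const_obj_comp b l).symm ≫ Functor.whiskerRight γ l := by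
    ext s
    simp [hγ, eqToHom_app]
  subst this
  simp only [coneMap, resTrans_comp, resTrans_eqToHom, NatTrans.comp_app,
    resTrans_whiskerRight_app, Category.assoc]
  simp [resComp, resPt, eqToHom_app, eqToHom_map]

lemma isIso_resTrans {k k' : A ⥤ B} (α : k ⟶ k') [IsIso α] : IsIso (D.resTrans α) :=
  inferInstanceAs (IsIso (D.resIso (asIso α)).hom)

lemma isIso_of_isIso_conj {𝒞 : Type*} [Category* 𝒞] {X Y X' Y' : 𝒞} (e : X ≅ X') {f : X' ⟶ Y'}
    (e' : Y ≅ Y') (h : IsIso (e.hom ≫ f ≫ e'.inv)) : IsIso f := by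
  have : f = e.inv ≫ (e.hom ≫ f ≫ e'.inv) ≫ e'.hom := by simp
  rw [this]
  infer_instance

/-- The unit of `r ⊣ s` becomes invertible when `S` is collapsed to a point, so the unit of `s^* ⊣
r^*` is invertible on constant diagrams. This is the cofinality of right adjoints. -/
lemma rightInduced_res_star {r : S ⥤ T} {s : T ⥤ S} (adj : r ⊣ s)
    (Z : D.val (Discrete PUnit.{w + 1})) :
    RightInduced (D.res s) ((D.res (Functor.star.{w} S)).obj Z) := by
  have : IsIso ((D.resAdj adj).unit.app ((D.res (Functor.star.{w} S)).obj Z)) := by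
    apply isIso_resAdj_unit_app
    have h := D.resTrans_whiskerRight_app adj.unit (Functor.star.{w} S) Z
    have h2 : IsIso (Functor.whiskerRight adj.unit (Functor.star.{w} S)) :=
      NatIso.isIso_of_isIso_app _
    have h3 := D.isIso_resTrans (Functor.whiskerRight adj.unit (Functor.star.{w} S))
    have h4 : IsIso ((D.resTrans (Functor.whiskerRight adj.unit (Functor.star.{w} S))).app Z) :=
      inferInstance
    rw [h] at h4
    exact isIso_of_isIso_conj _ _ h4
  exact RightInduced.of_isIso_unit (D.resAdj adj)

lemma leftInduced_res_star {s : T ⥤ S} {r : S ⥤ T} (adj : s ⊣ r)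
    (Z : D.val (Discrete PUnit.{w + 1})) :
    LeftInduced (D.res s) ((D.res (Functor.star.{w} S)).obj Z) := by
  have : IsIso ((D.resAdj adj).counit.app ((D.res (Functor.star.{w} S)).obj Z)) := by
    apply isIso_resAdj_counit_app
    have h := D.resTrans_whiskerRight_app adj.counit (Functor.star.{w} S) Z
    have h2 : IsIso (Functor.whiskerRight adj.counit (Functor.star.{w} S)) :=
      NatIso.isIso_of_isIso_app _
    have h3 := D.isIso_resTrans (Functor.whiskerRight adj.counit (Functor.star.{w} S))
    have h4 : IsIso ((D.resTrans (Functor.whiskerRight adj.counit (Functor.star.{w} S))).app Z) :=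
      inferInstance
    rw [h] at h4
    exact isIso_of_isIso_conj _ _ h4
  exact LeftInduced.of_isIso_counit (D.resAdj adj)

/-- Restriction of constant diagrams. -/
def starIso (s : T ⥤ S) (Z : D.val (Discrete PUnit.{w + 1})) :
    (D.res (Functor.star.{w} T)).obj Z ≅ (D.res s).obj ((D.res (Functor.star.{w} S)).obj Z) :=
  D.resComp s (Functor.star.{w} S) Z

lemma starIso_naturality (s : T ⥤ S) {Z Z' : D.val (Discrete PUnit.{w + 1})} (g : Z ⟶ Z') :
    (D.res (Functor.star.{w} T)).map g ≫ (starIso s Z').hom =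
      (starIso s Z).hom ≫ (D.res s).map ((D.res (Functor.star.{w} S)).map g) :=
  D.resComp_naturality s (Functor.star.{w} S) g

/-- Colimits may be computed after restriction along a right adjoint. -/
theorem isColim_whiskerLeft_iff {r : S ⥤ T} {s : T ⥤ S} (adj : r ⊣ s)
    (γ : h ⟶ (Functor.const S).obj b) (γ' : s ⋙ h ⟶ (Functor.const T).obj b)
    (hγ : ∀ t, γ'.app t = γ.app (s.obj t)) (Y : D.val B) :
    IsColim γ' Y ↔ IsColim γ Y := by
  refine forall_congr' fun Z => ?_
  obtain rfl : γ' = Functor.whiskerLeft s γ := by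
    ext t
    exact hγ t
  have key : coconeMap (Functor.whiskerLeft s γ : s ⋙ h ⟶ (Functor.const T).obj b) Y =
      (D.resComp s h Y).hom ≫ (D.res s).map (coconeMap γ Y) ≫
        (starIso s _).inv := by
    change (D.resTrans (Functor.whiskerLeft s γ)).app Y ≫ (D.resComp (s ⋙ Functor.star.{w} S)
      (Functor.fromPUnit.{w} b) Y).hom = _ ≫ _ ≫ (D.resComp s (Functor.star.{w} S) _).inv
    simp only [coconeMap, Functor.map_comp]
    rw [resTrans_whiskerLeft_app]
    simp [resComp, eqToHom_map]
  -- Constant diagrams are coinduced along `s`, so maps into them may be tested after `s^*`; this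
  -- identifies the universal properties over `S` and `T`.
  rw [← bijective_comp_iff_left (rightInduced_res_star adj Z _) (fun g => coconeMap γ Y ≫ _),
    ← bijective_comp_iff_left (bijective_precomp (D.resComp s h Y).hom _),
    ← bijective_comp_iff_left (bijective_postcomp (starIso s Z).inv _)]
  apply iff_of_eq
  congr 1
  ext g
  have := starIso_naturality s g
  have h2 : (D.res s).map ((D.res (Functor.star.{w} S)).map g) ≫
      (starIso s Z).inv = (starIso s _).inv ≫
        (D.res (Functor.star.{w} T)).map g := by
    rw [Iso.eq_inv_comp, ← Category.assoc, Iso.comp_inv_eq]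
    exact this.symm
  simp only [Function.comp_apply, Functor.map_comp, Category.assoc, h2]
  rw [key]
  simp

/-- Limits may be computed after restriction along a left adjoint. -/
theorem isLim_whiskerLeft_iff {s : T ⥤ S} {r : S ⥤ T} (adj : s ⊣ r)
    (γ : (Functor.const S).obj b ⟶ h) (γ' : (Functor.const T).obj b ⟶ s ⋙ h)
    (hγ : ∀ t, γ'.app t = γ.app (s.obj t)) (Y : D.val B) :
    IsLim γ' Y ↔ IsLim γ Y := by
  refine forall_congr' fun Z => ?_
  obtain rfl : γ' = Functor.whiskerLeft s γ := by
    ext t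
    exact hγ t
  have key : coneMap (Functor.whiskerLeft s γ : (Functor.const T).obj b ⟶ s ⋙ h) Y =
      (starIso s _).hom ≫ (D.res s).map (coneMap γ Y) ≫
        (D.resComp s h Y).inv := by
    change (D.resComp (s ⋙ Functor.star.{w} S) (Functor.fromPUnit.{w} b) Y).inv ≫
      (D.resTrans (Functor.whiskerLeft s γ)).app Y =
        (D.resComp s (Functor.star.{w} S) _).hom ≫ _ ≫ _
    simp only [coneMap, Functor.map_comp]
    rw [resTrans_whiskerLeft_app]
    simp [resComp, eqToHom_map]
  rw [← bijective_comp_iff_left (leftInduced_res_star adj Z _) (fun g => _ ≫ coneMap γ Y),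
    ← bijective_comp_iff_left (bijective_postcomp (D.resComp s h Y).inv _),
    ← bijective_comp_iff_left (bijective_precomp (starIso s Z).hom _)]
  apply iff_of_eq
  congr 1
  ext g
  have := starIso_naturality s g
  have h2 : (starIso s Z).hom ≫
      (D.res s).map ((D.res (Functor.star.{w} S)).map g) =
        (D.res (Functor.star.{w} T)).map g ≫ (starIso s _).hom :=
    this.symm
  simp only [Function.comp_apply, Functor.map_comp, Category.assoc, reassoc_of% h2]
  rw [key]

end Restriction

end Kan

end Prederivator

namespace Prederivator

variable {D : Prederivator.{w, v, u}}

/-! ### Terminal and initial objects, and Kan extensions along fully faithful functors -/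

section FullyFaithful

lemma isIso_homEquiv_symm_unit {𝒞 𝒟 : Type*} [Category* 𝒞] [Category* 𝒟] {F : 𝒞 ⥤ 𝒟}
    {G : 𝒟 ⥤ 𝒞} (adj : F ⊣ G) (X : 𝒞) :
    IsIso ((adj.homEquiv X (F.obj X)).symm (adj.unit.app X)) := by
  rw [adj.homEquiv_counit, adj.left_triangle_components]
  infer_instance

lemma isIso_homEquiv_counit {𝒞 𝒟 : Type*} [Category* 𝒞] [Category* 𝒟] {F : 𝒞 ⥤ 𝒟}
    {G : 𝒟 ⥤ 𝒞} (adj : F ⊣ G) (Y : 𝒟) :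
    IsIso (adj.homEquiv (G.obj Y) Y (adj.counit.app Y)) := by
  rw [adj.homEquiv_unit, adj.right_triangle_components]
  infer_instance

variable {S T A B C : Type w} [Category.{w} S] [Category.{w} T] [Category.{w} A] [Category.{w} B]
  [Category.{w} C]

lemma bijective_res_map_of_eq_id {k : A ⥤ A} (hk : k = 𝟭 A) (Z Z' : D.val A) :
    Function.Bijective (fun g : Z ⟶ Z' => (D.res k).map g) :=
  bijective_map_of_eq_id (by rw [hk, res_id]) Z Z'

/-- The right adjoint of the projection to the point given by a terminal object. -/
def starAdj {t : S} (ht : Limits.IsTerminal t) : Functor.star.{w} S ⊣ Functor.fromPUnit.{w} t :=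
  Adjunction.mkOfHomEquiv
    { homEquiv := fun X Y =>
        { toFun := fun _ => ht.from X
          invFun := fun _ => eqToHom (by rfl)
          left_inv := fun _ => Subsingleton.elim _ _
          right_inv := fun _ => ht.hom_ext _ _ }
      homEquiv_naturality_left_symm := fun _ _ => Subsingleton.elim _ _
      homEquiv_naturality_right := fun _ _ => ht.hom_ext _ _ }

/-- The left adjoint of the projection to the point given by an initial object. -/
def starAdj' {t : S} (ht : Limits.IsInitial t) : Functor.fromPUnit.{w} t ⊣ Functor.star.{w} S :=
  Adjunction.mkOfHomEquiv
    { homEquiv := fun X Y =>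
        { toFun := fun _ => eqToHom (by rfl)
          invFun := fun _ => ht.to Y
          left_inv := fun _ => ht.hom_ext _ _
          right_inv := fun _ => Subsingleton.elim _ _ }
      homEquiv_naturality_left_symm := fun _ _ => ht.hom_ext _ _
      homEquiv_naturality_right := fun _ _ => Subsingleton.elim _ _ }

lemma isIso_map_of_isIso_map {𝒞 𝒟 ℰ : Type*} [Category* 𝒞] [Category* 𝒟] [Category* ℰ]
    {F : 𝒞 ⥤ ℰ} {G : 𝒞 ⥤ 𝒟} {H : 𝒟 ⥤ ℰ} (h : F = G ⋙ H) {X Y : 𝒞} (f : X ⟶ Y) :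
    IsIso (F.map f) ↔ IsIso (H.map (G.map f)) := by
  subst h; rfl

/-- A terminal object `t` is right adjoint to the projection of `S` to the point. Hence maps into
constant diagrams are determined by their value at `t`, and evaluation at `t` is the colimit. -/
lemma isLan_star_iff {t : S} (ht : Limits.IsTerminal t) {X : D.val S}
    {Z : D.val (Discrete PUnit.{w + 1})} (f : X ⟶ (D.res (Functor.star.{w} S)).obj Z) :
    D.IsLan (Functor.star.{w} S) f ↔ IsIso ((D.res (Functor.fromPUnit.{w} t)).map f) := by
  have hb : ∀ W, Function.Bijective (fun g : Z ⟶ W =>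
      (D.res (Functor.fromPUnit.{w} t)).map ((D.res (Functor.star.{w} S)).map g)) := by
    intro W
    refine (bijective_comp_iff_left (bijective_precomp (starIso (Functor.fromPUnit.{w} t) Z).hom _)
      _).1 ?_
    refine Bijective.congr_fun
      ((bijective_postcomp (starIso (Functor.fromPUnit.{w} t) W).hom _).comp
      (bijective_res_map_of_eq_id (D := D) (k := Functor.star.{w} (Discrete PUnit.{w + 1})) rfl
        Z W)) fun g => ?_
    exact starIso_naturality _ g
  have key : ∀ W, Function.Bijective (fun g : Z ⟶ W => f ≫ (D.res (Functor.star.{w} S)).map g) ↔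
      Function.Bijective (fun g : (D.res (Functor.fromPUnit.{w} t)).obj
          ((D.res (Functor.star.{w} S)).obj Z) ⟶ (D.res (Functor.fromPUnit.{w} t)).obj
          ((D.res (Functor.star.{w} S)).obj W) => (D.res (Functor.fromPUnit.{w} t)).map f ≫ g) := by
    intro W
    rw [← bijective_comp_iff_left (rightInduced_res_star (starAdj ht) W _)
      (fun g => f ≫ _), ← bijective_comp_iff_right (hb W)]
    apply iff_of_eq
    congr 1
    ext g
    simp
  constructor
  · intro h
    apply isIso_of_bijective_precomp
    intro W
    -- Each object over the point is, up to isomorphism, the value at `t` of a constant diagram, so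
    -- testing against such values suffices.
    have e : (D.res (Functor.fromPUnit.{w} t)).obj ((D.res (Functor.star.{w} S)).obj W) ≅ W :=
      (starIso (Functor.fromPUnit.{w} t) W).symm ≪≫ eqToIso (by
        change (D.res (𝟭 _)).obj W = _
        rw [res_id]; rfl)
    refine (bijective_comp_iff_left (bijective_postcomp e.inv _) _).1 ?_
    refine Bijective.congr_fun (((key W).1 (h W)).comp (bijective_postcomp e.inv _)) fun g => ?_
    simp
  · intro h W
    exact (key W).2 (bijective_precomp _ _)

lemma isRan_star_iff {t : S} (ht : Limits.IsInitial t) {X : D.val S}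
    {Z : D.val (Discrete PUnit.{w + 1})} (f : (D.res (Functor.star.{w} S)).obj Z ⟶ X) :
    D.IsRan (Functor.star.{w} S) f ↔ IsIso ((D.res (Functor.fromPUnit.{w} t)).map f) := by
  have hb : ∀ W, Function.Bijective (fun g : W ⟶ Z =>
      (D.res (Functor.fromPUnit.{w} t)).map ((D.res (Functor.star.{w} S)).map g)) := by
    intro W
    refine (bijective_comp_iff_left (bijective_precomp (starIso (Functor.fromPUnit.{w} t) W).hom _)
      _).1 ?_
    refine Bijective.congr_fun
      ((bijective_postcomp (starIso (Functor.fromPUnit.{w} t) Z).hom _).comp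
      (bijective_res_map_of_eq_id (D := D) (k := Functor.star.{w} (Discrete PUnit.{w + 1})) rfl
        W Z)) fun g => ?_
    exact starIso_naturality _ g
  have key : ∀ W, Function.Bijective (fun g : W ⟶ Z => (D.res (Functor.star.{w} S)).map g ≫ f) ↔
      Function.Bijective (fun g : (D.res (Functor.fromPUnit.{w} t)).obj
          ((D.res (Functor.star.{w} S)).obj W) ⟶ (D.res (Functor.fromPUnit.{w} t)).obj
          ((D.res (Functor.star.{w} S)).obj Z) => g ≫ (D.res (Functor.fromPUnit.{w} t)).map f) := by
    intro W
    rw [← bijective_comp_iff_left (leftInduced_res_star (starAdj' ht) W _)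
      (fun g => _ ≫ f), ← bijective_comp_iff_right (hb W)]
    apply iff_of_eq
    congr 1
    ext g
    simp
  constructor
  · intro h
    apply isIso_of_bijective_postcomp
    intro W
    have e : (D.res (Functor.fromPUnit.{w} t)).obj ((D.res (Functor.star.{w} S)).obj W) ≅ W :=
      (starIso (Functor.fromPUnit.{w} t) W).symm ≪≫ eqToIso (by
        change (D.res (𝟭 _)).obj W = _
        rw [res_id]; rfl)
    refine (bijective_comp_iff_left (bijective_precomp e.hom _) _).1 ?_
    refine Bijective.congr_fun (((key W).1 (h W)).comp (bijective_precomp e.hom _)) fun g => ?_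
    simp
  · intro h W
    exact (key W).2 (bijective_postcomp _ _)

lemma isIso_map_resTrans (s : S ⥤ A) {k k' : A ⥤ B} (α : k ⟶ k') (X : D.val B)
    [h : IsIso (Functor.whiskerLeft s α)] : IsIso ((D.res s).map ((D.resTrans α).app X)) := by
  have h1 := D.isIso_resTrans (Functor.whiskerLeft s α)
  have h2 : IsIso ((D.resTrans (Functor.whiskerLeft s α)).app X) := inferInstance
  rw [resTrans_whiskerLeft_app] at h2
  exact isIso_of_isIso_conj _ _ h2

lemma isIso_map_resSquare {E : Type w} [Category.{w} E] (s : S ⥤ E) {p : E ⥤ A} {k : A ⥤ C}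
    {q : E ⥤ B} {l : B ⥤ C} (α : p ⋙ k ⟶ q ⋙ l) (X : D.val C)
    [h : IsIso (Functor.whiskerLeft s α)] : IsIso ((D.res s).map ((D.resSquare α).app X)) := by
  have := isIso_map_resTrans s α X
  rw [resSquare_app, Functor.map_comp, Functor.map_comp]
  infer_instance

lemma isIso_map_left {𝒞 𝒟 : Type*} [Category* 𝒞] [Category* 𝒟] (F : 𝒞 ⥤ 𝒟) {X Y Z : 𝒞}
    (f : X ⟶ Y) (g : Y ⟶ Z) (hg : IsIso (F.map g)) (h : IsIso (F.map (f ≫ g))) :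
    IsIso (F.map f) := by
  rw [F.map_comp] at h
  exact IsIso.of_isIso_comp_right _ (F.map g)

lemma isIso_map_right {𝒞 𝒟 : Type*} [Category* 𝒞] [Category* 𝒟] (F : 𝒞 ⥤ 𝒟) {X Y Z : 𝒞}
    (f : X ⟶ Y) (g : Y ⟶ Z) (hf : IsIso (F.map f)) (h : IsIso (F.map (f ≫ g))) :
    IsIso (F.map g) := by
  rw [F.map_comp] at h
  exact IsIso.of_isIso_comp_left (F.map f) _

lemma isIso_whiskerLeft_fromPUnit (t : S) {k k' : S ⥤ B} (α : k ⟶ k') [IsIso (α.app t)] :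
    IsIso (Functor.whiskerLeft (Functor.fromPUnit.{w} t) α) := by
  have : ∀ x, IsIso ((Functor.whiskerLeft (Functor.fromPUnit.{w} t) α).app x) := fun x => by
    simpa
  exact NatIso.isIso_of_isIso_app _

lemma isColim_of_isTerminal {h : S ⥤ B} {b : B} (γ : h ⟶ (Functor.const S).obj b) {t : S}
    (ht : Limits.IsTerminal t) [IsIso (γ.app t)] (Y : D.val B) : IsColim γ Y := by
  refine (isLan_star_iff ht _).2 ?_
  have := isIso_whiskerLeft_fromPUnit t γ
  have := isIso_map_resTrans (Functor.fromPUnit.{w} t) γ Y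
  rw [coconeMap, Functor.map_comp]
  infer_instance

lemma isLim_of_isInitial {h : S ⥤ B} {b : B} (γ : (Functor.const S).obj b ⟶ h) {t : S}
    (ht : Limits.IsInitial t) [IsIso (γ.app t)] (Y : D.val B) : IsLim γ Y := by
  refine (isRan_star_iff ht _).2 ?_
  have := isIso_whiskerLeft_fromPUnit t γ
  have := isIso_map_resTrans (Functor.fromPUnit.{w} t) γ Y
  rw [coneMap, Functor.map_comp]
  infer_instance

variable (k : A ⥤ B) [k.Full] [k.Faithful]

/-- The terminal object of the slice category over an object in the image of `k`. -/
abbrev sliceLeftObj (a : A) : SliceLeft k (k.obj a) where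
  left := a
  right := ⟨⟨⟩⟩
  hom := 𝟙 (k.obj a)

/-- The initial object of the slice category under an object in the image of `k`. -/
abbrev sliceRightObj (a : A) : SliceRight (k.obj a) k where
  left := ⟨⟨⟩⟩
  right := a
  hom := 𝟙 (k.obj a)

/-- `sliceLeftObj` is terminal. -/
noncomputable def isTerminalSliceLeftObj (a : A) : Limits.IsTerminal (sliceLeftObj k a) :=
  Limits.IsTerminal.ofUniqueHom
    (fun X => { left := k.preimage X.hom, right := eqToHom (by rfl), w := by simp [sliceLeftObj] })
    (fun X m => by
      ext
      · apply k.map_injective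
        have := m.w
        simp [sliceLeftObj] at this
        simpa using this
      · exact Subsingleton.elim _ _)

/-- `sliceRightObj` is initial. -/
noncomputable def isInitialSliceRightObj (a : A) : Limits.IsInitial (sliceRightObj k a) :=
  Limits.IsInitial.ofUniqueHom
    (fun X => { right := k.preimage X.hom, left := eqToHom (by rfl), w := by simp [sliceRightObj] })
    (fun X m => by
      ext
      · exact Subsingleton.elim _ _
      · apply k.map_injective
        have := m.w
        simp [sliceRightObj] at this
        simpa using this.symm)

instance isIso_natTrans_sliceLeftObj (a : A) :
    IsIso ((Comma.natTrans k (Functor.fromPUnit.{w} (k.obj a))).app (sliceLeftObj k a)) :=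
  inferInstanceAs (IsIso (𝟙 (k.obj a)))

instance isIso_natTrans_sliceRightObj (a : A) :
    IsIso ((Comma.natTrans (Functor.fromPUnit.{w} (k.obj a)) k).app (sliceRightObj k a)) :=
  inferInstanceAs (IsIso (𝟙 (k.obj a)))

lemma isColim_slice_obj (a : A) (Y : D.val B) :
    IsColim (h := Comma.fst k (Functor.fromPUnit.{w} (k.obj a)) ⋙ k) (b := k.obj a)
      (Comma.natTrans k (Functor.fromPUnit.{w} (k.obj a))) Y := by
  have := isIso_natTrans_sliceLeftObj k a
  exact isColim_of_isTerminal (h := Comma.fst k (Functor.fromPUnit.{w} (k.obj a)) ⋙ k)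
    (b := k.obj a) _ (isTerminalSliceLeftObj k a) Y

lemma isLim_slice_obj (a : A) (Y : D.val B) :
    IsLim (h := Comma.snd (Functor.fromPUnit.{w} (k.obj a)) k ⋙ k) (b := k.obj a)
      (Comma.natTrans (Functor.fromPUnit.{w} (k.obj a)) k) Y := by
  have := isIso_natTrans_sliceRightObj k a
  exact isLim_of_isInitial (h := Comma.snd (Functor.fromPUnit.{w} (k.obj a)) k ⋙ k)
    (b := k.obj a) _ (isInitialSliceRightObj k a) Y

/-- Left Kan extensions along fully faithful functors are extensions. -/
lemma isIso_of_isLan (hD : D.IsDerivator) {X : D.val A} {Y : D.val B} {f : X ⟶ (D.res k).obj Y}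
    (hf : D.IsLan k f) : IsIso f := by
  rw [hD.der2]
  intro a
  -- The slice over `k a` has the terminal object `(a, 𝟙)`. The pointwise criterion there says that
  -- the value at `a` of `f`, followed by an invertible comparison, is invertible.
  have h := (isLan_star_iff (isTerminalSliceLeftObj k a) _).1
    ((isLan_iff_slices hD k f).1 hf (k.obj a))
  have := isIso_natTrans_sliceLeftObj k a
  have := isIso_whiskerLeft_fromPUnit (sliceLeftObj k a)
    (Comma.natTrans k (Functor.fromPUnit.{w} (k.obj a)))
  refine (isIso_map_of_isIso_map ?_ f).2 (isIso_map_left _ _ _ (isIso_map_resSquare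
    (Functor.fromPUnit.{w} (sliceLeftObj k a))
    (Comma.natTrans k (Functor.fromPUnit.{w} (k.obj a))) Y) h)
  rw [← res_comp]
  rfl

/-- Right Kan extensions along fully faithful functors are extensions. -/
lemma isIso_of_isRan (hD : D.IsDerivator) {X : D.val A} {Y : D.val B} {f : (D.res k).obj Y ⟶ X}
    (hf : D.IsRan k f) : IsIso f := by
  rw [hD.der2]
  intro a
  have h := (isRan_star_iff (isInitialSliceRightObj k a) _).1
    ((isRan_iff_slices hD k f).1 hf (k.obj a))
  have := isIso_natTrans_sliceRightObj k a
  have := isIso_whiskerLeft_fromPUnit (sliceRightObj k a)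
    (Comma.natTrans (Functor.fromPUnit.{w} (k.obj a)) k)
  refine (isIso_map_of_isIso_map ?_ f).2 (isIso_map_right _ _ _ (isIso_map_resSquare
    (Functor.fromPUnit.{w} (sliceRightObj k a))
    (Comma.natTrans (Functor.fromPUnit.{w} (k.obj a)) k) Y) h)
  rw [← res_comp]
  rfl

lemma isIso_unit_of_fullyFaithful (hD : D.IsDerivator) {L : D.val A ⥤ D.val B} (adj : L ⊣ D.res k)
    (X : D.val A) : IsIso (adj.unit.app X) :=
  isIso_of_isLan k hD ((isLan_iff_isIso k _ adj).2 (isIso_homEquiv_symm_unit adj X))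

lemma isIso_counit_of_fullyFaithful (hD : D.IsDerivator) {R : D.val A ⥤ D.val B}
    (adj : D.res k ⊣ R) (X : D.val A) : IsIso (adj.counit.app X) :=
  isIso_of_isRan k hD ((isRan_iff_isIso k _ adj).2 (isIso_homEquiv_counit adj X))

/-- Every diagram extends along a fully faithful functor to an induced diagram. -/
lemma exists_leftInduced (hD : D.IsDerivator) (X : D.val A) :
    ∃ Y : D.val B, LeftInduced (D.res k) Y ∧ Nonempty ((D.res k).obj Y ≅ X) := by
  obtain ⟨L, ⟨adj⟩⟩ := hD.der3_left A B k
  have := isIso_unit_of_fullyFaithful k hD adj X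
  exact ⟨_, LeftInduced.of_isIso_unit adj X, ⟨(asIso (adj.unit.app X)).symm⟩⟩

/-- Every diagram extends along a fully faithful functor to a coinduced diagram. -/
lemma exists_rightInduced (hD : D.IsDerivator) (X : D.val A) :
    ∃ Y : D.val B, RightInduced (D.res k) Y ∧ Nonempty ((D.res k).obj Y ≅ X) := by
  obtain ⟨R, ⟨adj⟩⟩ := hD.der3_right A B k
  have := isIso_counit_of_fullyFaithful k hD adj X
  exact ⟨_, RightInduced.of_isIso_counit adj X, ⟨asIso (adj.counit.app X)⟩⟩

end FullyFaithful

end Prederivator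

namespace Prederivator

variable {D : Prederivator.{w, v, u}}

/-! ### Kan extensions with parameters -/

section Parameters

variable {A B M N : Type w} [Category.{w} A] [Category.{w} B] [Category.{w} M] [Category.{w} N]

lemma sliceLeft_hom_ext {k : M ⥤ N} {c : N} {x y : SliceLeft k c} {f g : x ⟶ y}
    (h : f.left = g.left) : f = g :=
  CommaMorphism.ext h (Subsingleton.elim _ _)

lemma sliceRight_hom_ext {k : M ⥤ N} {c : N} {x y : SliceRight c k} {f g : x ⟶ y}
    (h : f.right = g.right) : f = g :=
  CommaMorphism.ext (Subsingleton.elim _ _) h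

/-- Morphisms of the slice category `(k/c)`. -/
def sliceLeftHom {k : M ⥤ N} {c : N} {x y : SliceLeft k c} (g : x.left ⟶ y.left)
    (h : k.map g ≫ y.hom = x.hom) : x ⟶ y where
  left := g
  right := eqToHom (Subsingleton.elim _ _)
  w := h.trans (Category.comp_id _).symm

/-- Morphisms of the slice category `(c/k)`. -/
def sliceRightHom {k : M ⥤ N} {c : N} {x y : SliceRight c k} (g : x.right ⟶ y.right)
    (h : x.hom ≫ k.map g = y.hom) : x ⟶ y where
  left := eqToHom (Subsingleton.elim _ _)
  right := g
  w := (Category.id_comp _).trans h.symm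

lemma sliceLeft_w {k : M ⥤ N} {c : N} {x y : SliceLeft k c} (f : x ⟶ y) :
    k.map f.left ≫ y.hom = x.hom :=
  f.w.trans (Category.comp_id _)

lemma sliceRight_w {k : M ⥤ N} {c : N} {x y : SliceRight c k} (f : x ⟶ y) :
    x.hom ≫ k.map f.right = y.hom :=
  f.w.symm.trans (Category.id_comp _)

/-- The inclusion of a slice of `k` into a slice of `k × A`. -/
def sliceLeftSect (k : M ⥤ N) (c : N) (a : A) :
    SliceLeft k c ⥤ SliceLeft (k.prod (𝟭 A)) (c, a) where
  obj x := { left := (x.left, a), right := ⟨⟨⟩⟩, hom := (x.hom, 𝟙 a) }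
  map f := sliceLeftHom (f.left, 𝟙 a) (Prod.ext (sliceLeft_w f) (Category.id_comp _))
  map_id _ := sliceLeft_hom_ext rfl
  map_comp _ _ := sliceLeft_hom_ext (Prod.ext rfl (Category.id_comp _).symm)

/-- The projection of a slice of `k × A` to a slice of `k`. -/
def sliceLeftProj (k : M ⥤ N) (c : N) (a : A) :
    SliceLeft (k.prod (𝟭 A)) (c, a) ⥤ SliceLeft k c where
  obj x := { left := x.left.1, right := ⟨⟨⟩⟩, hom := x.hom.1 }
  map f := sliceLeftHom f.left.1 (congrArg Prod.fst (sliceLeft_w f))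
  map_id _ := sliceLeft_hom_ext rfl
  map_comp _ _ := sliceLeft_hom_ext rfl

/-- The projection of slices is left adjoint to the inclusion. -/
def sliceLeftAdj (k : M ⥤ N) (c : N) (a : A) : sliceLeftProj k c a ⊣ sliceLeftSect k c a :=
  Adjunction.mkOfHomEquiv
    { homEquiv := fun x _ =>
        { toFun := fun g => sliceLeftHom (g.left, x.hom.2)
            (Prod.ext (sliceLeft_w g) (Category.comp_id _))
          invFun := fun f => sliceLeftHom f.left.1 (congrArg Prod.fst (sliceLeft_w f))
          left_inv := fun _ => sliceLeft_hom_ext rfl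
          right_inv := fun f => sliceLeft_hom_ext (Prod.ext rfl
            ((congrArg Prod.snd (sliceLeft_w f)).symm.trans (Category.comp_id _))) }
      homEquiv_naturality_left_symm := fun _ _ => sliceLeft_hom_ext rfl
      homEquiv_naturality_right := fun _ _ =>
        sliceLeft_hom_ext (Prod.ext rfl (Category.comp_id _).symm) }

/-- The inclusion of a slice of `k` into a slice of `k × A`. -/
def sliceRightSect (k : M ⥤ N) (c : N) (a : A) :
    SliceRight c k ⥤ SliceRight (c, a) (k.prod (𝟭 A)) where
  obj x := { left := ⟨⟨⟩⟩, right := (x.right, a), hom := (x.hom, 𝟙 a) }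
  map f := sliceRightHom (f.right, 𝟙 a) (Prod.ext (sliceRight_w f) (Category.comp_id _))
  map_id _ := sliceRight_hom_ext rfl
  map_comp _ _ := sliceRight_hom_ext (Prod.ext rfl (Category.id_comp _).symm)

/-- The projection of a slice of `k × A` to a slice of `k`. -/
def sliceRightProj (k : M ⥤ N) (c : N) (a : A) :
    SliceRight (c, a) (k.prod (𝟭 A)) ⥤ SliceRight c k where
  obj x := { left := ⟨⟨⟩⟩, right := x.right.1, hom := x.hom.1 }
  map f := sliceRightHom f.right.1 (congrArg Prod.fst (sliceRight_w f))
  map_id _ := sliceRight_hom_ext rfl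
  map_comp _ _ := sliceRight_hom_ext rfl

/-- The projection of slices is right adjoint to the inclusion. -/
def sliceRightAdj (k : M ⥤ N) (c : N) (a : A) : sliceRightSect k c a ⊣ sliceRightProj k c a :=
  Adjunction.mkOfHomEquiv
    { homEquiv := fun _ x =>
        { toFun := fun f => sliceRightHom f.right.1 (congrArg Prod.fst (sliceRight_w f))
          invFun := fun g => sliceRightHom (g.right, x.hom.2)
            (Prod.ext (sliceRight_w g) (Category.id_comp _))
          left_inv := fun f => sliceRight_hom_ext (Prod.ext rfl
            ((congrArg Prod.snd (sliceRight_w f)).symm.trans (Category.id_comp _)))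
          right_inv := fun _ => sliceRight_hom_ext rfl }
      homEquiv_naturality_left_symm := fun _ _ =>
        sliceRight_hom_ext (Prod.ext rfl (Category.id_comp _).symm)
      homEquiv_naturality_right := fun _ _ => sliceRight_hom_ext rfl }

/-- Left Kan extensions with parameters on the right are computed parameterwise. -/
theorem leftInduced_prod_id_iff (hD : D.IsDerivator) (k : M ⥤ N) (Y : D.val (N × A)) :
    LeftInduced (D.res (k.prod (𝟭 A))) Y ↔
      ∀ a, LeftInduced (D.res k) ((D.res (Prod.sectL N a)).obj Y) := by
  rw [leftInduced_iff_isColim hD, Prod.forall, forall_comm]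
  refine forall_congr' fun a => ?_
  rw [leftInduced_iff_isColim hD]
  refine forall_congr' fun c => ?_
  -- The inclusion of the slice of `k` over `c` into the slice of `k × A` over `(c, a)` is a right
  -- adjoint, so the colimit may be computed on the smaller slice, where the parameter is constantly
  -- `a`.
  refine (isColim_whiskerLeft_iff (h := Comma.fst (k.prod (𝟭 A)) (Functor.fromPUnit.{w} (c, a)) ⋙
    k.prod (𝟭 A)) (b := (c, a)) (sliceLeftAdj k c a) _ (Functor.whiskerLeft (sliceLeftSect k c a)
    (Comma.natTrans (k.prod (𝟭 A)) (Functor.fromPUnit.{w} (c, a)))) (fun t => rfl) Y).symm.trans ?_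
  exact (isColim_res_iff (h := Comma.fst k (Functor.fromPUnit.{w} c) ⋙ k) (b := c)
    (l := Prod.sectL N a) _ (Functor.whiskerLeft (sliceLeftSect k c a)
    (Comma.natTrans (k.prod (𝟭 A)) (Functor.fromPUnit.{w} (c, a)))) (fun s => rfl) Y).symm

/-- Right Kan extensions with parameters on the right are computed parameterwise. -/
theorem rightInduced_prod_id_iff (hD : D.IsDerivator) (k : M ⥤ N) (Y : D.val (N × A)) :
    RightInduced (D.res (k.prod (𝟭 A))) Y ↔
      ∀ a, RightInduced (D.res k) ((D.res (Prod.sectL N a)).obj Y) := by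
  rw [rightInduced_iff_isLim hD, Prod.forall, forall_comm]
  refine forall_congr' fun a => ?_
  rw [rightInduced_iff_isLim hD]
  refine forall_congr' fun c => ?_
  refine (isLim_whiskerLeft_iff (h := Comma.snd (Functor.fromPUnit.{w} (c, a)) (k.prod (𝟭 A)) ⋙
    k.prod (𝟭 A)) (b := (c, a)) (sliceRightAdj k c a) _ (Functor.whiskerLeft (sliceRightSect k c a)
    (Comma.natTrans (Functor.fromPUnit.{w} (c, a)) (k.prod (𝟭 A)))) (fun t => rfl) Y).symm.trans ?_
  exact (isLim_res_iff (h := Comma.snd (Functor.fromPUnit.{w} c) k ⋙ k) (b := c)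
    (l := Prod.sectL N a) _ (Functor.whiskerLeft (sliceRightSect k c a)
    (Comma.natTrans (Functor.fromPUnit.{w} (c, a)) (k.prod (𝟭 A)))) (fun s => rfl) Y).symm

lemma bijective_map_of_comp {𝒞 𝒟 : Type*} [Category* 𝒞] [Category* 𝒟] {F : 𝒞 ⥤ 𝒟} {G : 𝒟 ⥤ 𝒞}
    (h : F ⋙ G = 𝟭 _) (h' : G ⋙ F = 𝟭 _) (X Y : 𝒞) :
    Function.Bijective (fun g : X ⟶ Y => F.map g) := by
  have h1 : Function.Bijective ((fun g : F.obj X ⟶ F.obj Y => G.map g) ∘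
      fun g : X ⟶ Y => F.map g) := bijective_map_of_eq_id h X Y
  have h2 : Function.Bijective ((fun g : G.obj (F.obj X) ⟶ G.obj (F.obj Y) => F.map g) ∘
      fun g : F.obj X ⟶ F.obj Y => G.map g) := bijective_map_of_eq_id h' _ _
  have h3 : Function.Bijective (fun g : F.obj X ⟶ F.obj Y => G.map g) :=
    ⟨h2.1.of_comp, h1.2.of_comp⟩
  exact (bijective_comp_iff_left h3 _).1 h1

lemma bijective_res_map {s : A ⥤ B} {r : B ⥤ A} (h : s ⋙ r = 𝟭 A) (h' : r ⋙ s = 𝟭 B)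
    (X Y : D.val B) : Function.Bijective (fun g : X ⟶ Y => (D.res s).map g) := by
  refine bijective_map_of_comp (F := D.res s) (G := D.res r) ?_ ?_ X Y
  · rw [← res_comp, h', res_id]
  · rw [← res_comp, h, res_id]

/-- Conjugating by the strictly invertible swaps exchanges the two positions of the parameter. -/
lemma leftInduced_of_swap (k : M ⥤ N) (Y : D.val (A × N))
    (h : LeftInduced (D.res (k.prod (𝟭 A))) ((D.res (CategoryTheory.Prod.swap N A)).obj Y)) :
    LeftInduced (D.res ((𝟭 A).prod k)) Y := by
  have e : D.res ((𝟭 A).prod k) = D.res (CategoryTheory.Prod.swap N A) ⋙ D.res (k.prod (𝟭 A)) ⋙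
      D.res (CategoryTheory.Prod.swap A M) := by
    rw [← res_comp, ← res_comp]
    rfl
  rw [e]
  exact LeftInduced.comp
    (fun Z => bijective_res_map (r := CategoryTheory.Prod.swap A N) rfl rfl _ _)
    (h.comp (fun Z => bijective_res_map (r := CategoryTheory.Prod.swap M A) rfl rfl _ _))

lemma leftInduced_of_swap' (k : M ⥤ N) (Y : D.val (N × A))
    (h : LeftInduced (D.res ((𝟭 A).prod k)) ((D.res (CategoryTheory.Prod.swap A N)).obj Y)) :
    LeftInduced (D.res (k.prod (𝟭 A))) Y := by
  have e : D.res (k.prod (𝟭 A)) = D.res (CategoryTheory.Prod.swap A N) ⋙ D.res ((𝟭 A).prod k) ⋙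
      D.res (CategoryTheory.Prod.swap M A) := by
    rw [← res_comp, ← res_comp]
    rfl
  rw [e]
  exact LeftInduced.comp
    (fun Z => bijective_res_map (r := CategoryTheory.Prod.swap N A) rfl rfl _ _)
    (h.comp (fun Z => bijective_res_map (r := CategoryTheory.Prod.swap A M) rfl rfl _ _))

/-- Left Kan extensions with parameters on the left are computed parameterwise. -/
theorem leftInduced_id_prod_iff (hD : D.IsDerivator) (k : M ⥤ N) (Y : D.val (A × N)) :
    LeftInduced (D.res ((𝟭 A).prod k)) Y ↔
      ∀ a, LeftInduced (D.res k) ((D.res (Prod.sectR a N)).obj Y) := by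
  have h1 : LeftInduced (D.res ((𝟭 A).prod k)) Y ↔
      LeftInduced (D.res (k.prod (𝟭 A))) ((D.res (CategoryTheory.Prod.swap N A)).obj Y) := by
    refine ⟨fun h => leftInduced_of_swap' k _ (LeftInduced.of_iso ?_ h), leftInduced_of_swap k Y⟩
    exact eqToIso (congrArg (fun F : D.val _ ⥤ D.val _ => F.obj Y) (D.res_id _)).symm ≪≫
      D.resComp (CategoryTheory.Prod.swap A N) (CategoryTheory.Prod.swap N A) Y
  rw [h1, leftInduced_prod_id_iff hD]
  refine forall_congr' fun a => ?_
  exact ⟨LeftInduced.of_iso (D.resComp (Prod.sectL N a) (CategoryTheory.Prod.swap N A) Y).symm,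
    LeftInduced.of_iso (D.resComp (Prod.sectL N a) (CategoryTheory.Prod.swap N A) Y)⟩

end Parameters

/-! ### Zero objects -/

section Zero

variable {A B S : Type w} [Category.{w} A] [Category.{w} B] [Category.{w} S]

/-- The functor out of an empty category. -/
def emptyFunctor (A B : Type w) [Category.{w} A] [Category.{w} B] [IsEmpty A] : A ⥤ B where
  obj x := isEmptyElim x
  map {x} := isEmptyElim x
  map_id x := isEmptyElim x
  map_comp {x} := isEmptyElim x

/-- The empty category has only trivial diagrams. -/
lemma bijective_of_isEmpty (hD : D.IsDerivator) [IsEmpty S] (X Y : D.val S) :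
    Nonempty (Unique (X ⟶ Y)) := by
  -- (Der1) for the empty family compares diagrams on an empty coproduct with the empty product of
  -- categories, whose hom-sets are singletons; `S` is isomorphic to that coproduct.
  have h0 := hD.der1 PEmpty (fun _ => Discrete PUnit.{w + 1})
  let T := Σ _ : PEmpty.{w + 1}, Discrete PUnit.{w + 1}
  have : IsEmpty T := inferInstanceAs (IsEmpty (Σ _ : PEmpty.{w + 1}, Discrete PUnit.{w + 1}))
  let r := emptyFunctor T S
  let s := emptyFunctor S T
  have hb := bijective_res_map (D := D) (s := r) (r := s)
    (CategoryTheory.Functor.ext (fun x : T => isEmptyElim x) (fun x : T => isEmptyElim x))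
    (CategoryTheory.Functor.ext (fun x : S => isEmptyElim x) (fun x : S => isEmptyElim x)) X Y
  let Φ := Functor.pi' fun i : PEmpty.{w + 1} =>
    D.res (Sigma.incl (C := fun _ : PEmpty.{w + 1} => Discrete PUnit.{w + 1}) i)
  have hΦ : Φ.FullyFaithful := Functor.FullyFaithful.ofFullyFaithful Φ
  let e : (X ⟶ Y) ≃ PUnit.{1} :=
    (Equiv.ofBijective _ hb).trans (hΦ.homEquiv.trans
      { toFun := fun _ => ⟨⟩
        invFun := fun _ i => i.elim
        left_inv := fun _ => funext fun i => i.elim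
        right_inv := fun _ => rfl })
  exact ⟨e.unique⟩

/-- The value of a diagram at an object. -/
abbrev valueAt (Y : D.val B) (b : B) : D.val (Discrete PUnit.{w + 1}) :=
  (D.res (Functor.fromPUnit.{w} b)).obj Y

lemma bijective_iff_of_unique {α β : Type*} (h : Nonempty (Unique β)) (f : α → β) :
    Function.Bijective f ↔ Nonempty (Unique α) := by
  obtain ⟨h⟩ := h
  constructor
  · intro hf
    exact ⟨(Equiv.ofBijective f hf).unique⟩
  · rintro ⟨h'⟩
    exact ⟨fun _ _ _ => Subsingleton.elim _ _, fun b => ⟨default, Subsingleton.elim _ _⟩⟩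

lemma isColim_iff_of_isEmpty (hD : D.IsDerivator) [IsEmpty S] {h : S ⥤ B} {b : B}
    (γ : h ⟶ (Functor.const S).obj b) (Y : D.val B) :
    IsColim γ Y ↔ ∀ Z, Nonempty (Unique (valueAt Y b ⟶ Z)) :=
  forall_congr' fun _ => bijective_iff_of_unique (bijective_of_isEmpty hD _ _) _

lemma isLim_iff_of_isEmpty (hD : D.IsDerivator) [IsEmpty S] {h : S ⥤ B} {b : B}
    (γ : (Functor.const S).obj b ⟶ h) (Y : D.val B) :
    IsLim γ Y ↔ ∀ Z, Nonempty (Unique (Z ⟶ valueAt Y b)) :=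
  forall_congr' fun _ => bijective_iff_of_unique (bijective_of_isEmpty hD _ _) _

lemma isEmpty_sliceLeft [IsEmpty S] (k : S ⥤ B) (b : B) : IsEmpty (SliceLeft k b) :=
  ⟨fun x => isEmptyElim x.left⟩

lemma isEmpty_sliceRight [IsEmpty S] (k : S ⥤ B) (b : B) : IsEmpty (SliceRight b k) :=
  ⟨fun x => isEmptyElim x.right⟩

/-- Initial objects are the diagrams induced from the empty category. All slices are then empty too,
so the pointwise formula asks for initial values. -/
lemma isInitial_iff_valueAt (hD : D.IsDerivator) (Y : D.val B) :
    (∀ Z, Nonempty (Unique (Y ⟶ Z))) ↔ ∀ b, ∀ Z, Nonempty (Unique (valueAt Y b ⟶ Z)) := by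
  let k := emptyFunctor (Discrete PEmpty.{w + 1}) B
  have h := leftInduced_iff_isColim hD k Y
  have h' : LeftInduced (D.res k) Y ↔ ∀ Z, Nonempty (Unique (Y ⟶ Z)) :=
    forall_congr' fun _ => bijective_iff_of_unique (bijective_of_isEmpty hD _ _) _
  rw [← h', h]
  refine forall_congr' fun b => ?_
  have := isEmpty_sliceLeft k b
  exact isColim_iff_of_isEmpty hD _ _

lemma isTerminal_iff_valueAt (hD : D.IsDerivator) (Y : D.val B) :
    (∀ Z, Nonempty (Unique (Z ⟶ Y))) ↔ ∀ b, ∀ Z, Nonempty (Unique (Z ⟶ valueAt Y b)) := by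
  let k := emptyFunctor (Discrete PEmpty.{w + 1}) B
  have h := rightInduced_iff_isLim hD k Y
  have h' : RightInduced (D.res k) Y ↔ ∀ Z, Nonempty (Unique (Z ⟶ Y)) :=
    forall_congr' fun _ => bijective_iff_of_unique (bijective_of_isEmpty hD _ _) _
  rw [← h', h]
  refine forall_congr' fun b => ?_
  have := isEmpty_sliceRight k b
  exact isLim_iff_of_isEmpty hD _ _

lemma isZero_iff_unique_to {𝒞 : Type*} [Category* 𝒞] (h0 : Limits.HasZeroObject 𝒞) (X : 𝒞) :
    Limits.IsZero X ↔ ∀ Z, Nonempty (Unique (X ⟶ Z)) := by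
  refine ⟨fun h => h.unique_to, fun h => ?_⟩
  obtain ⟨O, hO⟩ := h0
  have : Nonempty (X ≅ O) := by
    have := fun Z => (h Z).some
    exact ⟨(Limits.IsInitial.ofUnique X).uniqueUpToIso hO.isInitial⟩
  exact hO.of_iso this.some

lemma isZero_iff_unique_from {𝒞 : Type*} [Category* 𝒞] (h0 : Limits.HasZeroObject 𝒞) (X : 𝒞) :
    Limits.IsZero X ↔ ∀ Z, Nonempty (Unique (Z ⟶ X)) := by
  refine ⟨fun h => h.unique_from, fun h => ?_⟩
  obtain ⟨O, hO⟩ := h0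
  have : Nonempty (X ≅ O) := by
    have := fun Z => (h Z).some
    exact ⟨(Limits.IsTerminal.ofUnique X).uniqueUpToIso hO.isTerminal⟩
  exact hO.of_iso this.some

/-- Zero objects are detected pointwise. -/
theorem isZero_iff_valueAt (hD : D.IsStableDerivator) (Y : D.val B) :
    Limits.IsZero Y ↔ ∀ b, Limits.IsZero (valueAt Y b) := by
  constructor
  · intro h b
    exact (isZero_iff_unique_to hD.pointed _).2 
      ((isInitial_iff_valueAt hD.toIsDerivator Y).1 h.unique_to b)
  · intro h
    exact ⟨(isInitial_iff_valueAt hD.toIsDerivator Y).2 fun b => (h b).unique_to,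
      (isTerminal_iff_valueAt hD.toIsDerivator Y).2 fun b => (h b).unique_from⟩

/-- An object all of whose morphisms into other objects are unique is zero. -/
theorem isZero_of_unique_to (hD : D.IsStableDerivator) (Y : D.val B)
    (h : ∀ Z, Nonempty (Unique (Y ⟶ Z))) : Limits.IsZero Y :=
  (isZero_iff_valueAt hD Y).2 fun b => (isZero_iff_unique_to hD.pointed _).2
    ((isInitial_iff_valueAt hD.toIsDerivator Y).1 h b)

/-- An induced diagram vanishes if its restriction does. -/
theorem isZero_of_leftInduced (hD : D.IsStableDerivator) {k : A ⥤ B} {Y : D.val B}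
    (h : LeftInduced (D.res k) Y) (h0 : Limits.IsZero ((D.res k).obj Y)) : Limits.IsZero Y :=
  isZero_of_unique_to hD Y fun Z => (bijective_iff_of_unique (h0.unique_to _) _).1 (h Z)

/-- Restrictions of zero objects are zero objects. -/
theorem isZero_res (hD : D.IsStableDerivator) (k : A ⥤ B) {Y : D.val B} (h : Limits.IsZero Y) :
    Limits.IsZero ((D.res k).obj Y) :=
  (isZero_iff_valueAt hD _).2 fun a =>
    ((isZero_iff_valueAt hD Y).1 h (k.obj a)).of_iso (resPt k a Y)

/-- Extension by zero along a sieve. -/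
theorem rightInduced_iff_isZero (hD : D.IsStableDerivator) (k : A ⥤ B) [k.Full] [k.Faithful]
    (hk : ∀ b, (∃ a, k.obj a = b) ∨ IsEmpty (SliceRight b k)) (Y : D.val B) :
    RightInduced (D.res k) Y ↔ ∀ b, (¬ ∃ a, k.obj a = b) → Limits.IsZero (valueAt Y b) := by
  rw [rightInduced_iff_isLim hD.toIsDerivator]
  refine forall_congr' fun b => ?_
  by_cases hb : ∃ a, k.obj a = b
  · simp only [hb, not_true_eq_false, false_imp_iff, iff_true]
    obtain ⟨a, rfl⟩ := hb
    exact isLim_slice_obj k a Y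
  · simp only [hb, not_false_eq_true, true_imp_iff]
    -- Off the image the slice is empty and a limit over it is a terminal object; in the pointed
    -- case this means zero.
    have := (hk b).resolve_left hb
    rw [isLim_iff_of_isEmpty hD.toIsDerivator, isZero_iff_unique_from hD.pointed]

end Zero

end Prederivator

namespace Prederivator

variable {D : Prederivator.{w, v, u}}

/-! ### Diagrams on posets -/

section Poset

variable {A B S : Type w} [PartialOrder A] [PartialOrder B] [PartialOrder S]

lemma full_of_reflects {k : A ⥤ B} (hk : ∀ a a', k.obj a ≤ k.obj a' → a ≤ a') : k.Full where
  map_surjective f := ⟨homOfLE (hk _ _ f.le), Subsingleton.elim _ _⟩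

lemma faithful_of_poset (k : A ⥤ B) : k.Faithful where
  map_injective _ := Subsingleton.elim _ _

lemma functor_ext_of_poset {C : Type*} [Category* C] {k k' : C ⥤ B}
    (h : ∀ a, k.obj a = k'.obj a) : k = k' :=
  CategoryTheory.Functor.ext h fun _ _ _ => Subsingleton.elim _ _

lemma isColim_congr {C : Type w} [Category.{w} C] {h h' : C ⥤ B} (hh : h = h') {b : B}
    (γ : h ⟶ (Functor.const C).obj b) (γ' : h' ⟶ (Functor.const C).obj b) (Y : D.val B) :
    IsColim γ Y ↔ IsColim γ' Y := by
  subst hh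
  obtain rfl : γ = γ' := by
    ext s
    exact Subsingleton.elim (α := (h.obj s ⟶ b)) _ _
  rfl

/-- A cocone on a diagram `S ⥤ A` gives a diagram in the slice category. -/
def toSlice {k : A ⥤ B} {b : B} {h : S ⥤ A} (γ : h ⋙ k ⟶ (Functor.const S).obj b) :
    S ⥤ SliceLeft k b where
  obj s := { left := h.obj s, right := ⟨⟨⟩⟩, hom := γ.app s }
  map f := sliceLeftHom (h.map f) (Subsingleton.elim (α := (k.obj (h.obj _) ⟶ b)) _ _)
  map_id _ := sliceLeft_hom_ext (Subsingleton.elim _ _)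
  map_comp _ _ := sliceLeft_hom_ext (Subsingleton.elim _ _)

/-- Colimits over slices of posets may be computed over reflective subposets. -/
theorem isColim_slice_iff {k : A ⥤ B} {b : B} {h : S ⥤ A}
    (γ : h ⋙ k ⟶ (Functor.const S).obj b)
    (hr : ∀ a, k.obj a ≤ b → ∃ t, ∀ s, t ≤ s ↔ a ≤ h.obj s) (Y : D.val B) :
    IsColim (h := Comma.fst k (Functor.fromPUnit.{w} b) ⋙ k) (b := b)
      (Comma.natTrans k (Functor.fromPUnit.{w} b)) Y ↔ IsColim γ Y := by
  -- `r a` is the least index whose image lies above `a`: a left adjoint to the functor from `S` to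
  -- the slice.
  choose r hr using hr
  have hle : ∀ x : SliceLeft k b, k.obj x.left ≤ b := fun x => leOfHom (X := B) x.hom
  let e : ∀ (x : SliceLeft k b) (s : S), (r x.left (hle x) ⟶ s) ≃ (x ⟶ (toSlice γ).obj s) :=
    fun x s =>
      { toFun := fun g => sliceLeftHom (homOfLE ((hr x.left (hle x) s).1 g.le))
          (Subsingleton.elim (α := (k.obj x.left ⟶ b)) _ _)
        invFun := fun g => homOfLE ((hr x.left (hle x) s).2 g.left.le)
        left_inv := fun _ => Subsingleton.elim _ _
        right_inv := fun _ => sliceLeft_hom_ext (Subsingleton.elim _ _) }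
  have adj := Adjunction.adjunctionOfEquivLeft e
    (fun _ _ _ _ _ => sliceLeft_hom_ext (Subsingleton.elim _ _))
  exact (isColim_whiskerLeft_iff (h := Comma.fst k (Functor.fromPUnit.{w} b) ⋙ k) (b := b) adj
    (Comma.natTrans k (Functor.fromPUnit.{w} b)) γ (fun _ => rfl) Y).symm

/-- Diagrams induced along a subposet are those having colimiting values at the other elements. -/
theorem leftInduced_iff_of_reflects (hD : D.IsDerivator) {k : A ⥤ B}
    (hk : ∀ a a', k.obj a ≤ k.obj a' → a ≤ a') (Y : D.val B) :
    LeftInduced (D.res k) Y ↔ ∀ b, (¬ ∃ a, k.obj a = b) →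
      IsColim (h := Comma.fst k (Functor.fromPUnit.{w} b) ⋙ k) (b := b)
        (Comma.natTrans k (Functor.fromPUnit.{w} b)) Y := by
  have := full_of_reflects hk
  have := faithful_of_poset k
  rw [leftInduced_iff_isColim hD]
  refine forall_congr' fun b => ?_
  by_cases hb : ∃ a, k.obj a = b
  · simp only [hb, not_true_eq_false, false_imp_iff, iff_true]
    obtain ⟨a, rfl⟩ := hb
    exact isColim_slice_obj k a Y
  · simp only [hb, not_false_eq_true, true_imp_iff]

end Poset

/-! ### Cocartesian squares -/

lemma square_le_iff (p q : Square.{w}) : p ≤ q ↔ (p.x : ℕ) ≤ q.x ∧ (p.y : ℕ) ≤ q.y := Iff.rfl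

lemma square_le_one (p : Square.{w}) : p ≤ ⟨1, 1⟩ :=
  ⟨Fin.le_last _, Fin.le_last _⟩

section Cocart

variable {B C : Type w} [Category.{w} B] [Category.{w} C]

/-- The cocone on a span given by a square. -/
def squareCocone (e : Square.{w} ⥤ B) :
    spanIncl ⋙ e ⟶ (Functor.const SpanShape.{w}).obj (e.obj ⟨1, 1⟩) where
  app s := e.map (homOfLE (square_le_one s.1))
  naturality s t f := by
    change e.map _ ≫ e.map _ = _ ≫ 𝟙 _
    rw [← e.map_comp, Category.comp_id]
    rfl

/-- A diagram makes the square `e` cocartesian. -/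
def CocartAt (e : Square.{w} ⥤ B) (Y : D.val B) : Prop :=
  IsColim (squareCocone e) Y

lemma cocartAt_res_iff (l : B ⥤ C) (e : Square.{w} ⥤ B) (Y : D.val C) :
    CocartAt e ((D.res l).obj Y) ↔ CocartAt (e ⋙ l) Y :=
  isColim_res_iff (squareCocone e) (squareCocone (e ⋙ l)) (fun _ => rfl) Y

end Cocart

section CocartPoset

variable {A B : Type w} [PartialOrder A] [PartialOrder B]

/-- A colimit over a slice is a pushout if the corner of the square is a reflective subposet. -/
theorem isColim_slice_iff_cocartAt {k : A ⥤ B} (hk : ∀ a a', k.obj a ≤ k.obj a' → a ≤ a')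
    (e : Square.{w} ⥤ B) (he : ∀ s : Square.{w}, s ≠ ⟨1, 1⟩ → ∃ a, k.obj a = e.obj s)
    (h₁ : ∀ a, k.obj a ≤ e.obj ⟨1, 1⟩ → k.obj a ≤ e.obj ⟨1, 0⟩ ∨ k.obj a ≤ e.obj ⟨0, 1⟩)
    (h₂ : ∀ a, k.obj a ≤ e.obj ⟨1, 0⟩ → k.obj a ≤ e.obj ⟨0, 1⟩ → k.obj a ≤ e.obj ⟨0, 0⟩)
    (Y : D.val B) :
    IsColim (h := Comma.fst k (Functor.fromPUnit.{w} (e.obj ⟨1, 1⟩)) ⋙ k) (b := e.obj ⟨1, 1⟩)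
      (Comma.natTrans k (Functor.fromPUnit.{w} (e.obj ⟨1, 1⟩))) Y ↔ CocartAt e Y := by
  -- The corner of the square is lifted to `A`; it will serve as the reflective subposet of the
  -- slice.
  choose g hg using fun s : SpanShape.{w} => he s.1 s.2
  let h : SpanShape.{w} ⥤ A := Monotone.functor (f := g) fun s t hst => by
    apply hk
    rw [hg, hg]
    exact (e.map (homOfLE hst)).le
  have hh : h ⋙ k = spanIncl ⋙ e := functor_ext_of_poset hg
  rw [isColim_slice_iff (h := h) (eqToHom hh ≫ squareCocone e)]
  · exact isColim_congr hh _ _ Y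
  · intro a ha
    have key : ∀ s, a ≤ h.obj s ↔ k.obj a ≤ e.obj s.1 := fun s => by
      rw [← hg s]
      exact ⟨fun h => (k.map (homOfLE h)).le, fun h => hk _ _ h⟩
    have hm : ∀ {s t : Square.{w}}, s ≤ t → k.obj a ≤ e.obj s → k.obj a ≤ e.obj t :=
      fun hst h => h.trans (e.map (homOfLE hst)).le
    have hc : ∀ s : SpanShape.{w}, s.1 = ⟨0, 0⟩ ∨ s.1 = ⟨1, 0⟩ ∨ s.1 = ⟨0, 1⟩ := by
      rintro ⟨⟨x, y⟩, hs⟩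
      fin_cases x <;> fin_cases y <;> simp at hs ⊢
    simp only [key]
    -- The least vertex of the corner above `a` is `(0,0)` if both arms lie above `a`, by `h₂`, and
    -- otherwise the single arm that does, which exists by `h₁`.
    by_cases h10 : k.obj a ≤ e.obj ⟨1, 0⟩
    · by_cases h01 : k.obj a ≤ e.obj ⟨0, 1⟩
      · refine ⟨⟨⟨0, 0⟩, by simp⟩, fun s => ⟨fun hs => hm hs (h₂ a h10 h01), fun _ => ?_⟩⟩
        exact ⟨Fin.zero_le _, Fin.zero_le _⟩
      · refine ⟨⟨⟨1, 0⟩, by simp⟩, fun s => ⟨fun hs => hm hs h10, fun hs => ?_⟩⟩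
        rcases hc s with h | h | h
        · rw [h] at hs
          exact absurd (hm ⟨Fin.zero_le _, Fin.zero_le _⟩ hs) h01
        · exact h.ge
        · rw [h] at hs
          exact absurd hs h01
    · have h01 := (h₁ a ha).resolve_left h10
      refine ⟨⟨⟨0, 1⟩, by simp⟩, fun s => ⟨fun hs => hm hs h01, fun hs => ?_⟩⟩
      rcases hc s with h | h | h
      · rw [h] at hs
        exact absurd (hm ⟨Fin.zero_le _, Fin.zero_le _⟩ hs) h10
      · rw [h] at hs
        exact absurd hs h10
      · exact h.ge

lemma spanIncl_reflects (a a' : SpanShape.{w}) (h : spanIncl.obj a ≤ spanIncl.obj a') : a ≤ a' := h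

/-- The functor `e` is the identity or the transposition. Treating both at once yields the symmetry
of pushouts in `cocartAt_swap_iff`. -/
lemma leftInduced_spanIncl_iff (hD : D.IsDerivator) (e : Square.{w} ⥤ Square.{w})
    (h11 : e.obj ⟨1, 1⟩ = ⟨1, 1⟩)
    (h : (e.obj ⟨1, 0⟩ = ⟨1, 0⟩ ∧ e.obj ⟨0, 1⟩ = ⟨0, 1⟩) ∨
      (e.obj ⟨1, 0⟩ = ⟨0, 1⟩ ∧ e.obj ⟨0, 1⟩ = ⟨1, 0⟩)) (h00 : e.obj ⟨0, 0⟩ = ⟨0, 0⟩)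
    (Y : D.val Square.{w}) : LeftInduced (D.res spanIncl) Y ↔ CocartAt e Y := by
  have hc : ∀ s : Square.{w}, s ≠ ⟨1, 1⟩ → s = ⟨0, 0⟩ ∨ s = ⟨1, 0⟩ ∨ s = ⟨0, 1⟩ := by
    rintro ⟨x, y⟩ hs
    fin_cases x <;> fin_cases y <;> simp at hs ⊢
  rw [leftInduced_iff_of_reflects hD spanIncl_reflects]
  have h1 : ∀ b : Square.{w}, (¬ ∃ a, spanIncl.obj a = b) ↔ b = e.obj ⟨1, 1⟩ := by
    intro b
    rw [h11]
    constructor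
    · intro hb
      by_contra hne
      exact hb ⟨⟨b, hne⟩, rfl⟩
    · rintro rfl ⟨a, ha⟩
      exact a.2 ha
  simp only [h1, forall_eq]
  refine isColim_slice_iff_cocartAt spanIncl_reflects e ?_ ?_ ?_ Y
  · intro s hs
    have : e.obj s ≠ ⟨1, 1⟩ := by
      rcases hc s hs with rfl | rfl | rfl <;> rcases h with ⟨h, h'⟩ | ⟨h, h'⟩ <;>
        simp [h, h', h00]
    exact ⟨⟨e.obj s, this⟩, rfl⟩
  · rintro ⟨a, ha⟩ -
    change a ≤ _ ∨ a ≤ _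
    rcases hc a ha with rfl | rfl | rfl <;> rcases h with ⟨h, h'⟩ | ⟨h, h'⟩ <;>
      simp [h, h', square_le_iff]
  · rintro ⟨a, ha⟩
    change a ≤ _ → a ≤ _ → a ≤ _
    rcases hc a ha with rfl | rfl | rfl <;> rcases h with ⟨h, h'⟩ | ⟨h, h'⟩ <;>
      simp [h, h', h00, square_le_iff]

/-- The symmetry of the square. -/
def squareSwap : Square.{w} ⥤ Square.{w} :=
  Monotone.functor (f := fun p => ⟨p.y, p.x⟩) fun _ _ h => ⟨h.2, h.1⟩

lemma leftInduced_spanIncl_iff_cocartAt (hD : D.IsDerivator) (Y : D.val Square.{w}) :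
    LeftInduced (D.res spanIncl) Y ↔ CocartAt (𝟭 _) Y :=
  leftInduced_spanIncl_iff hD (𝟭 _) rfl (Or.inl ⟨rfl, rfl⟩) rfl Y

lemma cocartAt_iff_leftInduced (hD : D.IsDerivator) {B : Type w} [Category.{w} B]
    (e : Square.{w} ⥤ B) (Y : D.val B) :
    CocartAt e Y ↔ LeftInduced (D.res spanIncl) ((D.res e).obj Y) := by
  rw [leftInduced_spanIncl_iff_cocartAt hD, cocartAt_res_iff]
  rfl

lemma cocartAt_swap_iff (hD : D.IsDerivator) {B : Type w} [Category.{w} B]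
    (e : Square.{w} ⥤ B) (Y : D.val B) : CocartAt (squareSwap ⋙ e) Y ↔ CocartAt e Y := by
  rw [cocartAt_iff_leftInduced hD e, ← cocartAt_res_iff,
    leftInduced_spanIncl_iff hD squareSwap rfl (Or.inr ⟨rfl, rfl⟩) rfl]

/-- Squares of zero objects are cocartesian. -/
lemma cocartAt_of_isZero (hD : D.IsStableDerivator) {B : Type w} [Category.{w} B]
    (e : Square.{w} ⥤ B) (Y : D.val B) (h : ∀ s, Limits.IsZero (valueAt Y (e.obj s))) :
    CocartAt e Y := by
  rw [cocartAt_iff_leftInduced hD.toIsDerivator]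
  have h0 : Limits.IsZero ((D.res e).obj Y) :=
    (isZero_iff_valueAt hD _).2 fun s => (h s).of_iso (resPt e s Y)
  exact fun Z => (bijective_iff_of_unique ((isZero_res hD spanIncl h0).unique_to _) _).2
    (h0.unique_to Z)

end CocartPoset

/-! ### Pasting -/

/-- The poset `[2] × [1]`. -/
@[ext]
structure Grid : Type w where
  /-- The horizontal coordinate. -/
  x : ℕ
  /-- The vertical coordinate. -/
  y : ℕ
  hx : x ≤ 2
  hy : y ≤ 1

instance : PartialOrder Grid.{w} :=
  PartialOrder.lift (fun p => (p.x, p.y)) (by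
    rintro ⟨x, y⟩ ⟨x', y'⟩ h
    simpa using h)

namespace Grid

lemma le_iff (p q : Grid.{w}) : p ≤ q ↔ p.x ≤ q.x ∧ p.y ≤ q.y := Iff.rfl

/-- The left square. -/
def left : Square.{w} ⥤ Grid.{w} :=
  Monotone.functor (f := fun p => ⟨p.x, p.y, by omega, by omega⟩) fun _ _ h => h

/-- The right square. -/
def right : Square.{w} ⥤ Grid.{w} :=
  Monotone.functor (f := fun p => ⟨1 + p.x, p.y, by omega, by omega⟩) fun p q h => by
    rw [square_le_iff] at h
    rw [le_iff]
    dsimp only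
    omega

/-- The outer square. -/
def outer : Square.{w} ⥤ Grid.{w} :=
  Monotone.functor (f := fun p => ⟨2 * p.x, p.y, by omega, by omega⟩) fun p q h => by
    rw [square_le_iff] at h
    rw [le_iff]
    dsimp only
    omega

/-- The upper row and the left column. -/
abbrev J₀ : Type w := {p : Grid.{w} // p.y = 0 ∨ p.x = 0}

/-- The upper row and the left square. -/
abbrev J₁ : Type w := {p : Grid.{w} // p.y = 0 ∨ p.x ≤ 1}

/-- The inclusion of `J₀` into `J₁`. -/
def incl₀ : J₀.{w} ⥤ J₁.{w} :=
  Monotone.functor (f := fun p => ⟨p.1, p.2.imp_right fun h => by omega⟩) fun _ _ h => h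

/-- The inclusion of `J₁`. -/
def incl₁ : J₁.{w} ⥤ Grid.{w} := (Subtype.mono_coe _).functor

/-- The left square in `J₁`. -/
def left₁ : Square.{w} ⥤ J₁.{w} :=
  Monotone.functor (f := fun p => ⟨⟨p.x, p.y, by omega, by omega⟩, Or.inr (by dsimp only; omega)⟩)
    fun _ _ h => h

end Grid

open Grid in
/-- The pasting lemma for cocartesian squares. -/
theorem cocartAt_grid (hD : D.IsDerivator) (Y : D.val Grid.{w}) (hl : CocartAt left Y) :
    CocartAt right Y ↔ CocartAt outer Y := by
  -- `J₁` adds to `J₀` only the vertex `(1,1)`, whose value is the pushout given by the left square.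
  -- Passing from `J₁` to the grid then adds only `(2,1)`, which is governed by the right square.
  have h01 : LeftInduced (D.res incl₀) ((D.res incl₁).obj Y) := by
    rw [leftInduced_iff_of_reflects hD (fun _ _ h => h)]
    intro b hb
    have : b = left₁.obj ⟨1, 1⟩ := by
      have h1 := b.1.hx
      have h2 := b.1.hy
      have h3 : ¬ (b.1.y = 0 ∨ b.1.x = 0) := fun h => hb ⟨⟨b.1, h⟩, rfl⟩
      have h4 := b.2
      apply Subtype.ext
      apply Grid.ext
      · change b.1.x = 1
        omega
      · change b.1.y = 1
        omega
    subst this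
    refine (isColim_slice_iff_cocartAt (fun _ _ h => h) left₁ ?_ ?_ ?_ _).2 ?_
    · rintro ⟨x, y⟩ hs
      refine ⟨⟨left.obj ⟨x, y⟩, ?_⟩, rfl⟩
      fin_cases x <;> fin_cases y <;> simp [left, Monotone.functor] at hs ⊢
    · rintro ⟨⟨x, y, hx, hy⟩, h⟩
      change (x ≤ 1 ∧ y ≤ 1) → (x ≤ 1 ∧ y ≤ 0) ∨ (x ≤ 0 ∧ y ≤ 1)
      dsimp only at h
      omega
    · rintro ⟨⟨x, y, hx, hy⟩, h⟩
      change (x ≤ 1 ∧ y ≤ 0) → (x ≤ 0 ∧ y ≤ 1) → (x ≤ 0 ∧ y ≤ 0)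
      omega
    · rw [cocartAt_res_iff]
      exact hl
  have h12 : LeftInduced (D.res incl₁) Y ↔ CocartAt right Y := by
    rw [leftInduced_iff_of_reflects hD (fun _ _ h => h)]
    have h1 : ∀ b : Grid.{w}, (¬ ∃ a, incl₁.obj a = b) ↔ b = right.obj ⟨1, 1⟩ := by
      intro b
      constructor
      · intro hb
        have h1 := b.hx
        have h2 := b.hy
        have h3 : ¬ (b.y = 0 ∨ b.x ≤ 1) := fun h => hb ⟨⟨b, h⟩, rfl⟩
        apply Grid.ext
        · change b.x = 2
          omega
        · change b.y = 1
          omega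
      · rintro rfl ⟨a, ha⟩
        have h1 : a.1.x = 2 := congrArg Grid.x ha
        have h2 : a.1.y = 1 := congrArg Grid.y ha
        have := a.2
        omega
    simp only [h1, forall_eq]
    refine isColim_slice_iff_cocartAt (fun _ _ h => h) right ?_ ?_ ?_ Y
    · rintro ⟨x, y⟩ hs
      refine ⟨⟨right.obj ⟨x, y⟩, ?_⟩, rfl⟩
      fin_cases x <;> fin_cases y <;> simp [right, Monotone.functor] at hs ⊢
    · rintro ⟨⟨x, y, hx, hy⟩, h⟩
      change (x ≤ 2 ∧ y ≤ 1) → (x ≤ 2 ∧ y ≤ 0) ∨ (x ≤ 1 ∧ y ≤ 1)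
      dsimp only at h
      omega
    · rintro ⟨⟨x, y, hx, hy⟩, h⟩
      change (x ≤ 2 ∧ y ≤ 0) → (x ≤ 1 ∧ y ≤ 1) → (x ≤ 1 ∧ y ≤ 0)
      omega
  -- Extending from `J₀` at once, the value at `(1,1)` is still the pushout of the left square, and
  -- the value at `(2,1)` is that of the outer square. Pasting is now composition and cancellation
  -- of induced diagrams.
  have h02 : LeftInduced (D.res (incl₀ ⋙ incl₁)) Y ↔ CocartAt outer Y := by
    rw [leftInduced_iff_of_reflects hD (fun _ _ h => h)]
    have houter : IsColim (h := Comma.fst (incl₀ ⋙ incl₁)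
        (Functor.fromPUnit.{w} (outer.obj ⟨1, 1⟩)) ⋙ (incl₀ ⋙ incl₁)) (b := outer.obj ⟨1, 1⟩)
        (Comma.natTrans (incl₀ ⋙ incl₁) (Functor.fromPUnit.{w} (outer.obj ⟨1, 1⟩))) Y ↔
        CocartAt outer Y := by
      refine isColim_slice_iff_cocartAt (fun _ _ h => h) outer ?_ ?_ ?_ Y
      · rintro ⟨x, y⟩ hs
        refine ⟨⟨outer.obj ⟨x, y⟩, ?_⟩, rfl⟩
        fin_cases x <;> fin_cases y <;> simp [outer, Monotone.functor] at hs ⊢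
      · rintro ⟨⟨x, y, hx, hy⟩, h⟩
        change (x ≤ 2 ∧ y ≤ 1) → (x ≤ 2 ∧ y ≤ 0) ∨ (x ≤ 0 ∧ y ≤ 1)
        dsimp only at h
        omega
      · rintro ⟨⟨x, y, hx, hy⟩, h⟩
        change (x ≤ 2 ∧ y ≤ 0) → (x ≤ 0 ∧ y ≤ 1) → (x ≤ 0 ∧ y ≤ 0)
        omega
    have hleft : IsColim (h := Comma.fst (incl₀ ⋙ incl₁)
        (Functor.fromPUnit.{w} (left.obj ⟨1, 1⟩)) ⋙ (incl₀ ⋙ incl₁)) (b := left.obj ⟨1, 1⟩)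
        (Comma.natTrans (incl₀ ⋙ incl₁) (Functor.fromPUnit.{w} (left.obj ⟨1, 1⟩))) Y := by
      refine (isColim_slice_iff_cocartAt (fun _ _ h => h) left ?_ ?_ ?_ Y).2 hl
      · rintro ⟨x, y⟩ hs
        refine ⟨⟨left.obj ⟨x, y⟩, ?_⟩, rfl⟩
        fin_cases x <;> fin_cases y <;> simp [left, Monotone.functor] at hs ⊢
      · rintro ⟨⟨x, y, hx, hy⟩, h⟩
        change (x ≤ 1 ∧ y ≤ 1) → (x ≤ 1 ∧ y ≤ 0) ∨ (x ≤ 0 ∧ y ≤ 1)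
        dsimp only at h
        omega
      · rintro ⟨⟨x, y, hx, hy⟩, h⟩
        change (x ≤ 1 ∧ y ≤ 0) → (x ≤ 0 ∧ y ≤ 1) → (x ≤ 0 ∧ y ≤ 0)
        omega
    rw [← houter]
    constructor
    · intro h
      apply h
      rintro ⟨⟨a, h⟩, ha⟩
      have h1 : a.x = 2 := congrArg Grid.x ha
      have h2 : a.y = 1 := congrArg Grid.y ha
      omega
    · intro h b hb
      have h1 := b.hx
      have h2 := b.hy
      have h3 : ¬ (b.y = 0 ∨ b.x = 0) := fun h => hb ⟨⟨b, h⟩, rfl⟩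
      obtain h4 | h4 : b.x = 1 ∨ b.x = 2 := by omega
      · obtain rfl : b = left.obj ⟨1, 1⟩ := Grid.ext h4 (show b.y = 1 by omega)
        exact hleft
      · obtain rfl : b = outer.obj ⟨1, 1⟩ := Grid.ext h4 (show b.y = 1 by omega)
        exact h
  rw [← h12, ← h02, res_comp]
  exact ⟨fun h => h.comp h01, fun h => h.of_comp h01⟩

end Prederivator

/-! ### Rectangles in the mesh category -/

namespace Mesh

variable {n : ℕ}

/-- The rectangle in the mesh category with the given values of the coordinates `k` and `k + l`. -/
noncomputable def rect (n : ℕ) (p₀ p₁ q₀ q₁ : ℤ) (hp : p₀ ≤ p₁) (hq : q₀ ≤ q₁) (h : p₁ ≤ q₀)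
    (h' : q₁ ≤ p₀ + n + 1) : Square.{w} ⥤ Mesh.{w} n :=
  Monotone.functor (f := fun s =>
    { k := if (s.y : ℕ) = 0 then p₀ else p₁
      l := (if (s.x : ℕ) = 0 then q₀ else q₁) - if (s.y : ℕ) = 0 then p₀ else p₁
      nonneg := by split_ifs <;> omega
      le_succ := by split_ifs <;> omega }) fun s t hst => by
    rw [Prederivator.square_le_iff] at hst
    rw [le_def]
    dsimp only
    split_ifs <;> omega

/-- Two rectangles side by side in the mesh category. -/
noncomputable def rectGrid (n : ℕ) (p₀ p₁ q₀ q₁ q₂ : ℤ) (hp : p₀ ≤ p₁) (hq : q₀ ≤ q₁)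
    (hq' : q₁ ≤ q₂) (h : p₁ ≤ q₀) (h' : q₂ ≤ p₀ + n + 1) : Prederivator.Grid.{w} ⥤ Mesh.{w} n :=
  Monotone.functor (f := fun s =>
    { k := if s.y = 0 then p₀ else p₁
      l := (if s.x = 0 then q₀ else if s.x = 1 then q₁ else q₂) - if s.y = 0 then p₀ else p₁
      nonneg := by split_ifs <;> omega
      le_succ := by split_ifs <;> omega }) fun s t hst => by
    rw [Prederivator.Grid.le_iff] at hst
    rw [le_def]
    dsimp only
    split_ifs <;> omega

/-- Two rectangles on top of each other in the mesh category. -/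
noncomputable def rectGrid' (n : ℕ) (p₀ p₁ p₂ q₀ q₁ : ℤ) (hp : p₀ ≤ p₁) (hp' : p₁ ≤ p₂)
    (hq : q₀ ≤ q₁) (h : p₂ ≤ q₀) (h' : q₁ ≤ p₀ + n + 1) : Prederivator.Grid.{w} ⥤ Mesh.{w} n :=
  Monotone.functor (f := fun s =>
    { k := if s.x = 0 then p₀ else if s.x = 1 then p₁ else p₂
      l := (if s.y = 0 then q₀ else q₁) - if s.x = 0 then p₀ else if s.x = 1 then p₁ else p₂
      nonneg := by split_ifs <;> omega
      le_succ := by split_ifs <;> omega }) fun s t hst => by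
    rw [Prederivator.Grid.le_iff] at hst
    rw [le_def]
    dsimp only
    split_ifs <;> omega

lemma square_eq_rect (k l : ℤ) (h₁ : 1 ≤ l) (h₂ : l ≤ n) :
    square.{w} n k l h₁ h₂ = rect n k (k + 1) (k + l) (k + l + 1) (by omega) (by omega) (by omega)
      (by omega) := by
  refine Prederivator.functor_ext_of_poset ?_
  rintro ⟨x, y⟩
  fin_cases x <;> fin_cases y <;>
    simp [square, rect, Monotone.functor] <;> omega

/-- In the coordinates `(p, q) = (k, k + l)` the flip is `(p, q) ↦ (q, p + n + 1)`; the exchange of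
coordinates is the transposition of the square. -/
lemma rect_flip (p₀ p₁ q₀ q₁ : ℤ) (hp : p₀ ≤ p₁) (hq : q₀ ≤ q₁) (h : p₁ ≤ q₀)
    (h' : q₁ ≤ p₀ + n + 1) : rect.{w} n p₀ p₁ q₀ q₁ hp hq h h' ⋙ flip n =
      Prederivator.squareSwap ⋙ rect n q₀ q₁ (p₀ + n + 1) (p₁ + n + 1) hq (by omega) h'
        (by omega) := by
  refine Prederivator.functor_ext_of_poset ?_
  rintro ⟨x, y⟩
  ext <;> simp [flip, rect, Monotone.functor, Prederivator.squareSwap]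
  omega

/-- The squares `(k, l), (k, n + 1), (k + l, 0), (k + l, n + 1 - l)`, as a functor of `(k, l)`. -/
noncomputable def susp (n : ℕ) : Mesh.{w} n × Square.{w} ⥤ Mesh.{w} n :=
  { obj := fun m =>
      { k := if (m.2.y : ℕ) = 0 then m.1.k else m.1.k + m.1.l
        l := (if (m.2.x : ℕ) = 0 then m.1.k + m.1.l else m.1.k + n + 1) -
          if (m.2.y : ℕ) = 0 then m.1.k else m.1.k + m.1.l
        nonneg := by
          have := m.1.nonneg
          have := m.1.le_succ
          split_ifs <;> omega
        le_succ := by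
          have := m.1.nonneg
          have := m.1.le_succ
          split_ifs <;> omega }
    map := fun {s t} f => homOfLE (by
      have h1 := (le_def _ _).1 f.1.le
      have h2 := (Prederivator.square_le_iff _ _).1 f.2.le
      have := s.1.nonneg
      have := s.1.le_succ
      have := t.1.nonneg
      have := t.1.le_succ
      rw [le_def]
      dsimp only
      split_ifs <;> omega)
    map_id := fun _ => Subsingleton.elim _ _
    map_comp := fun _ _ => Subsingleton.elim _ _ }

lemma sectL_zero_susp :
    CategoryTheory.Prod.sectL (Mesh.{w} n) (⟨0, 0⟩ : Square.{w}) ⋙ susp n = 𝟭 _ := by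
  refine Prederivator.functor_ext_of_poset fun m => ?_
  ext <;> simp [susp]

lemma sectL_one_susp :
    CategoryTheory.Prod.sectL (Mesh.{w} n) (⟨1, 1⟩ : Square.{w}) ⋙ susp n = flip n := by
  refine Prederivator.functor_ext_of_poset fun m => ?_
  ext <;> simp [susp, flip, Monotone.functor]
  omega

end Mesh

namespace Prederivator

variable {D : Prederivator.{w, v, u}}

/-! ### Cocartesian squares with parameters -/

section Stable

variable {A B : Type w} [Category.{w} A] [Category.{w} B]

/-- Since `k` is fully faithful the unit is invertible, so values of `L` are induced. Conversely the
counit at an induced object is invertible. -/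
lemma LeftInduced.iff_essImage (hD : D.IsDerivator) (k : A ⥤ B) [k.Full] [k.Faithful]
    (Y : D.val B) : LeftInduced (D.res k) Y ↔
      ∃ L : D.val A ⥤ D.val B, Nonempty (L ⊣ D.res k) ∧ L.essImage Y := by
  constructor
  · intro h
    obtain ⟨L, ⟨adj⟩⟩ := hD.der3_left A B k
    have := h.isIso_counit adj
    exact ⟨L, ⟨adj⟩, ⟨_, ⟨asIso (adj.counit.app Y)⟩⟩⟩
  · rintro ⟨L, ⟨adj⟩, X, ⟨e⟩⟩
    have : IsIso (adj.unit.app X) := isIso_of_isLan k hD ((isLan_iff_isIso k _ adj).2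
      (isIso_homEquiv_symm_unit adj X))
    exact (LeftInduced.of_isIso_unit adj X).of_iso e

instance full_spanIncl_prod : (spanIncl.{w}.prod (𝟭 A)).Full where
  map_surjective f := ⟨(f.1, f.2), rfl⟩

instance faithful_spanIncl_prod : (spanIncl.{w}.prod (𝟭 A)).Faithful where
  map_injective h := Prod.ext (Subsingleton.elim _ _) (congrArg Prod.snd h)

lemma isCocartesian_iff (hD : D.IsDerivator) (X : D.val (Square.{w} × A)) :
    D.IsCocartesian X ↔ ∀ a, CocartAt (CategoryTheory.Prod.sectL Square.{w} a) X := by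
  rw [IsCocartesian, ← LeftInduced.iff_essImage hD, leftInduced_prod_id_iff hD]
  refine forall_congr' fun a => ?_
  rw [cocartAt_iff_leftInduced hD]

end Stable

/-! ### Exact diagrams on the mesh category -/

section MeshExactness

variable {n : ℕ}

lemma CocartAt.of_iso (hD : D.IsDerivator) {B : Type w} [Category.{w} B] {e : Square.{w} ⥤ B}
    {Y Y' : D.val B} (i : Y ≅ Y') (h : CocartAt e Y) : CocartAt e Y' := by
  rw [cocartAt_iff_leftInduced hD] at h ⊢
  exact h.of_iso ((D.res e).mapIso i)

variable (D n) in
/-- The exactness conditions for diagrams on the mesh category. -/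
def MeshExactAt (Y : D.val (Mesh.{w} n)) : Prop :=
  (∀ m : Mesh.{w} n, m.l = 0 ∨ m.l = n + 1 → Limits.IsZero (valueAt Y m)) ∧
    ∀ (k l : ℤ) (h₁ : 1 ≤ l) (h₂ : l ≤ n), CocartAt (Mesh.square n k l h₁ h₂) Y

lemma MeshExactAt.of_iso (hD : D.IsDerivator) {Y Y' : D.val (Mesh.{w} n)} (i : Y ≅ Y')
    (h : D.MeshExactAt n Y) : D.MeshExactAt n Y' :=
  ⟨fun m hm => (h.1 m hm).of_iso ((D.res _).mapIso i.symm),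
    fun k l h₁ h₂ => (h.2 k l h₁ h₂).of_iso hD i⟩

lemma isZero_iff_of_iso {𝒞 : Type*} [Category* 𝒞] {X Y : 𝒞} (e : X ≅ Y) :
    Limits.IsZero X ↔ Limits.IsZero Y :=
  ⟨fun h => h.of_iso e.symm, fun h => h.of_iso e⟩

/-- Exactness is a pointwise condition. -/
theorem meshExact_iff (hD : D.IsStableDerivator) (A : (Cat.{w, w})ᵒᵖ)
    (X : D.val (Mesh.{w} n × A.unop)) : D.MeshExact n A X ↔
      ∀ a, D.MeshExactAt n ((D.res (CategoryTheory.Prod.sectL (Mesh.{w} n) a)).obj X) := by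
  have h1 : ∀ m : Mesh.{w} n, Limits.IsZero ((D.res (CategoryTheory.Prod.sectR m A.unop)).obj X) ↔
      ∀ a, Limits.IsZero
        (valueAt ((D.res (CategoryTheory.Prod.sectL (Mesh.{w} n) a)).obj X) m) := fun m => by
    rw [isZero_iff_valueAt hD]
    exact forall_congr' fun a =>
      (isZero_iff_of_iso (resPt (CategoryTheory.Prod.sectR m A.unop) a X)).trans
      (isZero_iff_of_iso (resPt (CategoryTheory.Prod.sectL (Mesh.{w} n) a) m X)).symm
  have h2 : ∀ (k l : ℤ) (h₁ : 1 ≤ l) (h₂ : l ≤ n),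
      (D.IsCocartesian ((D.res ((Mesh.square n k l h₁ h₂).prod (𝟭 A.unop))).obj X) ∧
        D.IsCartesian ((D.res ((Mesh.square n k l h₁ h₂).prod (𝟭 A.unop))).obj X)) ↔
      ∀ a, CocartAt (Mesh.square n k l h₁ h₂)
        ((D.res (CategoryTheory.Prod.sectL (Mesh.{w} n) a)).obj X) := fun k l h₁ h₂ => by
    -- Here stability is used: the cartesian half of the condition is redundant, and pushouts are
    -- tested at each parameter.
    rw [← hD.cocartesian_iff_cartesian, and_self, isCocartesian_iff hD.toIsDerivator]
    refine forall_congr' fun a => ?_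
    rw [cocartAt_res_iff, cocartAt_res_iff]
    rfl
  constructor
  · intro h a
    exact ⟨fun m hm => (h1 m).1 (h.1 m hm) a, fun k l h₁ h₂ => (h2 k l h₁ h₂).1 (h.2 k l h₁ h₂) a⟩
  · intro h
    exact ⟨fun m hm => (h1 m).2 fun a => (h a).1 m hm,
      fun k l h₁ h₂ => (h2 k l h₁ h₂).2 fun a => (h a).2 k l h₁ h₂⟩

lemma sectL_comp_prod {M A A' : Type w} [Category.{w} M] [Category.{w} A] [Category.{w} A']
    (f : A' ⥤ A) (a : A') : CategoryTheory.Prod.sectL M a ⋙ (𝟭 M).prod f =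
      CategoryTheory.Prod.sectL M (f.obj a) :=
  Functor.hext (fun _ => rfl) (fun _ _ _ => heq_of_eq (Prod.ext rfl (f.map_id a)))

/-- The exact diagrams are stable under restriction. -/
theorem restrictionStable_meshExact (hD : D.IsStableDerivator) (n : ℕ) :
    (D.shift (Mesh.{w} n)).RestrictionStable (D.MeshExact n) where
  res_mem {A A'} f X hX := by
    refine (meshExact_iff hD A' _).2 fun a => ?_
    have h := (meshExact_iff hD A X).1 hX (f.unop.toFunctor.obj a)
    refine h.of_iso hD.toIsDerivator ?_
    exact eqToIso (by rw [sectL_comp_prod]) ≪≫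
      D.resComp (CategoryTheory.Prod.sectL (Mesh.{w} n) a)
        ((𝟭 (Mesh.{w} n)).prod f.unop.toFunctor) X

/-! ### Rectangles in exact diagrams -/

section Rect

variable {Y : D.val (Mesh.{w} n)}

/-- Pasting along the coordinate `q = k + l`. -/
lemma cocartAt_rect_paste (hD : D.IsDerivator) {p₀ p₁ q₀ q₁ q₂ : ℤ} (hp : p₀ ≤ p₁) (hq : q₀ ≤ q₁)
    (hq' : q₁ ≤ q₂) (h : p₁ ≤ q₀) (h' : q₂ ≤ p₀ + n + 1)
    (hl : CocartAt (Mesh.rect n p₀ p₁ q₀ q₁ hp hq h (by omega)) Y)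
    (hr : CocartAt (Mesh.rect n p₀ p₁ q₁ q₂ hp hq' (by omega) h') Y) :
    CocartAt (Mesh.rect n p₀ p₁ q₀ q₂ hp (by omega) h h') Y := by
  have key := cocartAt_grid hD ((D.res (Mesh.rectGrid n p₀ p₁ q₀ q₁ q₂ hp hq hq' h h')).obj Y)
  rw [cocartAt_res_iff, cocartAt_res_iff, cocartAt_res_iff] at key
  have e1 : Grid.left ⋙ Mesh.rectGrid n p₀ p₁ q₀ q₁ q₂ hp hq hq' h h' =
      Mesh.rect n p₀ p₁ q₀ q₁ hp hq h (by omega) := by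
    refine functor_ext_of_poset ?_
    rintro ⟨x, y⟩
    fin_cases x <;> fin_cases y <;> rfl
  have e2 : Grid.right ⋙ Mesh.rectGrid n p₀ p₁ q₀ q₁ q₂ hp hq hq' h h' =
      Mesh.rect n p₀ p₁ q₁ q₂ hp hq' (by omega) h' := by
    refine functor_ext_of_poset ?_
    rintro ⟨x, y⟩
    fin_cases x <;> fin_cases y <;> rfl
  have e3 : Grid.outer ⋙ Mesh.rectGrid n p₀ p₁ q₀ q₁ q₂ hp hq hq' h h' =
      Mesh.rect n p₀ p₁ q₀ q₂ hp (by omega) h h' := by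
    refine functor_ext_of_poset ?_
    rintro ⟨x, y⟩
    fin_cases x <;> fin_cases y <;> rfl
  rw [e1, e2, e3] at key
  exact (key hl).1 hr

/-- Pasting along the coordinate `p = k`. The long side of the grid now runs in the vertical
direction of the rectangles, so all three squares appear transposed. -/
lemma cocartAt_rect_paste' (hD : D.IsDerivator) {p₀ p₁ p₂ q₀ q₁ : ℤ} (hp : p₀ ≤ p₁) (hp' : p₁ ≤ p₂)
    (hq : q₀ ≤ q₁) (h : p₂ ≤ q₀) (h' : q₁ ≤ p₀ + n + 1)
    (hl : CocartAt (Mesh.rect n p₀ p₁ q₀ q₁ hp hq (by omega) h') Y)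
    (hr : CocartAt (Mesh.rect n p₁ p₂ q₀ q₁ hp' hq h (by omega)) Y) :
    CocartAt (Mesh.rect n p₀ p₂ q₀ q₁ (by omega) hq h h') Y := by
  have key := cocartAt_grid hD ((D.res (Mesh.rectGrid' n p₀ p₁ p₂ q₀ q₁ hp hp' hq h h')).obj Y)
  rw [cocartAt_res_iff, cocartAt_res_iff, cocartAt_res_iff] at key
  have e1 : Grid.left ⋙ Mesh.rectGrid' n p₀ p₁ p₂ q₀ q₁ hp hp' hq h h' =
      squareSwap ⋙ Mesh.rect n p₀ p₁ q₀ q₁ hp hq (by omega) h' := by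
    refine functor_ext_of_poset ?_
    rintro ⟨x, y⟩
    fin_cases x <;> fin_cases y <;> rfl
  have e2 : Grid.right ⋙ Mesh.rectGrid' n p₀ p₁ p₂ q₀ q₁ hp hp' hq h h' =
      squareSwap ⋙ Mesh.rect n p₁ p₂ q₀ q₁ hp' hq h (by omega) := by
    refine functor_ext_of_poset ?_
    rintro ⟨x, y⟩
    fin_cases x <;> fin_cases y <;> rfl
  have e3 : Grid.outer ⋙ Mesh.rectGrid' n p₀ p₁ p₂ q₀ q₁ hp hp' hq h h' =
      squareSwap ⋙ Mesh.rect n p₀ p₂ q₀ q₁ (by omega) hq h h' := by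
    refine functor_ext_of_poset ?_
    rintro ⟨x, y⟩
    fin_cases x <;> fin_cases y <;> rfl
  rw [e1, e2, e3, cocartAt_swap_iff hD, cocartAt_swap_iff hD, cocartAt_swap_iff hD] at key
  exact (key hl).1 hr

/-- Rectangles of width one in `p` are built from mesh squares by induction on the length in `q`.
The end is written `q₀ + 1 + N` so that `N = 0` is a single mesh square. -/
lemma cocartAt_rect_succ (hD : D.IsDerivator) (hY : D.MeshExactAt n Y) (N : ℕ) :
    ∀ {p₀ q₀ : ℤ} (h : p₀ + 1 ≤ q₀) (h' : q₀ + 1 + N ≤ p₀ + n + 1),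
      CocartAt (Mesh.rect n p₀ (p₀ + 1) q₀ (q₀ + 1 + N) (by omega) (by omega) h h') Y := by
  have base : ∀ {p₀ q₀ : ℤ} (h : p₀ + 1 ≤ q₀) (h' : q₀ + 1 ≤ p₀ + n + 1),
      CocartAt (Mesh.rect n p₀ (p₀ + 1) q₀ (q₀ + 1) (by omega) (by omega) h h') Y := by
    intro p₀ q₀ h h'
    -- The bounds `1 ≤ q₀ - p₀ ≤ n` say exactly that the unit square at `(p₀, q₀)` fits into the
    -- strip.
    have := hY.2 p₀ (q₀ - p₀) (by omega) (by omega)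
    rw [Mesh.square_eq_rect] at this
    simpa only [add_sub_cancel] using this
  induction N with
  | zero =>
    intro p₀ q₀ h h'
    simpa using base h (by simpa using h')
  | succ N ih =>
    intro p₀ q₀ h h'
    have h1 := ih (p₀ := p₀) (q₀ := q₀) h (by push_cast at h'; omega)
    have h2 := base (p₀ := p₀) (q₀ := q₀ + 1 + N) (by omega) (by push_cast at h'; omega)
    have h3 := cocartAt_rect_paste hD (by omega) (by omega) (by omega) h
      (by push_cast at h'; omega) h1 h2
    simpa only [Nat.cast_succ, add_assoc] using h3

/-- Rectangles of width one are stacked in the direction of `p`. -/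
lemma cocartAt_rect_of_nat (hD : D.IsDerivator) (hY : D.MeshExactAt n Y) (N N' : ℕ) :
    ∀ {p₀ q₀ : ℤ} (h : p₀ + 1 + N' ≤ q₀) (h' : q₀ + 1 + N ≤ p₀ + n + 1),
      CocartAt (Mesh.rect n p₀ (p₀ + 1 + N') q₀ (q₀ + 1 + N) (by omega) (by omega) h h') Y := by
  induction N' with
  | zero =>
    intro p₀ q₀ h h'
    simpa using cocartAt_rect_succ hD hY N (by simpa using h) h'
  | succ N' ih =>
    intro p₀ q₀ h h'
    push_cast at h
    have h1 := ih (p₀ := p₀) (q₀ := q₀) (by omega) h'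
    have h2 := cocartAt_rect_succ hD hY N (p₀ := p₀ + 1 + N') (q₀ := q₀) (by omega) (by omega)
    have h3 := cocartAt_rect_paste' hD (by omega) (by omega) (by omega) (by omega) h' h1 h2
    simpa only [Nat.cast_succ, add_assoc] using h3

/-- An exact diagram makes all rectangles cocartesian. -/
theorem MeshExactAt.cocartAt_rect (hD : D.IsDerivator) (hY : D.MeshExactAt n Y) {p₀ p₁ q₀ q₁ : ℤ}
    (hp : p₀ < p₁) (hq : q₀ < q₁) (h : p₁ ≤ q₀) (h' : q₁ ≤ p₀ + n + 1) :
    CocartAt (Mesh.rect n p₀ p₁ q₀ q₁ hp.le hq.le h h') Y := by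
  obtain ⟨N, rfl⟩ : ∃ N : ℕ, q₁ = q₀ + 1 + N := ⟨(q₁ - q₀ - 1).toNat, by omega⟩
  obtain ⟨N', rfl⟩ : ∃ N' : ℕ, p₁ = p₀ + 1 + N' := ⟨(p₁ - p₀ - 1).toNat, by omega⟩
  exact cocartAt_rect_of_nat hD hY N N' h h'

/-- Exactness is stable under the flip symmetry. -/
theorem MeshExactAt.flip (hD : D.IsDerivator) (hY : D.MeshExactAt n Y) :
    D.MeshExactAt n ((D.res (Mesh.flip n)).obj Y) := by
  refine ⟨fun m hm => ?_, fun k l h₁ h₂ => ?_⟩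
  · refine (hY.1 ((Mesh.flip n).obj m) ?_).of_iso (resPt (Mesh.flip n) m Y)
    change n + 1 - m.l = 0 ∨ n + 1 - m.l = n + 1
    omega
  · rw [cocartAt_res_iff, Mesh.square_eq_rect, Mesh.rect_flip, cocartAt_swap_iff hD]
    exact hY.cocartAt_rect hD (by omega) (by omega) _ _

/-- Diagrams of zero objects are exact. -/
theorem meshExactAt_of_isZero (hD : D.IsStableDerivator)
    (h : ∀ m, Limits.IsZero (valueAt Y m)) : D.MeshExactAt n Y :=
  ⟨fun m _ => h m, fun _ _ _ _ => cocartAt_of_isZero hD _ _ fun _ => h _⟩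

/-- Exact diagrams make the squares computing the suspension cocartesian. -/
theorem MeshExactAt.cocartAt_susp (hD : D.IsStableDerivator) (hY : D.MeshExactAt n Y)
    (m : Mesh.{w} n) : CocartAt (CategoryTheory.Prod.sectR m Square.{w} ⋙ Mesh.susp n) Y := by
  have h1 := m.nonneg
  have h2 := m.le_succ
  -- On the boundary the rectangle has a side of length zero and the rectangle theorem does not
  -- apply; but then all four vertices are boundary points.
  by_cases hm : m.l = 0 ∨ m.l = n + 1
  · refine cocartAt_of_isZero hD _ _ fun s => hY.1 _ ?_
    simp only [Functor.comp_obj, CategoryTheory.Prod.sectR_obj, Mesh.susp]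
    split_ifs <;> omega
  · have e : CategoryTheory.Prod.sectR m Square.{w} ⋙ Mesh.susp n =
        Mesh.rect n m.k (m.k + m.l) (m.k + m.l) (m.k + n + 1) (by omega) (by omega) (by omega)
          (by omega) := functor_ext_of_poset fun _ => rfl
    rw [e]
    exact hY.cocartAt_rect hD.toIsDerivator (by omega) (by omega) _ _

/-- The squares computing the suspension are diagrams of exact diagrams. -/
theorem MeshExactAt.susp (hD : D.IsStableDerivator) (hY : D.MeshExactAt n Y) (s : Square.{w}) :
    D.MeshExactAt n ((D.res (CategoryTheory.Prod.sectL (Mesh.{w} n) s ⋙ Mesh.susp n)).obj Y) := by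
  -- The vertex `(0,0)` gives the identity and `(1,1)` the flip; at the two other vertices all of
  -- `M_n` is sent to the boundary, which gives a zero diagram.
  have hc : s = ⟨0, 0⟩ ∨ s = ⟨1, 1⟩ ∨ ∀ m : Mesh.{w} n, ((Mesh.susp n).obj (m, s)).l = 0 ∨
      ((Mesh.susp n).obj (m, s)).l = n + 1 := by
    obtain ⟨x, y⟩ := s
    fin_cases x <;> fin_cases y <;> simp [Mesh.susp]
    omega
  rcases hc with rfl | rfl | hc
  · rw [Mesh.sectL_zero_susp, D.res_id]
    exact hY
  · rw [Mesh.sectL_one_susp]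
    exact hY.flip hD.toIsDerivator
  · refine meshExactAt_of_isZero hD fun m => ?_
    exact (hY.1 _ (hc m)).of_iso
      (resPt (CategoryTheory.Prod.sectL (Mesh.{w} n) s ⋙ Mesh.susp n) m Y)

end Rect

end MeshExactness

end Prederivator

/-! ### Strict transformations -/

section Strict

variable {B : Type*} [Bicategory B] {P Q R : Pseudofunctor B Cat.{v, u}}

/-- A pseudo-natural transformation whose naturality constraints are identities. -/
def IsStrict (φ : P ⟶ Q) : Prop :=
  ∀ ⦃a b : B⦄ (f : a ⟶ b), ∃ h, φ.naturality f = eqToIso h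

lemma IsStrict.comp {φ : P ⟶ Q} {ψ : Q ⟶ R} (hφ : IsStrict φ) (hψ : IsStrict ψ) :
    IsStrict (φ ≫ ψ) := by
  intro a b f
  obtain ⟨h, e⟩ := hφ f
  obtain ⟨h', e'⟩ := hψ f
  have hh : P.map f ≫ φ.app b ≫ ψ.app b = (φ.app a ≫ ψ.app a) ≫ R.map f := by
    rw [← Category.assoc, h, Category.assoc, h', Category.assoc]
  refine ⟨hh, ?_⟩
  ext1
  change (α_ _ _ _).inv ≫ (φ.naturality f).hom ▷ ψ.app b ≫ (α_ _ _ _).hom ≫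
    φ.app a ◁ (ψ.naturality f).hom ≫ (α_ _ _ _).inv = _
  rw [e, e']
  simp [Bicategory.Strict.associator_eqToIso]
  erw [Category.id_comp, Category.comp_id]

lemma IsStrict.id (P : Pseudofunctor B Cat.{v, u}) : IsStrict (𝟙 P) := by
  intro a b f
  refine ⟨by change P.map f ≫ 𝟙 _ = 𝟙 _ ≫ P.map f; simp, ?_⟩
  ext1
  change (ρ_ _).hom ≫ (λ_ _).inv = _
  simp [Bicategory.Strict.leftUnitor_eqToIso, Bicategory.Strict.rightUnitor_eqToIso]
  rfl

/-- The constraints of a strict transformation are determined by its components, so identities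
between restriction morphisms reduce to identities between functors of shapes. -/
lemma IsStrict.ext {φ ψ : P ⟶ Q} (hφ : IsStrict φ) (hψ : IsStrict ψ)
    (h : ∀ a, φ.app a = ψ.app a) : φ = ψ := by
  obtain ⟨app, nat, _, _, _⟩ := φ
  obtain ⟨app', nat', _, _, _⟩ := ψ
  obtain rfl : app = app' := funext h
  obtain rfl : @nat = @nat' := by
    funext a b f
    obtain ⟨h, e⟩ := hφ f
    obtain ⟨h', e'⟩ := hψ f
    exact e.trans e'.symm
  rfl

lemma isStrict_strictTrans {B : Type*} [Bicategory B] [Bicategory.Strict B]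
    (F G : StrictPseudofunctor B Cat.{v, u}) (app : ∀ a, F.obj a ⟶ G.obj a)
    (h : ∀ {a b : B} (f : a ⟶ b), F.map f ≫ app b = app a ≫ G.map f)
    (h₂ : ∀ {a b : B} {f g : a ⟶ b} (η : f ⟶ g),
      F.map₂ η ▷ app b ≫ eqToHom (h g) = eqToHom (h f) ≫ app a ◁ G.map₂ η) :
    IsStrict (strictTrans F G app h h₂) :=
  fun _ _ f => ⟨h f, rfl⟩

end Strict

/-! ### Adjunctions of pseudo-natural transformations -/

section Adjunction

variable {B : Type*} [Bicategory B] {P Q R : Pseudofunctor B Cat.{v, u}}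

/-- The components of an adjunction of pseudo-natural transformations are adjunctions. -/
def adjunctionApp {φ : P ⟶ Q} {ψ : Q ⟶ P} (adj : Bicategory.Adjunction φ ψ) (a : B) :
    (φ.app a).toFunctor ⊣ (ψ.app a).toFunctor :=
  Adjunction.ofCat
    { unit := adj.unit.as.app a
      counit := adj.counit.as.app a
      left_triangle := congrArg (fun t => t.as.app a) adj.left_triangle
      right_triangle := congrArg (fun t => t.as.app a) adj.right_triangle }

lemma adjunctionApp_unit {φ : P ⟶ Q} {ψ : Q ⟶ P} (adj : Bicategory.Adjunction φ ψ) (a : B)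
    (X : P.obj a) : (adjunctionApp adj a).unit.app X = (adj.unit.as.app a).toNatTrans.app X := rfl

lemma adjunctionApp_counit {φ : P ⟶ Q} {ψ : Q ⟶ P} (adj : Bicategory.Adjunction φ ψ) (a : B)
    (X : Q.obj a) :
    (adjunctionApp adj a).counit.app X = (adj.counit.as.app a).toNatTrans.app X := rfl

/-- Modifications with invertible components are invertible. -/
lemma nonempty_iso_of_modification {φ ψ : P ⟶ Q} (Γ : φ ⟶ ψ)
    (h : ∀ (a : B) (X : P.obj a), IsIso ((Γ.as.app a).toNatTrans.app X)) : Nonempty (φ ≅ ψ) := by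
  have h1 : ∀ a, IsIso (Γ.as.app a).toNatTrans := fun a => NatIso.isIso_of_isIso_app _
  exact ⟨Pseudofunctor.StrongTrans.isoMk (fun a => Cat.Hom.isoMk (asIso (Γ.as.app a).toNatTrans))
    (fun f => Γ.as.naturality f)⟩

/-- Morphisms with values in induced objects are determined by their restrictions. -/
lemma nonempty_iso_of_leftInduced {φ : P ⟶ Q} {H : Q ⟶ P} (adj : Bicategory.Adjunction H φ)
    (T : R ⟶ P) (h : ∀ (a : B) (X : R.obj a),
      LeftInduced (φ.app a).toFunctor ((T.app a).toFunctor.obj X)) :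
    Nonempty ((T ≫ φ) ≫ H ≅ T) := by
  refine nonempty_iso_of_modification ((α_ T φ H).hom ≫ T ◁ adj.counit ≫ (ρ_ T).hom) fun a X => ?_
  have := (h a X).isIso_counit (adjunctionApp adj a)
  rw [adjunctionApp_counit] at this
  have e : ((((α_ T φ H).hom ≫ T ◁ adj.counit ≫ (ρ_ T).hom).as.app a).toNatTrans.app X) =
    𝟙 _ ≫ (adj.counit.as.app a).toNatTrans.app ((T.app a).toFunctor.obj X) ≫ 𝟙 _ := rfl
  rw [e]
  exact IsIso.comp_isIso' (IsIso.id _) (IsIso.comp_isIso' this (IsIso.id _))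

/-- Morphisms with values in coinduced objects are determined by their restrictions. -/
lemma nonempty_iso_of_rightInduced {φ : P ⟶ Q} {G : Q ⟶ P} (adj : Bicategory.Adjunction φ G)
    (T : R ⟶ P) (h : ∀ (a : B) (X : R.obj a),
      RightInduced (φ.app a).toFunctor ((T.app a).toFunctor.obj X)) :
    Nonempty (T ≅ (T ≫ φ) ≫ G) := by
  refine nonempty_iso_of_modification ((ρ_ T).inv ≫ T ◁ adj.unit ≫ (α_ T φ G).inv) fun a X => ?_
  have := (h a X).isIso_unit (adjunctionApp adj a)
  rw [adjunctionApp_unit] at this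
  have e : (((ρ_ T).inv ≫ T ◁ adj.unit ≫ (α_ T φ G).inv).as.app a).toNatTrans.app X =
    𝟙 _ ≫ (adj.unit.as.app a).toNatTrans.app ((T.app a).toFunctor.obj X) ≫ 𝟙 _ := rfl
  rw [e]
  exact IsIso.comp_isIso' (IsIso.id _) (IsIso.comp_isIso' this (IsIso.id _))

end Adjunction

/-! ### Lifting strict transformations -/

section LiftStrict

variable {B : Type*} [Bicategory B] [Bicategory.Strict B]

lemma strict_iff_app {F G : StrictPseudofunctor B Cat.{v, u}} {app : ∀ a, F.obj a ⟶ G.obj a}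
    (h : ∀ {a b : B} (f : a ⟶ b), F.map f ≫ app b = app a ≫ G.map f)
    {a b : B} {f g : a ⟶ b} (η : f ⟶ g) :
    F.map₂ η ▷ app b ≫ eqToHom (h g) = eqToHom (h f) ≫ app a ◁ G.map₂ η ↔
      ∀ X : F.obj a, (app b).toFunctor.map ((F.map₂ η).toNatTrans.app X) ≫
        eqToHom (congrArg (fun t => t.toFunctor.obj X) (h g)) =
        eqToHom (congrArg (fun t => t.toFunctor.obj X) (h f)) ≫
          (G.map₂ η).toNatTrans.app ((app a).toFunctor.obj X) := by
  constructor
  · intro e X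
    have := congrArg (fun t => t.toNatTrans.app X) e
    simp only [Cat.Hom.toNatTrans_comp, NatTrans.comp_app, cat_eqToHom_app] at this
    exact this
  · intro e
    ext X
    simp only [Cat.Hom.toNatTrans_comp, NatTrans.comp_app, cat_eqToHom_app]
    exact e X

lemma comp_eqToHom_eq {𝒞 : Type*} [Category* 𝒞] {X₁ Y₁ X₂ Y₂ X Y : 𝒞} {m₁ : X₁ ⟶ Y₁}
    {m₂ : X₂ ⟶ Y₂} {t : X ⟶ Y} {hY₁ : Y₁ = Y} {hX₁ : X₁ = X} {hY₂ : Y₂ = Y} {hX₂ : X₂ = X}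
    (h₁ : m₁ ≫ eqToHom hY₁ = eqToHom hX₁ ≫ t) (h₂ : m₂ ≫ eqToHom hY₂ = eqToHom hX₂ ≫ t)
    (hY : Y₁ = Y₂) (hX : X₁ = X₂) : m₁ ≫ eqToHom hY = eqToHom hX ≫ m₂ := by
  subst hY₁ hX₁ hX hY
  simp at h₁ h₂ ⊢
  rw [h₁, h₂]

/-- The conditions for a family of functors to be strictly 2-natural. -/
def StrictNat (F G : StrictPseudofunctor B Cat.{v, u}) (app : ∀ a, F.obj a ⟶ G.obj a) : Prop :=
  ∀ {a b : B} {f g : a ⟶ b} (η : f ⟶ g), ∃ (hf : F.map f ≫ app b = app a ≫ G.map f)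
    (hg : F.map g ≫ app b = app a ≫ G.map g), ∀ X : F.obj a,
      (app b).toFunctor.map ((F.map₂ η).toNatTrans.app X) ≫
        eqToHom (congrArg (fun t => t.toFunctor.obj X) hg) =
      eqToHom (congrArg (fun t => t.toFunctor.obj X) hf) ≫
        (G.map₂ η).toNatTrans.app ((app a).toFunctor.obj X)

lemma IsStrict.strictNat {F G : StrictPseudofunctor B Cat.{v, u}}
    {α : F.toPseudofunctor ⟶ G.toPseudofunctor} (hα : IsStrict α) : StrictNat F G α.app := by
  intro a b f g η
  obtain ⟨hf, ef⟩ := hα f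
  obtain ⟨hg, eg⟩ := hα g
  refine ⟨hf, hg, fun X => ?_⟩
  have e := α.naturality_naturality η
  rw [ef, eg] at e
  have := congrArg (fun t => t.toNatTrans.app X) e
  simp only [Cat.Hom.toNatTrans_comp, NatTrans.comp_app, eqToIso.hom, cat_eqToHom_app] at this
  exact this

/-- A strict transformation `θ` which factors objectwise through the components of a strict
transformation `ι` given by embeddings factors through `ι`. -/
theorem exists_strict_lift {F G G' : StrictPseudofunctor B Cat.{v, u}}
    {ι : G.toPseudofunctor ⟶ G'.toPseudofunctor} (hι : IsStrict ι)
    {θ : F.toPseudofunctor ⟶ G'.toPseudofunctor} (hθ : IsStrict θ)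
    (hinj : ∀ (b : B) {C : Cat.{v, u}} (s t : C ⟶ G.obj b), s ≫ ι.app b = t ≫ ι.app b → s = t)
    (hfaith : ∀ b, (ι.app b).toFunctor.Faithful)
    (app : ∀ a, F.obj a ⟶ G.obj a) (happ : ∀ a, app a ≫ ι.app a = θ.app a) :
    ∃ φ : F.toPseudofunctor ⟶ G.toPseudofunctor, IsStrict φ ∧ φ.app = app ∧ φ ≫ ι = θ := by
  have h : ∀ {a b : B} (f : a ⟶ b), F.map f ≫ app b = app a ≫ G.map f := by
    intro a b f
    apply hinj
    obtain ⟨h1, -⟩ := hι f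
    obtain ⟨h2, -⟩ := hθ f
    calc (F.map f ≫ app b) ≫ ι.app b = F.map f ≫ θ.app b := by rw [Category.assoc, happ]
      _ = θ.app a ≫ G'.map f := h2
      _ = app a ≫ G.map f ≫ ι.app b := by rw [← happ, Category.assoc]; exact congrArg _ h1.symm
      _ = (app a ≫ G.map f) ≫ ι.app b := (Category.assoc _ _ _).symm
  have h₂ : ∀ {a b : B} {f g : a ⟶ b} (η : f ⟶ g),
      F.map₂ η ▷ app b ≫ eqToHom (h g) = eqToHom (h f) ≫ app a ◁ G.map₂ η := by
    intro a b f g η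
    rw [strict_iff_app]
    intro X
    -- Compatibility with 2-cells is tested after the faithful components of `ι`, where it follows
    -- from that of `ι` and `θ`.
    apply (hfaith b).map_injective
    obtain ⟨_, _, h1⟩ := hι.strictNat η
    have hθ' : StrictNat F G' θ.app := hθ.strictNat
    rw [← (funext happ : (fun a => app a ≫ ι.app a) = θ.app)] at hθ'
    obtain ⟨_, _, h2⟩ := hθ' η
    rw [Functor.map_comp, Functor.map_comp, eqToHom_map, eqToHom_map]
    exact comp_eqToHom_eq (h2 X) (h1 ((app a).toFunctor.obj X)) _ _
  refine ⟨strictTrans F G app h h₂, isStrict_strictTrans _ _ _ _ _, rfl, ?_⟩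
  exact IsStrict.ext ((isStrict_strictTrans _ _ _ _ _).comp hι) hθ happ

end LiftStrict

namespace Prederivator

variable (D : Prederivator.{w, v, u})

/-! ### Strict morphisms of prederivators -/

section StrictMorphisms

variable {B B' C : Type w} [Category.{w} B] [Category.{w} B'] [Category.{w} C]

lemma isStrict_resMor (k : B ⥤ B') : IsStrict (D.resMor k) :=
  fun _ _ _ => ⟨_, rfl⟩

lemma isStrict_evalMor (b : B) : IsStrict (D.evalMor b) :=
  fun _ _ _ => ⟨_, rfl⟩

lemma isStrict_fullIncl {P : ∀ A : (Cat.{w, w})ᵒᵖ, ObjectProperty (D.obj A)}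
    (hP : D.RestrictionStable P) : IsStrict (D.fullIncl hP) :=
  fun _ _ _ => ⟨_, rfl⟩

/-- The functor underlying `resMor₂`. -/
abbrev prodFunctor (r : B × C ⥤ B') (A : Type w) [Category.{w} A] : B × (C × A) ⥤ B' × A :=
  (prod.inverseAssociator B C A) ⋙ r.prod (𝟭 A)

/-- Restriction along a functor of two variables. -/
def resMor₂ (r : B × C ⥤ B') :
    (D.shift B').toPseudofunctor ⟶ ((D.shift B).shift C).toPseudofunctor :=
  strictTrans (D.shift B') ((D.shift B).shift C)
    (fun A => D.map (prodFunctor r A.unop).toCatHom.op)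
    (fun {A A'} f => (D.map_comp _ _).symm.trans
      (D.map_comp (prodFunctor r A.unop).toCatHom.op
        ((𝟭 B).prod ((𝟭 C).prod f.unop.toFunctor)).toCatHom.op))
    (fun {A A' f g} η => map₂_square D (f := ((𝟭 B').prod f.unop.toFunctor).toCatHom.op)
      (f' := ((𝟭 B).prod ((𝟭 C).prod f.unop.toFunctor)).toCatHom.op) rfl rfl _ _ (by
        refine comp_id_eq_id_comp ?_
        apply congrArg Bicategory.Opposite.op2
        ext x
        refine Prod.ext ?_ ?_
        · exact (r.map_id (x.1, x.2.1)).symm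
        · rfl) _ _)

lemma isStrict_resMor₂ (r : B × C ⥤ B') : IsStrict (D.resMor₂ r) :=
  fun _ _ _ => ⟨_, rfl⟩

lemma resMor_comp {B'' : Type w} [Category.{w} B''] (k : B ⥤ B') (k' : B' ⥤ B'') :
    D.resMor k' ≫ D.resMor k = D.resMor (k ⋙ k') :=
  IsStrict.ext ((D.isStrict_resMor _).comp (D.isStrict_resMor _)) (D.isStrict_resMor _)
    fun _ => (D.map_comp _ _).symm

lemma resMor_id : D.resMor (𝟭 B) = 𝟙 _ :=
  IsStrict.ext (D.isStrict_resMor _) (IsStrict.id _) fun _ => D.map_id _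

lemma resMor_evalMor (k : B ⥤ B') (b : B) :
    D.resMor k ≫ D.evalMor b = D.evalMor (k.obj b) :=
  IsStrict.ext ((D.isStrict_resMor _).comp (D.isStrict_evalMor _)) (D.isStrict_evalMor _)
    fun A => (D.map_comp _ _).symm.trans (congrArg D.map (by
      apply Quiver.Hom.unop_inj
      apply Cat.ext
      exact Functor.hext (fun _ => rfl) (fun _ _ _ => heq_of_eq (Prod.ext (k.map_id b) rfl))))

lemma resMor₂_evalMor (r : B × C ⥤ B') (c : C) :
    D.resMor₂ r ≫ (D.shift B).evalMor c = D.resMor (CategoryTheory.Prod.sectL B c ⋙ r) :=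
  IsStrict.ext ((D.isStrict_resMor₂ _).comp (isStrict_evalMor _ _)) (D.isStrict_resMor _)
    fun _ => (D.map_comp _ _).symm

/-- The inclusion of diagrams in a full subprederivator. -/
def fullInclShift {P : ∀ A : (Cat.{w, w})ᵒᵖ, ObjectProperty (D.obj A)}
    (hP : D.RestrictionStable P) (C : Type w) [Category.{w} C] :
    ((full hP).shift C).toPseudofunctor ⟶ (D.shift C).toPseudofunctor :=
  strictTrans ((full hP).shift C) (D.shift C)
    (fun A => (P (op (Cat.of (C × A.unop)))).ι.toCatHom)
    (fun {A A'} f => by rfl)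
    (fun η => by
      refine comp_id_eq_id_comp ?_
      rfl)

lemma isStrict_fullInclShift {P : ∀ A : (Cat.{w, w})ᵒᵖ, ObjectProperty (D.obj A)}
    (hP : D.RestrictionStable P) : IsStrict (D.fullInclShift hP C) :=
  fun _ _ _ => ⟨_, rfl⟩

end StrictMorphisms

/-! ### Recognition of the suspension -/

/-- A morphism with values in cocartesian squares having the expected restriction to the corner
computes the suspension. -/
theorem nonempty_iso_of_isSuspension {D : Prederivator.{w, v, u}}
    (T : D.toPseudofunctor ⟶ (D.shift Square.{w}).toPseudofunctor)
    (θ : T ≫ D.evalMor (B := Square.{w}) ⟨0, 0⟩ ≅ 𝟙 _)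
    (hT : ∀ A X, LeftInduced ((D.resMor spanIncl.{w}).app A).toFunctor ((T.app A).toFunctor.obj X))
    (hT' : ∀ A X, RightInduced
      ((D.evalMor (B := SpanShape.{w}) ⟨⟨0, 0⟩, by simp⟩).app A).toFunctor
      (((T ≫ D.resMor spanIncl.{w}).app A).toFunctor.obj X))
    (S : D.toPseudofunctor ⟶ D.toPseudofunctor) (hS : D.IsSuspension S) :
    Nonempty (S ≅ T ≫ D.evalMor (B := Square.{w}) ⟨1, 1⟩) := by
  obtain ⟨G, H, ⟨adjG⟩, ⟨adjH⟩, ⟨e⟩⟩ := hS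
  -- `T` is recovered from its corner by `H`, the corner from its value at `(0,0)` by `G`, and that
  -- value is the identity by `θ`. Hence `T ≅ G ≫ H`.
  obtain ⟨e₁⟩ := nonempty_iso_of_leftInduced adjH T hT
  obtain ⟨e₂⟩ := nonempty_iso_of_rightInduced adjG (T ≫ D.resMor spanIncl.{w}) hT'
  have h := D.resMor_evalMor spanIncl.{w} ⟨⟨0, 0⟩, by simp⟩
  let e₃ : (T ≫ D.resMor spanIncl.{w}) ≫ D.evalMor (B := SpanShape.{w}) ⟨⟨0, 0⟩, by simp⟩ ≅ 𝟙 _ :=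
    α_ _ _ _ ≪≫ Bicategory.whiskerLeftIso T (eqToIso h) ≪≫ θ
  exact ⟨e ≪≫ (α_ _ _ _).symm ≪≫ Bicategory.whiskerRightIso
    (Bicategory.whiskerRightIso ((λ_ G).symm ≪≫ Bicategory.whiskerRightIso e₃.symm G ≪≫ e₂.symm) H
      ≪≫ e₁) _⟩

end Prederivator

namespace Prederivator

variable {D : Prederivator.{w, v, u}}

/-! ### Kan extension morphisms along fully faithful functors -/

section KanMorphisms

variable {M N A A' : Type w} [Category.{w} M] [Category.{w} N] [Category.{w} A] [Category.{w} A']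

lemma full_prod_id (k : M ⥤ N) [k.Full] : (k.prod (𝟭 A)).Full where
  map_surjective f := by
    obtain ⟨g, hg⟩ := k.map_surjective f.1
    exact ⟨(g, f.2), Prod.ext hg rfl⟩

lemma faithful_prod_id (k : M ⥤ N) [k.Faithful] : (k.prod (𝟭 A)).Faithful where
  map_injective h := by
    have h₁ := congrArg Prod.fst h
    have h₂ := congrArg Prod.snd h
    exact Prod.ext (k.map_injective h₁) h₂

lemma full_id_prod (k : M ⥤ N) [k.Full] : ((𝟭 A).prod k).Full where
  map_surjective f := by
    obtain ⟨g, hg⟩ := k.map_surjective f.2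
    exact ⟨(f.1, g), Prod.ext rfl hg⟩

lemma faithful_id_prod (k : M ⥤ N) [k.Faithful] : ((𝟭 A).prod k).Faithful where
  map_injective h := by
    have h₁ := congrArg Prod.fst h
    have h₂ := congrArg Prod.snd h
    exact Prod.ext h₁ (k.map_injective h₂)

/-- Being induced is tested at each parameter, and restriction along `f` merely reindexes
parameters. This stability is what makes objectwise Kan extensions into morphisms of prederivators.
-/
lemma leftInduced_res_prod (hD : D.IsDerivator) {k : M ⥤ N} (f : A' ⥤ A) {Y : D.val (N × A)}
    (h : LeftInduced (D.res (k.prod (𝟭 A))) Y) :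
    LeftInduced (D.res (k.prod (𝟭 A'))) ((D.res ((𝟭 N).prod f)).obj Y) := by
  rw [leftInduced_prod_id_iff hD] at h ⊢
  intro a
  refine (h (f.obj a)).of_iso (eqToIso (by rw [sectL_comp_prod]) ≪≫
    D.resComp (CategoryTheory.Prod.sectL N a) ((𝟭 N).prod f) Y)

lemma rightInduced_res_prod (hD : D.IsDerivator) {k : M ⥤ N} (f : A' ⥤ A) {Y : D.val (N × A)}
    (h : RightInduced (D.res (k.prod (𝟭 A))) Y) :
    RightInduced (D.res (k.prod (𝟭 A'))) ((D.res ((𝟭 N).prod f)).obj Y) := by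
  rw [rightInduced_prod_id_iff hD] at h ⊢
  intro a
  refine (h (f.obj a)).of_iso (eqToIso (by rw [sectL_comp_prod]) ≪≫
    D.resComp (CategoryTheory.Prod.sectL N a) ((𝟭 N).prod f) Y)

/-- Left Kan extension morphisms along fully faithful functors exist. -/
theorem exists_leftAdjoint_resMor (hD : D.IsDerivator) (k : M ⥤ N) [k.Full] [k.Faithful] :
    ∃ H, Nonempty (Bicategory.Adjunction H (D.resMor k)) :=
  exists_leftAdjoint (D.resMor k)
    (fun A (Y : D.val (N × A.unop)) => LeftInduced (D.res (k.prod (𝟭 A.unop))) Y)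
    (fun h => h)
    (fun f _ h => leftInduced_res_prod hD f.unop.toFunctor h)
    (fun {A} Y => by
      have := full_prod_id k (A := A.unop)
      have := faithful_prod_id k (A := A.unop)
      exact exists_leftInduced (k.prod (𝟭 A.unop)) hD Y)

/-- Right Kan extension morphisms along fully faithful functors exist. -/
theorem exists_rightAdjoint_resMor (hD : D.IsDerivator) (k : M ⥤ N) [k.Full] [k.Faithful] :
    ∃ G, Nonempty (Bicategory.Adjunction (D.resMor k) G) :=
  exists_rightAdjoint (D.resMor k)
    (fun A (Y : D.val (N × A.unop)) => RightInduced (D.res (k.prod (𝟭 A.unop))) Y)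
    (fun h => h)
    (fun f _ h => rightInduced_res_prod hD f.unop.toFunctor h)
    (fun {A} Y => by
      have := full_prod_id k (A := A.unop)
      have := faithful_prod_id k (A := A.unop)
      exact exists_rightInduced (k.prod (𝟭 A.unop)) hD Y)

variable {k : M ⥤ N} [k.Full] [k.Faithful]
  {H : (D.shift M).toPseudofunctor ⟶ (D.shift N).toPseudofunctor}

lemma isIso_unit_resMor (hD : D.IsDerivator) (adj : Bicategory.Adjunction H (D.resMor k))
    (A : (Cat.{w, w})ᵒᵖ) (X : D.val (M × A.unop)) : IsIso ((adjunctionApp adj A).unit.app X) := by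
  have := full_prod_id k (A := A.unop)
  have := faithful_prod_id k (A := A.unop)
  exact isIso_unit_of_fullyFaithful (k.prod (𝟭 A.unop)) hD (adjunctionApp adj A) X

lemma isIso_counit_resMor (hD : D.IsDerivator) (adj : Bicategory.Adjunction (D.resMor k) H)
    (A : (Cat.{w, w})ᵒᵖ) (X : D.val (M × A.unop)) :
    IsIso ((adjunctionApp adj A).counit.app X) := by
  have := full_prod_id k (A := A.unop)
  have := faithful_prod_id k (A := A.unop)
  exact isIso_counit_of_fullyFaithful (k.prod (𝟭 A.unop)) hD (adjunctionApp adj A) X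

/-- Left Kan extension morphisms along fully faithful functors are extensions. -/
theorem nonempty_iso_of_left (hD : D.IsDerivator) (adj : Bicategory.Adjunction H (D.resMor k)) :
    Nonempty (H ≫ D.resMor k ≅ 𝟙 _) := by
  obtain ⟨e⟩ := nonempty_iso_of_modification adj.unit fun A X => isIso_unit_resMor hD adj A X
  exact ⟨e.symm⟩

/-- Right Kan extension morphisms along fully faithful functors are extensions. -/
theorem nonempty_iso_of_right (hD : D.IsDerivator) (adj : Bicategory.Adjunction (D.resMor k) H) :
    Nonempty (H ≫ D.resMor k ≅ 𝟙 _) :=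
  nonempty_iso_of_modification adj.counit fun A X => isIso_counit_resMor hD adj A X

lemma leftInduced_app (hD : D.IsDerivator) (adj : Bicategory.Adjunction H (D.resMor k))
    (A : (Cat.{w, w})ᵒᵖ) (X : D.val (M × A.unop)) :
    LeftInduced (D.res (k.prod (𝟭 A.unop))) ((H.app A).toFunctor.obj X) := by
  have := isIso_unit_resMor hD adj A X
  exact LeftInduced.of_isIso_unit (adjunctionApp adj A) X

lemma rightInduced_app (hD : D.IsDerivator) (adj : Bicategory.Adjunction (D.resMor k) H)
    (A : (Cat.{w, w})ᵒᵖ) (X : D.val (M × A.unop)) :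
    RightInduced (D.res (k.prod (𝟭 A.unop))) ((H.app A).toFunctor.obj X) := by
  have := isIso_counit_resMor hD adj A X
  exact RightInduced.of_isIso_counit (adjunctionApp adj A) X

end KanMorphisms

/-! ### The suspension of a shifted prederivator -/

section ShiftedSuspension

variable {M A A' : Type w} [Category.{w} M] [Category.{w} A] [Category.{w} A']

variable (M A) in
/-- The restriction to the span shape of squares in `D^M`. -/
abbrev spanFunctor : M × (SpanShape.{w} × A) ⥤ M × (Square.{w} × A) :=
  (𝟭 M).prod (spanIncl.prod (𝟭 A))

/-- The initial object of the span shape. -/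
abbrev spanZero : SpanShape.{w} := ⟨⟨0, 0⟩, by simp⟩

variable (M A) in
/-- The evaluation of spans in `D^M` at the initial object. -/
abbrev spanEvalFunctor : M × A ⥤ M × (SpanShape.{w} × A) :=
  (𝟭 M).prod (CategoryTheory.Prod.sectR spanZero A)

lemma eq_spanZero_of_le {p : SpanShape.{w}} (h : p ≤ spanZero) : p = spanZero :=
  le_antisymm h ⟨Fin.zero_le _, Fin.zero_le _⟩

/-- The square at `m` and `a` of a diagram of squares. -/
abbrev squareAt (m : M) (a : A) : Square.{w} ⥤ M × (Square.{w} × A) :=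
  CategoryTheory.Prod.sectL Square.{w} a ⋙ CategoryTheory.Prod.sectR m (Square.{w} × A)

lemma leftInduced_spanFunctor_iff (hD : D.IsDerivator) (Y : D.val (M × (Square.{w} × A))) :
    LeftInduced (D.res (spanFunctor M A)) Y ↔
      ∀ (m : M) (a : A), LeftInduced (D.res spanIncl) ((D.res (squareAt m a)).obj Y) := by
  rw [leftInduced_id_prod_iff hD]
  refine forall_congr' fun m => ?_
  rw [leftInduced_prod_id_iff hD]
  refine forall_congr' fun a => ?_
  exact ⟨LeftInduced.of_iso (D.resComp _ _ Y).symm, LeftInduced.of_iso (D.resComp _ _ Y)⟩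

lemma leftInduced_spanFunctor_res (hD : D.IsDerivator) (f : A' ⥤ A)
    {Y : D.val (M × (Square.{w} × A))} (h : LeftInduced (D.res (spanFunctor M A)) Y) :
    LeftInduced (D.res (spanFunctor M A'))
      ((D.res ((𝟭 M).prod ((𝟭 Square.{w}).prod f))).obj Y) := by
  rw [leftInduced_spanFunctor_iff hD] at h ⊢
  intro m a
  have e : squareAt m a ⋙ (𝟭 M).prod ((𝟭 Square.{w}).prod f) = squareAt m (f.obj a) :=
    Functor.hext (fun _ => rfl)
      (fun _ _ _ => heq_of_eq (Prod.ext rfl (Prod.ext rfl (f.map_id a))))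
  exact (h m (f.obj a)).of_iso (eqToIso (by rw [e]) ≪≫ D.resComp _ _ Y)

lemma full_spanFunctor : (spanFunctor M A).Full := by
  have := full_of_reflects spanIncl_reflects
  have := full_prod_id spanIncl.{w} (A := A)
  exact full_id_prod _

lemma faithful_spanFunctor : (spanFunctor M A).Faithful := by
  have := faithful_of_poset spanIncl.{w}
  have := faithful_prod_id spanIncl.{w} (A := A)
  exact faithful_id_prod _

lemma full_spanEvalFunctor : (spanEvalFunctor M A).Full where
  map_surjective f := ⟨(f.1, f.2.2), Prod.ext rfl (Prod.ext (Subsingleton.elim _ _) rfl)⟩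

lemma faithful_spanEvalFunctor : (spanEvalFunctor M A).Faithful where
  map_injective h := by
    have h₁ := congrArg Prod.fst h
    have h₂ := congrArg (fun t => t.2.2) h
    exact Prod.ext h₁ h₂

/-- `(0,0)` is the least element of the corner, so the evaluation functor is the inclusion of a
sieve and right extension along it is extension by zero. -/
lemma rightInduced_spanEvalFunctor_iff (hD : D.IsStableDerivator)
    (Y : D.val (M × (SpanShape.{w} × A))) :
    RightInduced (D.res (spanEvalFunctor M A)) Y ↔
      ∀ b, b.2.1 ≠ spanZero → Limits.IsZero (valueAt Y b) := by
  have := full_spanEvalFunctor (M := M) (A := A)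
  have := faithful_spanEvalFunctor (M := M) (A := A)
  have h : ∀ b, (∃ a, (spanEvalFunctor M A).obj a = b) ↔ b.2.1 = spanZero := fun b =>
    ⟨by rintro ⟨a, rfl⟩; rfl, fun h => ⟨(b.1, b.2.2), Prod.ext rfl (Prod.ext h.symm rfl)⟩⟩
  rw [rightInduced_iff_isZero hD]
  · exact forall_congr' fun b => by rw [h]
  · intro b
    rw [h, or_iff_not_imp_left]
    exact fun hb => ⟨fun x => hb (eq_spanZero_of_le (leOfHom x.hom.2.1))⟩

/-- The suspension morphism of a shifted stable derivator exists. -/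
theorem exists_isSuspension_shift (hD : D.IsStableDerivator) (M : Type w) [Category.{w} M] :
    ∃ S, (D.shift M).IsSuspension S := by
  obtain ⟨H, hH⟩ := exists_leftAdjoint ((D.shift M).resMor spanIncl.{w})
    (fun A (Y : D.val (M × (Square.{w} × A.unop))) => LeftInduced (D.res (spanFunctor M A.unop)) Y)
    (fun h => h)
    (fun f _ h => leftInduced_spanFunctor_res hD.toIsDerivator f.unop.toFunctor h)
    (fun {A} Y => by
      have := full_spanFunctor (M := M) (A := A.unop)
      have := faithful_spanFunctor (M := M) (A := A.unop)
      exact exists_leftInduced (spanFunctor M A.unop) hD.toIsDerivator Y)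
  obtain ⟨G, hG⟩ := exists_rightAdjoint ((D.shift M).evalMor spanZero.{w})
    (fun A (Y : D.val (M × (SpanShape.{w} × A.unop))) =>
      ∀ b : M × (SpanShape.{w} × A.unop), b.2.1 ≠ spanZero → Limits.IsZero (valueAt Y b))
    (fun {A Y} h => (rightInduced_spanEvalFunctor_iff hD _).2 h)
    (fun {A A'} f Y h b hb => (h (b.1, (b.2.1, f.unop.toFunctor.obj b.2.2)) hb).of_iso
      (resPt ((𝟭 M).prod ((𝟭 SpanShape.{w}).prod f.unop.toFunctor)) b Y))
    (fun {A} Y => by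
      have := full_spanEvalFunctor (M := M) (A := A.unop)
      have := faithful_spanEvalFunctor (M := M) (A := A.unop)
      obtain ⟨X, hX, e⟩ := exists_rightInduced (spanEvalFunctor M A.unop) hD.toIsDerivator Y
      exact ⟨X, (rightInduced_spanEvalFunctor_iff hD X).1 hX, e⟩)
  exact ⟨_, G, H, hG, hH, ⟨Iso.refl _⟩⟩

end ShiftedSuspension

end Prederivator

/-! ### The inclusions between `A_n`, `K_1`, `K_2`, `K_3` and `M_n` -/

namespace Mesh

variable (n : ℕ)

lemma i₁_reflects (a a' : LinQuiver.{w} n) (h : (i₁ n).obj a ≤ (i₁ n).obj a') : a ≤ a' := by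
  have h' := ((le_def _ _).1 h).2
  change (0 : ℤ) + a.l ≤ 0 + a'.l at h'
  change a.l ≤ a'.l
  omega

lemma i₂_reflects (a a' : {p : Mesh.{w} n // InK₁ p}) (h : (i₂ n).obj a ≤ (i₂ n).obj a') :
    a ≤ a' := h

lemma i₃_reflects (a a' : {p : Mesh.{w} n // InK₂ p}) (h : (i₃ n).obj a ≤ (i₃ n).obj a') :
    a ≤ a' := h

lemma i₄_reflects (a a' : {p : Mesh.{w} n // InK₃ p}) (h : (i₄ n).obj a ≤ (i₄ n).obj a') :
    a ≤ a' := h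

instance : (i₁.{w} n).Full := Prederivator.full_of_reflects (i₁_reflects n)
instance : (i₂.{w} n).Full := Prederivator.full_of_reflects (i₂_reflects n)
instance : (i₃.{w} n).Full := Prederivator.full_of_reflects (i₃_reflects n)
instance : (i₄.{w} n).Full := Prederivator.full_of_reflects (i₄_reflects n)

/-- The square `(0, l), (0, n + 1), (l, 0), (l, n + 1 - l)` in `K₂`, as a functor of `l`. -/
noncomputable def linSusp : LinQuiver.{w} n × Square.{w} ⥤ {p : Mesh.{w} n // InK₂ p} where
  obj m := ⟨(susp n).obj (((i₁ n).obj m.1).1, m.2), by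
    have h1 := m.1.one_le
    have h2 := m.1.le_n
    simp only [susp, i₁, Monotone.functor, InK₂, InK₁]
    split_ifs <;> omega⟩
  map f := homOfLE ((susp n).map (Prod.mkHom ((i₁ n).map f.1) f.2)).le
  map_id _ := Subsingleton.elim _ _
  map_comp _ _ := Subsingleton.elim _ _

lemma sectL_zero_linSusp :
    CategoryTheory.Prod.sectL (LinQuiver.{w} n) (⟨0, 0⟩ : Square.{w}) ⋙ linSusp n =
      i₁ n ⋙ i₂ n := by
  refine Prederivator.functor_ext_of_poset fun a => ?_
  apply Subtype.ext
  ext <;> simp [linSusp, i₁, i₂, susp, Monotone.functor]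

/-- Since `l ≥ 1`, the point `(l, n + 1 - l)` already lies in `K_2`. This is why the last two
extensions in `F` are invisible to `j^*`. -/
lemma sectL_one_linSusp :
    (CategoryTheory.Prod.sectL (LinQuiver.{w} n) (⟨1, 1⟩ : Square.{w}) ⋙ linSusp n) ⋙
      i₃ n ⋙ i₄ n = j n := by
  refine Prederivator.functor_ext_of_poset fun a => ?_
  ext <;> simp [linSusp, i₁, i₃, i₄, j, susp, Monotone.functor]

/-- A boundary point of `K_1` is never below some `(0, l)` with `l ≤ n`: either it has `k > 0`, or
it is `(k, n + 1)` with `k ≥ 0` and its sum of coordinates exceeds `n`. -/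
lemma i₁_sieve (b : {p : Mesh.{w} n // InK₁ p}) :
    (∃ a, (i₁ n).obj a = b) ∨ IsEmpty (Prederivator.SliceRight b (i₁ n)) := by
  by_cases hb : b.1.k = 0 ∧ 1 ≤ b.1.l ∧ b.1.l ≤ n
  · exact Or.inl ⟨⟨b.1.l, hb.2.1, hb.2.2⟩, Subtype.ext (Mesh.ext hb.1.symm rfl)⟩
  · refine Or.inr ⟨fun x => ?_⟩
    obtain ⟨h1, h2⟩ := (le_def _ _).1 (leOfHom x.hom : b ≤ (i₁ n).obj x.right)
    change b.1.k ≤ 0 at h1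
    change b.1.k + b.1.l ≤ 0 + x.right.l at h2
    have h3 := x.right.le_n
    have h4 : InK₁ b.1 := b.2
    unfold InK₁ at h4
    omega

lemma exists_i₁_iff (b : {p : Mesh.{w} n // InK₁ p}) :
    (∃ a, (i₁ n).obj a = b) ↔ b.1.l ≠ 0 ∧ b.1.l ≠ n + 1 := by
  constructor
  · rintro ⟨a, rfl⟩
    have h1 := a.one_le
    have h2 := a.le_n
    change a.l ≠ 0 ∧ a.l ≠ n + 1
    omega
  · intro h
    have h1 : InK₁ b.1 := b.2
    unfold InK₁ at h1
    exact ⟨⟨b.1.l, by omega, by omega⟩, Subtype.ext (Mesh.ext (by change 0 = b.1.k; omega) rfl)⟩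

end Mesh

/-! ### The suspension of `D^{A_n}` -/

namespace Prederivator

variable {D : Prederivator.{w, v, u}} {n : ℕ}

/-- Extensions by zero along `i₁` vanish at the `(k, 0)` and the `(k, n + 1)`. -/
lemma isZero_of_rightInduced_i₁ (hD : D.IsStableDerivator) {A : Type w} [Category.{w} A]
    {Y : D.val ({p : Mesh.{w} n // Mesh.InK₁ p} × A)}
    (h : RightInduced (D.res ((Mesh.i₁ n).prod (𝟭 A))) Y) (b : {p : Mesh.{w} n // Mesh.InK₁ p})
    (hb : b.1.l = 0 ∨ b.1.l = n + 1) (a : A) : Limits.IsZero (valueAt Y (b, a)) := by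
  rw [rightInduced_prod_id_iff hD.toIsDerivator] at h
  have := faithful_of_poset (Mesh.i₁.{w} n)
  have h := (rightInduced_iff_isZero hD (Mesh.i₁ n) (Mesh.i₁_sieve n) _).1 (h a) b (by
    rw [Mesh.exists_i₁_iff]
    omega)
  exact h.of_iso (resPt (CategoryTheory.Prod.sectL _ a) b Y).symm

/-- Left Kan extensions along `i₂` compute the suspension. -/
lemma cocartAt_of_leftInduced_i₂ (hD : D.IsDerivator)
    {Y : D.val {p : Mesh.{w} n // Mesh.InK₂ p}} (h : LeftInduced (D.res (Mesh.i₂ n)) Y)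
    (l : LinQuiver.{w} n) :
    CocartAt (CategoryTheory.Prod.sectR l Square.{w} ⋙ Mesh.linSusp n) Y := by
  have h1 := l.one_le
  have h2 := l.le_n
  rw [leftInduced_iff_of_reflects hD (Mesh.i₂_reflects n)] at h
  refine (isColim_slice_iff_cocartAt (Mesh.i₂_reflects n)
    (CategoryTheory.Prod.sectR l Square.{w} ⋙ Mesh.linSusp n) ?_ ?_ ?_ Y).1 (h _ ?_)
  · rintro ⟨x, y⟩ hs
    refine ⟨⟨((CategoryTheory.Prod.sectR l Square.{w} ⋙ Mesh.linSusp n).obj ⟨x, y⟩).1, ?_⟩, rfl⟩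
    fin_cases x <;> fin_cases y <;>
      simp [Mesh.linSusp, Mesh.susp, Mesh.i₁, Monotone.functor, Mesh.InK₁] at hs ⊢ <;> omega
  -- An element of `K_1` below `(l, n + 1 - l)` either has `k = 0`, and is below `(0, n + 1)`, or is
  -- some `(k, 0)` with `k ≤ l`, and is below `(l, 0)`.
  · intro a ha
    obtain ⟨h3, h4⟩ := (Mesh.le_def _ _).1 ha
    have h5 : Mesh.InK₁ a.1 := a.2
    change a.1 ≤ _ ∨ a.1 ≤ _
    rw [Mesh.le_def, Mesh.le_def]
    simp [Mesh.linSusp, Mesh.susp, Mesh.i₁, Mesh.i₂, Monotone.functor, Mesh.InK₁] at h3 h4 h5 ⊢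
    omega
  -- Below `(0, n + 1)` the first coordinate is at most `0`, and below `(l, 0)` the sum of the
  -- coordinates is at most `l`; together this means below `(0, l)`.
  · intro a ha ha'
    obtain ⟨h3, h4⟩ := (Mesh.le_def _ _).1 ha
    obtain ⟨h3', h4'⟩ := (Mesh.le_def _ _).1 ha'
    change a.1 ≤ _
    rw [Mesh.le_def]
    simp [Mesh.linSusp, Mesh.susp, Mesh.i₁, Mesh.i₂, Monotone.functor] at h3 h4 h3' h4' ⊢
    omega
  · rintro ⟨a, ha⟩
    have h3 := congrArg (fun t => t.1.k) ha
    have h4 := congrArg (fun t => t.1.l) ha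
    have h5 : Mesh.InK₁ a.1 := a.2
    simp [Mesh.linSusp, Mesh.susp, Mesh.i₁, Mesh.i₂, Monotone.functor, Mesh.InK₁] at h3 h4 h5
    omega

/-- The morphism `F` exists. -/
theorem exists_isMeshExtension (hD : D.IsDerivator) (n : ℕ) : ∃ F, D.IsMeshExtension n F := by
  have := faithful_of_poset (Mesh.i₁.{w} n)
  have := faithful_of_poset (Mesh.i₂.{w} n)
  have := faithful_of_poset (Mesh.i₃.{w} n)
  have := faithful_of_poset (Mesh.i₄.{w} n)
  obtain ⟨E₁, h₁⟩ := exists_rightAdjoint_resMor hD (Mesh.i₁.{w} n)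
  obtain ⟨E₂, h₂⟩ := exists_leftAdjoint_resMor hD (Mesh.i₂.{w} n)
  obtain ⟨E₃, h₃⟩ := exists_leftAdjoint_resMor hD (Mesh.i₃.{w} n)
  obtain ⟨E₄, h₄⟩ := exists_rightAdjoint_resMor hD (Mesh.i₄.{w} n)
  exact ⟨_, E₁, E₂, E₃, E₄, h₁, h₂, h₃, h₄, ⟨Iso.refl _⟩⟩

/-- Isomorphisms cancelling a retraction in the middle of a composite. -/
lemma nonempty_iso_cancel {𝓑 : Type*} [Bicategory 𝓑] {a b c d : 𝓑} {f : a ⟶ b} {g : b ⟶ c}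
    {g' : c ⟶ b} {h : b ⟶ d} (e : g ≫ g' ≅ 𝟙 b) : Nonempty ((f ≫ g) ≫ g' ≫ h ≅ f ≫ h) :=
  ⟨α_ _ _ _ ≪≫ Bicategory.whiskerLeftIso f ((α_ _ _ _).symm ≪≫
    Bicategory.whiskerRightIso e h ≪≫ λ_ h)⟩

/-- The suspension of `D^{A_n}` is computed by the mesh extension. -/
theorem nonempty_iso_of_isMeshExtension (hD : D.IsStableDerivator)
    (F : (D.shift (LinQuiver.{w} n)).toPseudofunctor ⟶ (D.shift (Mesh.{w} n)).toPseudofunctor)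
    (S : (D.shift (LinQuiver.{w} n)).toPseudofunctor ⟶
      (D.shift (LinQuiver.{w} n)).toPseudofunctor)
    (hF : D.IsMeshExtension n F) (hS : (D.shift (LinQuiver.{w} n)).IsSuspension S) :
    Nonempty (S ≅ F ≫ D.resMor (Mesh.j n)) := by
  have hD' := hD.toIsDerivator
  have := faithful_of_poset (Mesh.i₁.{w} n)
  have := faithful_of_poset (Mesh.i₂.{w} n)
  have := faithful_of_poset (Mesh.i₃.{w} n)
  have := faithful_of_poset (Mesh.i₄.{w} n)
  obtain ⟨E₁, E₂, E₃, E₄, ⟨adj₁⟩, ⟨adj₂⟩, ⟨adj₃⟩, ⟨adj₄⟩, ⟨eF⟩⟩ := hF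
  obtain ⟨e₁⟩ := nonempty_iso_of_right hD' adj₁
  obtain ⟨e₂⟩ := nonempty_iso_of_left hD' adj₂
  obtain ⟨e₃⟩ := nonempty_iso_of_left hD' adj₃
  obtain ⟨e₄⟩ := nonempty_iso_of_right hD' adj₄
  -- The suspension squares already live on `K_2`, before the last two extensions.
  let T := (E₁ ≫ E₂) ≫ D.resMor₂ (Mesh.linSusp n)
  have hθ : Nonempty (T ≫ (D.shift (LinQuiver.{w} n)).evalMor (B := Square.{w}) ⟨0, 0⟩ ≅ 𝟙 _) := by
    have h := D.resMor₂_evalMor (Mesh.linSusp.{w} n) (⟨0, 0⟩ : Square.{w})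
    rw [Mesh.sectL_zero_linSusp, ← D.resMor_comp] at h
    obtain ⟨i⟩ := nonempty_iso_cancel (f := E₁) (h := D.resMor (Mesh.i₁ n)) e₂
    exact ⟨α_ _ _ _ ≪≫ Bicategory.whiskerLeftIso _ (eqToIso h) ≪≫ i ≪≫ e₁⟩
  obtain ⟨θ⟩ := hθ
  have hE : ∀ (A : (Cat.{w, w})ᵒᵖ) (X : D.val (LinQuiver.{w} n × A.unop)),
      LeftInduced (D.res ((Mesh.i₂ n).prod (𝟭 A.unop)))
        (((E₁ ≫ E₂).app A).toFunctor.obj X) := fun A X =>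
    leftInduced_app hD' adj₂ A ((E₁.app A).toFunctor.obj X)
  -- Extension along `i_2` followed by restriction returns the value of `E₁`, up to the invertible
  -- unit, and that value is an extension by zero.
  have hE' : ∀ (A : (Cat.{w, w})ᵒᵖ) (X : D.val (LinQuiver.{w} n × A.unop)),
      RightInduced (D.res ((Mesh.i₁ n).prod (𝟭 A.unop)))
        ((D.res ((Mesh.i₂ n).prod (𝟭 A.unop))).obj (((E₁ ≫ E₂).app A).toFunctor.obj X)) := by
    intro A X
    have := isIso_unit_resMor hD' adj₂ A ((E₁.app A).toFunctor.obj X)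
    exact (rightInduced_app hD' adj₁ A X).of_iso
      (@asIso _ _ _ _ ((adjunctionApp adj₂ A).unit.app ((E₁.app A).toFunctor.obj X)) this)
  have key : Nonempty (S ≅ T ≫ (D.shift (LinQuiver.{w} n)).evalMor (B := Square.{w}) ⟨1, 1⟩) := by
    refine nonempty_iso_of_isSuspension T θ (fun A X => ?_) (fun A X => ?_) S hS
    · refine (leftInduced_spanFunctor_iff hD' (A := A.unop) _).2 fun l a => ?_
      have h := (leftInduced_prod_id_iff hD' _ _).1 (hE A X) a
      have h := (cocartAt_iff_leftInduced hD' _ _).1 (cocartAt_of_leftInduced_i₂ hD' h l)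
      refine h.of_iso ?_
      exact D.resComp₂ (k := CategoryTheory.Prod.sectR l Square.{w} ⋙ Mesh.linSusp n)
        (k' := CategoryTheory.Prod.sectL _ a) (l := squareAt l a)
        (l' := prodFunctor (Mesh.linSusp n) A.unop) rfl _
    · refine (rightInduced_spanEvalFunctor_iff hD (A := A.unop) _).2 ?_
      rintro ⟨l, p, a⟩ hp
      have h1 := l.one_le
      have h2 := l.le_n
      have hp' : p.1 = ⟨1, 0⟩ ∨ p.1 = ⟨0, 1⟩ := by
        obtain ⟨⟨x, y⟩, hs⟩ := p
        fin_cases x <;> fin_cases y <;> simp [spanZero] at hs hp ⊢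
      -- The arms of the square are `(0, n + 1)` and `(l, 0)`: boundary points of `K_1`.
      have hb : Mesh.InK₁ ((Mesh.linSusp n).obj (l, p.1)).1 ∧
          (((Mesh.linSusp n).obj (l, p.1)).1.l = 0 ∨
            ((Mesh.linSusp n).obj (l, p.1)).1.l = n + 1) := by
        rcases hp' with h | h <;> rw [h] <;>
          simp [Mesh.linSusp, Mesh.susp, Mesh.i₁, Monotone.functor, Mesh.InK₁] <;> omega
      have h := isZero_of_rightInduced_i₁ hD (hE' A X) ⟨_, hb.1⟩ hb.2 a
      refine h.of_iso ?_
      refine resPt (spanFunctor (LinQuiver.{w} n) A.unop) (l, (p, a)) _ ≪≫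
        resPt (prodFunctor (Mesh.linSusp n) A.unop) (l, (p.1, a)) _ ≪≫
        (resPt ((Mesh.i₂ n).prod (𝟭 A.unop)) (⟨_, hb.1⟩, a) _).symm
  obtain ⟨e⟩ := key
  have h := D.resMor₂_evalMor (Mesh.linSusp.{w} n) (⟨1, 1⟩ : Square.{w})
  -- As `i_3` and `i_4` are fully faithful, extending by `E₃` and `E₄` and restricting back is
  -- isomorphic to the identity, so both may be inserted in front of the restriction.
  obtain ⟨i⟩ := nonempty_iso_cancel (f := E₁ ≫ E₂) (h := D.resMor
    (CategoryTheory.Prod.sectL (LinQuiver.{w} n) (⟨1, 1⟩ : Square.{w}) ⋙ Mesh.linSusp n)) e₃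
  obtain ⟨i'⟩ := nonempty_iso_cancel (f := (E₁ ≫ E₂) ≫ E₃) (h := D.resMor (Mesh.i₃.{w} n) ≫
    D.resMor (CategoryTheory.Prod.sectL (LinQuiver.{w} n) (⟨1, 1⟩ : Square.{w}) ⋙
      Mesh.linSusp n)) e₄
  have hj : D.resMor (Mesh.j n) = D.resMor (Mesh.i₄.{w} n) ≫ D.resMor (Mesh.i₃.{w} n) ≫
    D.resMor (CategoryTheory.Prod.sectL (LinQuiver.{w} n) (⟨1, 1⟩ : Square.{w}) ⋙
      Mesh.linSusp n) := by
    rw [resMor_comp, resMor_comp, ← Mesh.sectL_one_linSusp]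
    rfl
  have eF' : F ≅ ((E₁ ≫ E₂) ≫ E₃) ≫ E₄ :=
    eF ≪≫ (α_ _ _ _).symm ≪≫ (α_ _ _ _).symm
  exact ⟨e ≪≫ α_ _ _ _ ≪≫ Bicategory.whiskerLeftIso _ (eqToIso h) ≪≫ i.symm ≪≫ i'.symm ≪≫
    Bicategory.whiskerRightIso eF'.symm _ ≪≫ Bicategory.whiskerLeftIso F (eqToIso hj.symm)⟩

end Prederivator

/-! ### The inverse of the flip -/

namespace Mesh

variable {n : ℕ}

/-- The inverse of the flip symmetry. -/
noncomputable def flipInv (n : ℕ) : Mesh.{w} n ⥤ Mesh.{w} n :=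
  Monotone.functor (f := fun p =>
    { k := p.k + p.l - n - 1
      l := n + 1 - p.l
      nonneg := by have := p.le_succ; omega
      le_succ := by have := p.nonneg; omega }) (by
    intro p q h
    rw [le_def] at h ⊢
    dsimp only
    omega)

lemma flip_flipInv : flip.{w} n ⋙ flipInv n = 𝟭 _ := by
  refine Prederivator.functor_ext_of_poset fun p => ?_
  ext <;> simp [flip, flipInv, Monotone.functor]
  omega

lemma flipInv_flip : flipInv.{w} n ⋙ flip n = 𝟭 _ := by
  refine Prederivator.functor_ext_of_poset fun p => ?_
  ext <;> simp [flip, flipInv, Monotone.functor]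
  omega

lemma rect_flipInv (p₀ p₁ q₀ q₁ : ℤ) (hp : p₀ ≤ p₁) (hq : q₀ ≤ q₁) (h : p₁ ≤ q₀)
    (h' : q₁ ≤ p₀ + n + 1) : rect.{w} n p₀ p₁ q₀ q₁ hp hq h h' ⋙ flipInv n =
      Prederivator.squareSwap ⋙ rect n (q₀ - n - 1) (q₁ - n - 1) p₀ p₁ (by omega) hp (by omega)
        (by omega) := by
  refine Prederivator.functor_ext_of_poset ?_
  rintro ⟨x, y⟩
  fin_cases x <;> fin_cases y <;>
    ext <;> simp [flipInv, rect, Monotone.functor, Prederivator.squareSwap] <;> omega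

end Mesh

/-! ### Induced objects of full subcategories -/

section FullSubcategory

variable {𝒞 𝒟 : Type u} [Category.{v} 𝒞] [Category.{v} 𝒟] {P : ObjectProperty 𝒞}
  {P' : ObjectProperty 𝒟}

/-- Full subcategories have the hom-sets of the ambient category, so induced objects remain induced
when they lie in the subcategory. -/
lemma bijective_map_of_full {Φ : P.FullSubcategory ⥤ P'.FullSubcategory} {Ψ : 𝒞 ⥤ 𝒟}
    (h : Φ ⋙ P'.ι = P.ι ⋙ Ψ) {X Y : P.FullSubcategory}
    (hb : Function.Bijective (fun g : X.obj ⟶ Y.obj => Ψ.map g)) :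
    Function.Bijective (fun g : X ⟶ Y => Φ.map g) := by
  have h1 : Function.Bijective (fun g : X ⟶ Y => (P.ι ⋙ Ψ).map g) :=
    hb.comp ((ObjectProperty.fullyFaithfulι P).map_bijective X Y)
  rw [← h] at h1
  exact (bijective_comp_iff_left ((ObjectProperty.fullyFaithfulι P').map_bijective _ _)
    (fun g : X ⟶ Y => Φ.map g)).1 h1

lemma leftInduced_of_full {Φ : P.FullSubcategory ⥤ P'.FullSubcategory} {Ψ : 𝒞 ⥤ 𝒟}
    (h : Φ ⋙ P'.ι = P.ι ⋙ Ψ) {Y : P.FullSubcategory} (hY : LeftInduced Ψ Y.obj) :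
    LeftInduced Φ Y :=
  fun Z => bijective_map_of_full h (hY Z.obj)

lemma rightInduced_of_full {Φ : P.FullSubcategory ⥤ P'.FullSubcategory} {Ψ : 𝒞 ⥤ 𝒟}
    (h : Φ ⋙ P'.ι = P.ι ⋙ Ψ) {Y : P.FullSubcategory} (hY : RightInduced Ψ Y.obj) :
    RightInduced Φ Y :=
  fun Z => bijective_map_of_full h (hY Z.obj)

end FullSubcategory

namespace Prederivator

variable {D : Prederivator.{w, v, u}} {n : ℕ}

lemma MeshExactAt.flipInv (hD : D.IsDerivator) {Y : D.val (Mesh.{w} n)}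
    (hY : D.MeshExactAt n Y) : D.MeshExactAt n ((D.res (Mesh.flipInv n)).obj Y) := by
  refine ⟨fun m hm => ?_, fun k l h₁ h₂ => ?_⟩
  · refine (hY.1 ((Mesh.flipInv n).obj m) ?_).of_iso (resPt (Mesh.flipInv n) m Y)
    change n + 1 - m.l = 0 ∨ n + 1 - m.l = n + 1
    omega
  · rw [cocartAt_res_iff, Mesh.square_eq_rect, Mesh.rect_flipInv, cocartAt_swap_iff hD]
    exact hY.cocartAt_rect hD (by omega) (by omega) _ _

/-! ### Extensions of exact diagrams -/

section Extensions

variable {A A' : Type w} [Category.{w} A] [Category.{w} A']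

lemma MeshExact.of_iso (hD : D.IsStableDerivator) {A : (Cat.{w, w})ᵒᵖ}
    {X X' : D.val (Mesh.{w} n × A.unop)} (e : X ≅ X') (h : D.MeshExact n A X) :
    D.MeshExact n A X' :=
  (meshExact_iff hD A X').2 fun a =>
    ((meshExact_iff hD A X).1 h a).of_iso hD.toIsDerivator ((D.res _).mapIso e)

/-- Exactness is pointwise in the parameter, so only the behaviour of `k` on each slice `M_n × {a}`
matters: an exactness-preserving self-map of `M_n` followed by the inclusion at some `b`. -/
lemma meshExact_res (hD : D.IsStableDerivator) (k : Mesh.{w} n × A' ⥤ Mesh.{w} n × A)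
    {X : D.val (Mesh.{w} n × A)} (h : D.MeshExact n (op (Cat.of A)) X)
    (hk : ∀ a, ∃ (r : Mesh.{w} n ⥤ Mesh.{w} n) (b : A),
      CategoryTheory.Prod.sectL (Mesh.{w} n) a ⋙ k = r ⋙ CategoryTheory.Prod.sectL (Mesh.{w} n) b ∧
      ∀ {Y : D.val (Mesh.{w} n)}, D.MeshExactAt n Y → D.MeshExactAt n ((D.res r).obj Y)) :
    D.MeshExact n (op (Cat.of A')) ((D.res k).obj X) := by
  refine (meshExact_iff hD (op (Cat.of A')) _).2 fun a => ?_
  obtain ⟨r, b, e, hr⟩ := hk a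
  exact (hr ((meshExact_iff hD (op (Cat.of A)) X).1 h b)).of_iso hD.toIsDerivator
    (D.resComp₂ e.symm X)

/-- Exactness of induced squares of exact diagrams. -/
theorem meshExact_of_leftInduced (hD : D.IsStableDerivator)
    {Y : D.val (Mesh.{w} n × (Square.{w} × A))}
    (h : LeftInduced (D.res (spanFunctor (Mesh.{w} n) A)) Y)
    (hY : D.MeshExact n (op (Cat.of (SpanShape.{w} × A)))
      ((D.res (spanFunctor (Mesh.{w} n) A)).obj Y)) :
    D.MeshExact n (op (Cat.of (Square.{w} × A))) Y := by
  have hD' := hD.toIsDerivator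
  refine (meshExact_iff hD (op (Cat.of (Square.{w} × A))) Y).2 ?_
  rintro ⟨s, a⟩
  have hY : ∀ p : SpanShape.{w}, D.MeshExactAt n
      ((D.res (CategoryTheory.Prod.sectL (Mesh.{w} n) (p.1, a))).obj Y) := fun p =>
    ((meshExact_iff hD (op (Cat.of (SpanShape.{w} × A))) _).1 hY (p, a)).of_iso hD'
      (D.resComp (CategoryTheory.Prod.sectL (Mesh.{w} n) (p, a)) (spanFunctor (Mesh.{w} n) A)
        Y).symm
  rw [leftInduced_spanFunctor_iff hD'] at h
  refine ⟨fun m hm => ?_, fun k l h₁ h₂ => ?_⟩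
  -- At a boundary point `m` the corner vanishes, and a square induced from a zero corner is zero.
  · have h0 : Limits.IsZero ((D.res (squareAt m a)).obj Y) := by
      refine isZero_of_leftInduced hD (h m a) ((isZero_iff_valueAt hD _).2 fun p => ?_)
      refine ((hY p).1 m hm).of_iso ?_
      exact resPt spanIncl p _ ≪≫ resPt (squareAt m a) p.1 Y ≪≫
        (resPt (CategoryTheory.Prod.sectL (Mesh.{w} n) (p.1, a)) m Y).symm
    refine ((isZero_iff_valueAt hD _).1 h0 s).of_iso ?_
    exact resPt (CategoryTheory.Prod.sectL (Mesh.{w} n) (s, a)) m Y ≪≫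
      (resPt (squareAt m a) s Y).symm
  -- `V` is a square of squares: the mesh square in the first variable, the given square in the
  -- second. It is induced in the second variable, and over the corner of the second variable also
  -- in the first; the aim is to have it induced in the first variable everywhere.
  · let e := Mesh.square.{w} n k l h₁ h₂
    let r : Square.{w} × Square.{w} ⥤ Mesh.{w} n × (Square.{w} × A) :=
      e.prod (CategoryTheory.Prod.sectL Square.{w} a)
    let V := (D.res r).obj Y
    have hV : LeftInduced (D.res ((𝟭 Square.{w}).prod spanIncl.{w})) V := by
      rw [leftInduced_id_prod_iff hD']
      intro t
      have e' : CategoryTheory.Prod.sectR t Square.{w} ⋙ r = squareAt (e.obj t) a :=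
        Functor.hext (fun _ => rfl) (fun _ _ _ => heq_of_eq (Prod.ext (e.map_id t) rfl))
      exact (h (e.obj t) a).of_iso
        (eqToIso (by rw [e']) ≪≫ D.resComp (CategoryTheory.Prod.sectR t _) r Y)
    have hV₁ : LeftInduced (D.res (spanIncl.{w}.prod (𝟭 SpanShape.{w})))
        ((D.res ((𝟭 Square.{w}).prod spanIncl.{w})).obj V) := by
      rw [leftInduced_prod_id_iff hD']
      intro p
      have h1 := (cocartAt_iff_leftInduced hD' _ _).1 ((hY p).2 k l h₁ h₂)
      refine h1.of_iso ?_
      exact D.resComp₂ (k := e) (k' := CategoryTheory.Prod.sectL (Mesh.{w} n) (p.1, a))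
        (l := CategoryTheory.Prod.sectL Square.{w} p.1) (l' := r) rfl Y ≪≫
        D.resComp (CategoryTheory.Prod.sectL Square.{w} p) ((𝟭 Square.{w}).prod spanIncl.{w}) V
    have hV₂ : LeftInduced (D.res ((𝟭 SpanShape.{w}).prod spanIncl.{w}))
        ((D.res (spanIncl.{w}.prod (𝟭 Square.{w}))).obj V) := by
      rw [leftInduced_id_prod_iff hD'] at hV ⊢
      intro p
      exact (hV p.1).of_iso (D.resComp (CategoryTheory.Prod.sectR p Square.{w})
        (spanIncl.{w}.prod (𝟭 Square.{w})) V)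
    -- So `V` is induced from the product of the two corners. The inclusion of this product also
    -- factors through the other variable first, and cancelling `hV₂` leaves extension in the first
    -- variable.
    have hV₃ := hV.comp hV₁
    rw [← res_comp] at hV₃
    have hV₄ : LeftInduced (D.res (spanIncl.{w}.prod (𝟭 Square.{w})) ⋙
        D.res ((𝟭 SpanShape.{w}).prod spanIncl.{w})) V := by
      rw [← res_comp]
      exact hV₃
    have hV₅ := (leftInduced_prod_id_iff hD' _ _).1 (hV₄.of_comp hV₂) s
    rw [cocartAt_iff_leftInduced hD']
    refine hV₅.of_iso ?_
    exact D.resComp₂ (k := CategoryTheory.Prod.sectL Square.{w} s) (k' := r) (l := e)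
      (l' := CategoryTheory.Prod.sectL (Mesh.{w} n) (s, a)) rfl Y

/-- Exactness of extensions by zero of exact diagrams. -/
theorem meshExact_of_isZero (hD : D.IsStableDerivator)
    {Y : D.val (Mesh.{w} n × (SpanShape.{w} × A))}
    (h : ∀ b, b.2.1 ≠ spanZero → Limits.IsZero (valueAt Y b))
    (hY : D.MeshExact n (op (Cat.of A)) ((D.res (spanEvalFunctor (Mesh.{w} n) A)).obj Y)) :
    D.MeshExact n (op (Cat.of (SpanShape.{w} × A))) Y := by
  refine (meshExact_iff hD (op (Cat.of (SpanShape.{w} × A))) Y).2 ?_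
  rintro ⟨p, a⟩
  by_cases hp : p = spanZero
  · subst hp
    exact ((meshExact_iff hD (op (Cat.of A)) _).1 hY a).of_iso hD.toIsDerivator
      (D.resComp (CategoryTheory.Prod.sectL (Mesh.{w} n) a) (spanEvalFunctor (Mesh.{w} n) A) Y).symm
  · exact meshExactAt_of_isZero hD fun m => (h (m, (p, a)) hp).of_iso
      (resPt (CategoryTheory.Prod.sectL (Mesh.{w} n) (p, a)) m Y)

end Extensions

end Prederivator

/-! ### Strict composition laws -/

section StrictComposition

variable {𝓑 : Type*} [Bicategory 𝓑] {P Q R S : Pseudofunctor 𝓑 Cat.{v, u}} {φ : P ⟶ Q} {ψ : Q ⟶ R}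
  {χ : R ⟶ S}

/-- The bicategory of pseudofunctors only supplies associators, while the restricted flip has to be
compared by equalities of morphisms; for strict transformations these hold. -/
lemma IsStrict.assoc (hφ : IsStrict φ) (hψ : IsStrict ψ) (hχ : IsStrict χ) :
    (φ ≫ ψ) ≫ χ = φ ≫ ψ ≫ χ :=
  IsStrict.ext ((hφ.comp hψ).comp hχ) (hφ.comp (hψ.comp hχ)) fun _ => rfl

lemma IsStrict.id_comp (hφ : IsStrict φ) : 𝟙 P ≫ φ = φ :=
  IsStrict.ext ((IsStrict.id P).comp hφ) hφ fun _ => rfl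

lemma IsStrict.comp_id (hφ : IsStrict φ) : φ ≫ 𝟙 Q = φ :=
  IsStrict.ext (hφ.comp (IsStrict.id Q)) hφ fun _ => rfl

end StrictComposition

namespace Prederivator

/-! ### Strict morphisms to full subprederivators -/


section FullSubprederivator

variable {E : Prederivator.{w, v, u}} {P : ∀ A : (Cat.{w, w})ᵒᵖ, ObjectProperty (E.obj A)}
  (hP : E.RestrictionStable P)

include hP in
lemma fullIncl_app_cancel (A : (Cat.{w, w})ᵒᵖ) {𝒞 : Cat.{v, u}} (s t : 𝒞 ⟶ (full hP).obj A)
    (h : s ≫ (E.fullIncl hP).app A = t ≫ (E.fullIncl hP).app A) : s = t := by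
  apply Cat.ext
  apply fullSubcategory_functor_ext
  exact congrArg Cat.Hom.toFunctor h

lemma eq_of_comp_fullIncl {F : Prederivator.{w, v, u}}
    {α β : F.toPseudofunctor ⟶ (full hP).toPseudofunctor} (hα : IsStrict α) (hβ : IsStrict β)
    (h : α ≫ E.fullIncl hP = β ≫ E.fullIncl hP) : α = β :=
  IsStrict.ext hα hβ fun A => fullIncl_app_cancel hP A _ _ (congrArg (fun t => t.app A) h)

/-- A strict morphism with values in a full subprederivator factors through the inclusion. -/
lemma exists_lift_fullIncl {F : Prederivator.{w, v, u}}
    (θ : F.toPseudofunctor ⟶ E.toPseudofunctor) (hθ : IsStrict θ)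
    (h : ∀ A X, P A ((θ.app A).toFunctor.obj X)) :
    ∃ φ : F.toPseudofunctor ⟶ (full hP).toPseudofunctor,
      IsStrict φ ∧ φ ≫ E.fullIncl hP = θ := by
  obtain ⟨φ, h1, -, h2⟩ := exists_strict_lift (E.isStrict_fullIncl hP) hθ
    (fun A => fullIncl_app_cancel hP A)
    (fun A => inferInstanceAs (P A).ι.Faithful)
    (fun A => ((P A).lift (θ.app A).toFunctor (h A)).toCatHom)
    (fun A => rfl)
  exact ⟨φ, h1, h2⟩

/-- A strict morphism with values in diagrams in a full subprederivator factors through the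
inclusion. -/
lemma exists_lift_fullInclShift {F : Prederivator.{w, v, u}} {C : Type w} [Category.{w} C]
    (θ : F.toPseudofunctor ⟶ (E.shift C).toPseudofunctor) (hθ : IsStrict θ)
    (h : ∀ (A : (Cat.{w, w})ᵒᵖ) X,
      P (op (Cat.of (C × A.unop))) ((θ.app A).toFunctor.obj X)) :
    ∃ φ : F.toPseudofunctor ⟶ ((full hP).shift C).toPseudofunctor,
      IsStrict φ ∧ φ ≫ E.fullInclShift hP C = θ := by
  obtain ⟨φ, h1, -, h2⟩ := exists_strict_lift (E.isStrict_fullInclShift (C := C) hP) hθ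
    (fun A => fullIncl_app_cancel hP (op (Cat.of (C × A.unop))))
    (fun A => inferInstanceAs (P (op (Cat.of (C × A.unop)))).ι.Faithful)
    (fun A => ((P (op (Cat.of (C × A.unop)))).lift (θ.app A).toFunctor (h A)).toCatHom)
    (fun A => rfl)
  exact ⟨φ, h1, h2⟩

lemma evalMor_comp_fullIncl {F : Prederivator.{w, v, u}} {C : Type w} [Category.{w} C]
    {T : F.toPseudofunctor ⟶ ((full hP).shift C).toPseudofunctor} (hT : IsStrict T) (c : C) :
    (T ≫ (full hP).evalMor c) ≫ E.fullIncl hP = (T ≫ E.fullInclShift hP C) ≫ E.evalMor c :=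
  IsStrict.ext ((hT.comp ((full hP).isStrict_evalMor c)).comp (E.isStrict_fullIncl hP))
    ((hT.comp (E.isStrict_fullInclShift hP)).comp (E.isStrict_evalMor c)) fun _ => rfl

end FullSubprederivator

variable {D : Prederivator.{w, v, u}} {n : ℕ}

lemma isStrictIso_resMor_flip (D : Prederivator.{w, v, u}) (n : ℕ) :
    IsStrictIso (D.resMor (Mesh.flip.{w} n)) :=
  ⟨D.resMor (Mesh.flipInv n), by rw [resMor_comp, Mesh.flipInv_flip, resMor_id],
    by rw [resMor_comp, Mesh.flip_flipInv, resMor_id]⟩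

/-! ### Flip and suspension of exact diagrams -/

section ExactDiagrams

variable (hD : D.IsStableDerivator)

include hD in
lemma meshExact_res_prod {r : Mesh.{w} n ⥤ Mesh.{w} n}
    (hr : ∀ {Y : D.val (Mesh.{w} n)}, D.MeshExactAt n Y → D.MeshExactAt n ((D.res r).obj Y))
    {A : Type w} [Category.{w} A] {X : D.val (Mesh.{w} n × A)}
    (h : D.MeshExact n (op (Cat.of A)) X) :
    D.MeshExact n (op (Cat.of A)) ((D.res (r.prod (𝟭 A))).obj X) :=
  meshExact_res hD _ h fun a => ⟨r, a, rfl, hr⟩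

include hD in
lemma meshExact_res_susp {A : Type w} [Category.{w} A] {X : D.val (Mesh.{w} n × A)}
    (h : D.MeshExact n (op (Cat.of A)) X) :
    D.MeshExact n (op (Cat.of (Square.{w} × A)))
      ((D.res (prodFunctor (Mesh.susp n) A)).obj X) :=
  meshExact_res hD _ h fun a => ⟨_, a.2, rfl, fun hY => hY.susp hD a.1⟩

/-- The flip symmetry restricts to exact diagrams. -/
theorem exists_flip_full : ∃ φ : (full (restrictionStable_meshExact hD n)).toPseudofunctor ⟶
      (full (restrictionStable_meshExact hD n)).toPseudofunctor,
    IsStrict φ ∧ φ ≫ fullIncl _ (restrictionStable_meshExact hD n) =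
      fullIncl _ (restrictionStable_meshExact hD n) ≫ D.resMor (Mesh.flip n) ∧
    IsStrictIso φ := by
  let hres := restrictionStable_meshExact hD n
  let ι := fullIncl _ hres
  have hι : IsStrict ι := isStrict_fullIncl _ hres
  obtain ⟨φ, h1, h2⟩ := exists_lift_fullIncl hres (ι ≫ D.resMor (Mesh.flip n))
    (hι.comp (D.isStrict_resMor _))
    (fun A X => meshExact_res_prod hD (fun h => h.flip hD.toIsDerivator) X.property)
  obtain ⟨ψ, h3, h4⟩ := exists_lift_fullIncl hres (ι ≫ D.resMor (Mesh.flipInv n))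
    (hι.comp (D.isStrict_resMor _))
    (fun A X => meshExact_res_prod hD (fun h => h.flipInv hD.toIsDerivator) X.property)
  -- Strict morphisms into the subprederivator are determined by their composite with the inclusion,
  -- where inverse shape functors give inverse restrictions.
  have key {α β : (full hres).toPseudofunctor ⟶ (full hres).toPseudofunctor} (hα : IsStrict α)
      (hβ : IsStrict β) {k k' : Mesh.{w} n ⥤ Mesh.{w} n} (eα : α ≫ ι = ι ≫ D.resMor k)
      (eβ : β ≫ ι = ι ≫ D.resMor k') (hk : k' ⋙ k = 𝟭 _) : α ≫ β = 𝟙 _ := by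
    refine eq_of_comp_fullIncl hres (hα.comp hβ) (IsStrict.id _) ?_
    change (α ≫ β) ≫ ι = 𝟙 _ ≫ ι
    rw [hα.assoc hβ hι, eβ, ← hα.assoc hι (D.isStrict_resMor _), eα,
      hι.assoc (D.isStrict_resMor _) (D.isStrict_resMor _)]
    erw [D.resMor_comp]
    rw [hk, resMor_id, hι.id_comp]
    exact hι.comp_id
  exact ⟨φ, h1, h2, ψ, key h1 h3 h2 h4 (Mesh.flipInv_flip), key h3 h1 h4 h2 (Mesh.flip_flipInv)⟩

/-- The suspension squares of exact diagrams. -/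
theorem exists_susp_full (φ : (full (restrictionStable_meshExact hD n)).toPseudofunctor ⟶
      (full (restrictionStable_meshExact hD n)).toPseudofunctor) (hφ : IsStrict φ)
    (h : φ ≫ fullIncl _ (restrictionStable_meshExact hD n) =
      fullIncl _ (restrictionStable_meshExact hD n) ≫ D.resMor (Mesh.flip n)) :
    ∃ T : (full (restrictionStable_meshExact hD n)).toPseudofunctor ⟶
        ((full (restrictionStable_meshExact hD n)).shift Square.{w}).toPseudofunctor,
      T ≫ fullInclShift _ (restrictionStable_meshExact hD n) Square.{w} =
        fullIncl _ (restrictionStable_meshExact hD n) ≫ D.resMor₂ (Mesh.susp n) ∧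
      T ≫ (full (restrictionStable_meshExact hD n)).evalMor (B := Square.{w}) ⟨0, 0⟩ = 𝟙 _ ∧
      T ≫ (full (restrictionStable_meshExact hD n)).evalMor (B := Square.{w}) ⟨1, 1⟩ = φ := by
  let hres := restrictionStable_meshExact hD n
  let ι := fullIncl _ hres
  have hι : IsStrict ι := isStrict_fullIncl _ hres
  have hι' : IsStrict (fullInclShift _ hres Square.{w}) := isStrict_fullInclShift _ hres
  obtain ⟨T, h1, h2⟩ := exists_lift_fullInclShift hres (C := Square.{w})
    (ι ≫ D.resMor₂ (Mesh.susp n)) (hι.comp (D.isStrict_resMor₂ _))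
    (fun A X => meshExact_res_susp hD X.property)
  -- Evaluating the suspension squares at `s` is restriction along the slice of `Mesh.susp` at `s`:
  -- the identity for `(0,0)`, the flip for `(1,1)`.
  have key (s : Square.{w}) : (T ≫ (full hres).evalMor s) ≫ ι =
      ι ≫ D.resMor (CategoryTheory.Prod.sectL (Mesh.{w} n) s ⋙ Mesh.susp n) := by
    rw [← D.resMor₂_evalMor, ← hι.assoc (D.isStrict_resMor₂ _) (isStrict_evalMor _ s), ← h2]
    exact evalMor_comp_fullIncl hres h1 s
  have hs (s : Square.{w}) : IsStrict (T ≫ (full hres).evalMor s) :=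
    h1.comp ((full hres).isStrict_evalMor s)
  refine ⟨T, h2, ?_, ?_⟩
  · refine eq_of_comp_fullIncl hres (hs _) (IsStrict.id _) ((key _).trans ?_)
    rw [Mesh.sectL_zero_susp, resMor_id]
    exact hι.comp_id.trans hι.id_comp.symm
  · refine eq_of_comp_fullIncl hres (hs _) hφ ((key _).trans ?_)
    rw [Mesh.sectL_one_susp]
    exact h.symm

section Restriction

variable {hD} {A : (Cat.{w, w})ᵒᵖ}

lemma leftInduced_full_span {Y : D.val (Mesh.{w} n × (Square.{w} × A.unop))}
    {hY : D.MeshExact n (op (Cat.of (Square.{w} × A.unop))) Y}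
    (h : LeftInduced (D.res (spanFunctor (Mesh.{w} n) A.unop)) Y) :
    LeftInduced (((full (restrictionStable_meshExact hD n)).resMor spanIncl.{w}).app A).toFunctor
      ⟨Y, hY⟩ :=
  leftInduced_of_full (P := D.MeshExact n (op (Cat.of (Square.{w} × A.unop))))
    (P' := D.MeshExact n (op (Cat.of (SpanShape.{w} × A.unop))))
    (Ψ := D.res (spanFunctor (Mesh.{w} n) A.unop)) rfl h

lemma rightInduced_full_spanEval {Y : D.val (Mesh.{w} n × (SpanShape.{w} × A.unop))}
    {hY : D.MeshExact n (op (Cat.of (SpanShape.{w} × A.unop))) Y}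
    (h : ∀ b : Mesh.{w} n × (SpanShape.{w} × A.unop), b.2.1 ≠ spanZero →
      Limits.IsZero (valueAt Y b)) :
    RightInduced
      (((full (restrictionStable_meshExact hD n)).evalMor spanZero.{w}).app A).toFunctor
      ⟨Y, hY⟩ :=
  rightInduced_of_full (P := D.MeshExact n (op (Cat.of (SpanShape.{w} × A.unop))))
    (P' := D.MeshExact n A)
    (Ψ := D.res (spanEvalFunctor (Mesh.{w} n) A.unop)) rfl
    ((rightInduced_spanEvalFunctor_iff hD Y).2 h)

end Restriction

/-- The suspension of exact diagrams exists. -/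
theorem exists_isSuspension_full :
    ∃ S, (full (restrictionStable_meshExact hD n)).IsSuspension S := by
  have hD' := hD.toIsDerivator
  obtain ⟨H, hH⟩ := exists_leftAdjoint
    ((full (restrictionStable_meshExact hD n)).resMor spanIncl.{w})
    (fun A Y => LeftInduced (D.res (spanFunctor (Mesh.{w} n) A.unop)) Y.obj)
    (fun {A Y} h => leftInduced_full_span (hD := hD) h)
    (fun f _ h => leftInduced_spanFunctor_res hD' f.unop.toFunctor h)
    (fun {A} Y => by
      have := full_spanFunctor (M := Mesh.{w} n) (A := A.unop)
      have := faithful_spanFunctor (M := Mesh.{w} n) (A := A.unop)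
      obtain ⟨X, hX, ⟨e⟩⟩ := exists_leftInduced (spanFunctor (Mesh.{w} n) A.unop) hD' Y.obj
      -- The square is formed among all diagrams on `M_n`; commutation of left Kan extensions keeps
      -- it exact, so the adjoint restricts to the subprederivator.
      have hX' := meshExact_of_leftInduced hD hX (MeshExact.of_iso hD e.symm Y.property)
      exact ⟨⟨X, hX'⟩, hX, ⟨ObjectProperty.isoMk _ e⟩⟩)
  obtain ⟨G, hG⟩ := exists_rightAdjoint
    ((full (restrictionStable_meshExact hD n)).evalMor spanZero.{w})
    (fun A Y => ∀ b : Mesh.{w} n × (SpanShape.{w} × A.unop), b.2.1 ≠ spanZero →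
      Limits.IsZero (valueAt (D := D) (B := Mesh.{w} n × (SpanShape.{w} × A.unop)) Y.obj b))
    (fun {A Y} h => rightInduced_full_spanEval (hD := hD) h)
    (fun {A A'} f Y h b hb => (h (b.1, (b.2.1, f.unop.toFunctor.obj b.2.2)) hb).of_iso
      (resPt ((𝟭 (Mesh.{w} n)).prod ((𝟭 SpanShape.{w}).prod f.unop.toFunctor)) b Y.obj))
    (fun {A} Y => by
      have := full_spanEvalFunctor (M := Mesh.{w} n) (A := A.unop)
      have := faithful_spanEvalFunctor (M := Mesh.{w} n) (A := A.unop)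
      obtain ⟨X, hX, ⟨e⟩⟩ := exists_rightInduced (spanEvalFunctor (Mesh.{w} n) A.unop) hD' Y.obj
      have hX := (rightInduced_spanEvalFunctor_iff hD X).1 hX
      have hX' := meshExact_of_isZero hD hX (MeshExact.of_iso hD e.symm Y.property)
      exact ⟨⟨X, hX'⟩, hX, ⟨ObjectProperty.isoMk _ e⟩⟩)
  exact ⟨_, G, H, hG, hH, ⟨Iso.refl _⟩⟩

/-- The suspension of exact diagrams is the flip symmetry. -/
theorem nonempty_iso_of_isSuspension_full
    (φ : (full (restrictionStable_meshExact hD n)).toPseudofunctor ⟶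
      (full (restrictionStable_meshExact hD n)).toPseudofunctor) (hφ : IsStrict φ)
    (h : φ ≫ fullIncl _ (restrictionStable_meshExact hD n) =
      fullIncl _ (restrictionStable_meshExact hD n) ≫ D.resMor (Mesh.flip n))
    (S : (full (restrictionStable_meshExact hD n)).toPseudofunctor ⟶
      (full (restrictionStable_meshExact hD n)).toPseudofunctor)
    (hS : (full (restrictionStable_meshExact hD n)).IsSuspension S) : Nonempty (S ≅ φ) := by
  have hD' := hD.toIsDerivator
  obtain ⟨T, hT, h0, h1⟩ := exists_susp_full hD φ hφ h
  have hT (A : (Cat.{w, w})ᵒᵖ) (X : (full (restrictionStable_meshExact hD n)).obj A) :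
      ((T.app A).toFunctor.obj X).obj =
        (D.res (prodFunctor (Mesh.susp n) A.unop)).obj X.obj :=
    congrArg (fun t => (t.app A).toFunctor.obj X) hT
  have hX (A : (Cat.{w, w})ᵒᵖ) (X : (full (restrictionStable_meshExact hD n)).obj A)
      (a : A.unop) : D.MeshExactAt n ((D.res (CategoryTheory.Prod.sectL _ a)).obj X.obj) :=
    (meshExact_iff hD A _).1 X.property a
  rw [← h1]
  refine nonempty_iso_of_isSuspension T (eqToIso h0) (fun A X => ?_) (fun A X => ?_) S hS
  · refine leftInduced_full_span (hD := hD) (hY := ((T.app A).toFunctor.obj X).property) ?_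
    rw [hT, leftInduced_spanFunctor_iff hD']
    intro m a
    refine ((cocartAt_iff_leftInduced hD' _ _).1 ((hX A X a).cocartAt_susp hD m)).of_iso ?_
    exact D.resComp₂ (k := CategoryTheory.Prod.sectR m Square.{w} ⋙ Mesh.susp n)
      (k' := CategoryTheory.Prod.sectL _ a) (l := squareAt m a)
      (l' := prodFunctor (Mesh.susp n) A.unop) rfl _
  · refine rightInduced_full_spanEval (hD := hD)
      (hY := (((T ≫ resMor _ spanIncl).app A).toFunctor.obj X).property) ?_
    rintro ⟨m, p, a⟩ hp
    have hp' : p.1 = ⟨1, 0⟩ ∨ p.1 = ⟨0, 1⟩ := by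
      obtain ⟨⟨x, y⟩, hs⟩ := p
      fin_cases x <;> fin_cases y <;> simp [spanZero] at hs hp ⊢
    -- The two arms `(k, n + 1)` and `(k + l, 0)` lie on the boundary, where exact diagrams vanish.
    refine ((hX A X a).1 ((Mesh.susp n).obj (m, p.1)) ?_).of_iso ?_
    · rcases hp' with h | h <;> rw [h] <;> simp [Mesh.susp]
      omega
    · refine resPt (spanFunctor (Mesh.{w} n) A.unop) (m, (p, a))
          ((T.app A).toFunctor.obj X).obj ≪≫ eqToIso (by rw [hT]; rfl) ≪≫
        resPt (prodFunctor (Mesh.susp n) A.unop) (m, (p.1, a)) X.obj ≪≫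
        (resPt (CategoryTheory.Prod.sectL _ a) _ X.obj).symm

end ExactDiagrams

end Prederivator

end DerivatorTheory

open DerivatorTheory
theorem mainTheorem4 (D : Prederivator.{w, v, u}) (hD : D.IsStableDerivator) (n : ℕ) (hn : 1 ≤ n) :
    (∃ hres : (D.shift (Mesh.{w} n)).RestrictionStable (D.MeshExact n),
      Prederivator.IsStrictIso (D.resMor (Mesh.flip.{w} n)) ∧
      ∃ φ : (Prederivator.full hres).toPseudofunctor ⟶ (Prederivator.full hres).toPseudofunctor,
        φ ≫ Prederivator.fullIncl _ hres = Prederivator.fullIncl _ hres ≫ D.resMor (Mesh.flip n) ∧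
        Prederivator.IsStrictIso φ ∧
        (∃ S, (Prederivator.full hres).IsSuspension S) ∧
        ∀ S, (Prederivator.full hres).IsSuspension S → Nonempty (S ≅ φ)) ∧
    (∃ F, D.IsMeshExtension n F) ∧
    (∃ S, (D.shift (LinQuiver.{w} n)).IsSuspension S) ∧
    ∀ F S, D.IsMeshExtension n F → (D.shift (LinQuiver.{w} n)).IsSuspension S →
      Nonempty (S ≅ F ≫ D.resMor (Mesh.j n)) := by
  obtain ⟨φ, h₁, h₂, h₃⟩ := Prederivator.exists_flip_full (n := n) hD
  exact ⟨⟨Prederivator.restrictionStable_meshExact hD n, Prederivator.isStrictIso_resMor_flip D n,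
      φ, h₂, h₃, Prederivator.exists_isSuspension_full hD,
      Prederivator.nonempty_iso_of_isSuspension_full hD φ h₁ h₂⟩,
    Prederivator.exists_isMeshExtension hD.toIsDerivator n,
    Prederivator.exists_isSuspension_shift hD _,
    Prederivator.nonempty_iso_of_isMeshExtension hD⟩
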